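/- Let $G$ be a connected multigraph with $V$ vertices and $I$ oriented lines, without loops (lines joining a vertex to itself) and such that every vertex is an endpoint of at least two lines. Let $s^v_i=+1$ if line $i$ is oriented into $v$, $-1$ if it is oriented away from $v$, and $0$ otherwise. Let $N_v$ be integers attached to the vertices with $\sum_v N_v=0$, and for positive reals $q=(q_1,\dots,q_I)$ let $$S_G(N,q)=\sum_{n\in\mathbb Z^I}\ \prod_{v}\delta_{\sum_i s^v_i n_i,\,N_v}\ \prod_{i=1}^I\frac{1}{n_i^2+q_i^2}.$$ Let $L=I-V+1$. Let $T$ be any spanning tree of $G$. Given real values $x_l$ for the $L$ lines $l\notin T$, the equations $\sum_i s^v_i x_i=N_v$ (for all $v$) determine the remaining $x_j$, $j\in T$, uniquely; put $$I_G(N,q)=\int_{\mathbb R^{L}}\ \prod_{i=1}^I\frac1{x_i^2+q_i^2}\ \prod_{l\notin T}dx_l .$$ Then the sum and the integral converge for all positive $q$, and $I_G(N,\cdot)$ agrees on positive $q$ with a (unique) rational function of $q$ that is regular there; it is again denoted by $I_G$ and also evaluated at $q_i$ of either sign. Let $\hat R_i$ be the operator that replaces $q_i$ by $-q_i$ in a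 function of $q$, and $n_i=1/(e^{2\pi q_i}-1)$. A cutset is a set of lines whose removal leaves a disconnected graph. Let $$\hat{\mathcal O}'_G=\sum_{C\ \text{not a cutset}}\ \prod_{i\in C} n_i\,(1-\hat R_i),$$ i.e. the expansion of $\prod_i[1+n_i(1-\hat R_i)]$ with every term indexed by a cutset removed. Then every set $C$ occurring in this sum has at most $L$ lines, and $$S_G(N,q)=\hat{\mathcal O}'_G\, I_G(N,q)$$ at every positive $q$ at which none of the reflected values of $I_G$, obtained by changing the signs of $q_i$, $i\in D$, for a non-cutset $D$, falls on a pole. These $q$ are dense among the positive $q$, and at every positive $q$ the right-hand side, taken as the limit through such points, equals $S_G(N,q)$. The same holds with $\hat{\mathcal O}'_G$ replaced by $$1+\sum_{i=1}^I n_i(1-\hat R_i)+\sum_{k=2}^{L}\ \sum_{\substack{|C|=k\\ C\ \text{not a cutset}}}\ \prod_{i\in C}n_i(1-\hat R_i),$$ where the linear terms of all lines, also of bridges, are kept. -/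

import Mathlib

open MeasureTheory Filter Topology

noncomputable section

/-- A multigraph with point set `V` and line set `E`, every line carrying an orientation. -/
structure OrientedMultigraph (V E : Type*) where
  /-- the point that a line is oriented away from -/
  src : E → V
  /-- the point that a line is oriented into -/
  tgt : E → V

/-- The Bose-Einstein kernel. -/
def nbe (z : ℝ) : ℝ := 1 / (Real.exp (2 * Real.pi * z) - 1)

section Operators

variable {E : Type*} [DecidableEq E]

/-- The point `q` with the signs of the coordinates in `D` reversed. -/
def flipSigns (D : Finset E) (q : E → ℝ) : E → ℝ := fun i => if i ∈ D then - q i else q i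

/-- The reflection operator `R̂ᵢ` on functions of the variables `q`. -/
def reflectionOp (i : E) : Module.End ℝ ((E → ℝ) → ℝ) where
  toFun f := fun q => f (Function.update q i (- q i))
  map_add' _ _ := rfl
  map_smul' _ _ := rfl

/-- Multiplication by `n(qᵢ)`. -/
def kernelOp (i : E) : Module.End ℝ ((E → ℝ) → ℝ) where
  toFun f := fun q => nbe (q i) * f q
  map_add' f g := by funext q; simp [mul_add]
  map_smul' c f := by funext q; simp [mul_left_comm]

/-- The operator `nᵢ (1 - R̂ᵢ)`. -/
def lineOp (i : E) : Module.End ℝ ((E → ℝ) → ℝ) := kernelOp i * (1 - reflectionOp i)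

theorem lineOp_apply (i : E) (f : (E → ℝ) → ℝ) (q : E → ℝ) :
    lineOp i f q = nbe (q i) * (f q - f (Function.update q i (- q i))) := rfl

theorem lineOp_commute {i j : E} (h : i ≠ j) : Commute (lineOp i) (lineOp j) := by
  apply LinearMap.ext
  intro f
  funext q
  simp only [Module.End.mul_apply, lineOp_apply, Function.update_of_ne h,
    Function.update_of_ne h.symm]
  rw [Function.update_comm h]
  ring

/-- The operator `∏_{i ∈ C} nᵢ (1 - R̂ᵢ)` (the factors commute). -/
def termOp (C : Finset E) : Module.End ℝ ((E → ℝ) → ℝ) :=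
  C.noncommProd lineOp fun _ _ _ _ h => lineOp_commute h

end Operators

section RationalContinuation

variable {E : Type*}

/-- `f`, a function on the open positive orthant, is there the quotient `P / D` of two real
polynomials with `D q ≠ 0`, and `v = P q / D q`. -/
def IsRationalValue (f : (E → ℝ) → ℝ) (q : E → ℝ) (v : ℝ) : Prop :=
  ∃ P D : MvPolynomial E ℝ,
    (∀ x : E → ℝ, (∀ i, 0 < x i) → MvPolynomial.eval x P = f x * MvPolynomial.eval x D) ∧
    MvPolynomial.eval q D ≠ 0 ∧ v = MvPolynomial.eval q P / MvPolynomial.eval q D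

/-- The points at which the rational function that agrees with `f` on the open positive orthant
exists and is regular. -/
def rationalDomain (f : (E → ℝ) → ℝ) : Set (E → ℝ) := {q | ∃ v, IsRationalValue f q v}

open Classical in
/-- The rational function that agrees with `f` on the open positive orthant (0 outside of its
domain of regularity). -/
def rationalContinuation (f : (E → ℝ) → ℝ) (q : E → ℝ) : ℝ :=
  if h : ∃ v, IsRationalValue f q v then h.choose else 0

/-- The value does not depend on the polynomials that represent the function. -/
theorem IsRationalValue.unique {f : (E → ℝ) → ℝ} {q : E → ℝ} {v w : ℝ}
    (hv : IsRationalValue f q v) (hw : IsRationalValue f q w) : v = w := by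
  obtain ⟨P, D, h, hD, rfl⟩ := hv
  obtain ⟨P', D', h', hD', rfl⟩ := hw
  have key : P * D' = P' * D := by
    apply MvPolynomial.funext_set (fun _ => Set.Ioi (0 : ℝ)) (fun _ => Set.Ioi_infinite 0)
    intro x hx
    have hx' : ∀ i, 0 < x i := fun i => hx i (Set.mem_univ i)
    simp only [map_mul, h x hx', h' x hx']
    ring
  rw [div_eq_div_iff hD hD']
  simpa using congrArg (MvPolynomial.eval q) key

end RationalContinuation

namespace OrientedMultigraph

variable {V E : Type*}

/-- Adjacency of points through at least one line of `A`. -/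
def graphOn (G : OrientedMultigraph V E) (A : Set E) : SimpleGraph V :=
  SimpleGraph.fromRel fun u v => ∃ e ∈ A, G.src e = u ∧ G.tgt e = v

/-- Removing the lines in `C` (and no point) leaves a disconnected graph. -/
def IsCutset (G : OrientedMultigraph V E) (C : Finset E) : Prop :=
  ¬ (G.graphOn {e | e ∉ C}).Connected

variable [Fintype V] [Fintype E] [DecidableEq V] [DecidableEq E]

/-- Matsubara graphs: connected, no line joins a point to itself, and each point is an endpoint
of at least two lines. -/
structure IsMatsubara (G : OrientedMultigraph V E) : Prop where
  connected : (G.graphOn Set.univ).Connected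
  loopless : ∀ e, G.src e ≠ G.tgt e
  two_le_degree : ∀ v, 2 ≤ (Finset.univ.filter fun e => G.src e = v ∨ G.tgt e = v).card

/-- Spanning trees: `T` connects all points and has `|V| - 1` lines (equivalently, it contains
no cycle). -/
def IsSpanningTree (G : OrientedMultigraph V E) (T : Finset E) : Prop :=
  (G.graphOn {e | e ∈ T}).Connected ∧ T.card + 1 = Fintype.card V

/-- The number `L = |E| - |V| + 1` of independent cycles of a connected graph. -/
def cycleRank (_G : OrientedMultigraph V E) : ℕ := Fintype.card E + 1 - Fintype.card V

/-- `+1` if the line is oriented into `v`, `-1` if it is oriented away from `v`, else `0`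
(for a line that joins two different points). -/
def sign (G : OrientedMultigraph V E) (v : V) (e : E) : ℤ :=
  (if G.tgt e = v then 1 else 0) - (if G.src e = v then 1 else 0)

/-- `T_v = ∑ᵢ sᵢᵛ nᵢ`. -/
def vertexSum (G : OrientedMultigraph V E) {R : Type*} [Ring R] (n : E → R) (v : V) : R :=
  ∑ e, (G.sign v e : R) * n e

/-- The summand of the Matsubara sum, with the product of Kronecker deltas. -/
def summand (G : OrientedMultigraph V E) (N : V → ℤ) (q : E → ℝ) (n : E → ℤ) : ℝ :=
  (∏ v, if G.vertexSum n v = N v then (1 : ℝ) else 0) / ∏ e, ((n e : ℝ) ^ 2 + q e ^ 2)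

/-- The Matsubara sum. -/
def matsubaraSum (G : OrientedMultigraph V E) (N : V → ℤ) (q : E → ℝ) : ℝ :=
  ∑' n : E → ℤ, G.summand N q n

/-- `x` solves the constraints `T_v = N_v` and has the prescribed values `y` off `T`. -/
def IsSolution (G : OrientedMultigraph V E) (N : V → ℤ) (T : Finset E)
    (y : {l // l ∉ T} → ℝ) (x : E → ℝ) : Prop :=
  (∀ v, G.vertexSum x v = N v) ∧ ∀ l, x l.1 = y l

/-- The solution of the constraints in terms of the variables of the lines off `T`. -/
def solution (G : OrientedMultigraph V E) (N : V → ℤ) (T : Finset E)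
    (y : {l // l ∉ T} → ℝ) : E → ℝ :=
  Classical.epsilon (G.IsSolution N T y)

/-- The summand with real variables, the constraints being solved in terms of the variables of
the lines off `T`. -/
def integrand (G : OrientedMultigraph V E) (N : V → ℤ) (T : Finset E) (q : E → ℝ)
    (y : {l // l ∉ T} → ℝ) : ℝ :=
  1 / ∏ e, (G.solution N T y e ^ 2 + q e ^ 2)

/-- The Matsubara integral, as an integral over the independent variables (for positive `q`). -/
def integralValue (G : OrientedMultigraph V E) (N : V → ℤ) (T : Finset E) (q : E → ℝ) : ℝ :=
  ∫ y : {l // l ∉ T} → ℝ, G.integrand N T q y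

/-- The evaluation of the Matsubara integral as a rational function of `q`, on which reflections
act. (The integral itself is even in each `qᵢ`; its evaluation for positive `q` is not.) -/
def matsubaraIntegral (G : OrientedMultigraph V E) (N : V → ℤ) (T : Finset E) :
    (E → ℝ) → ℝ :=
  rationalContinuation (G.integralValue N T)

/-- The positive `q` for which none of the values of the Matsubara integral that enter
`Ô'_G I_G` is taken at a pole. -/
def regularSet (G : OrientedMultigraph V E) (N : V → ℤ) (T : Finset E) : Set (E → ℝ) :=
  {q | (∀ i, 0 < q i) ∧
    ∀ D, ¬ G.IsCutset D → flipSigns D q ∈ rationalDomain (G.integralValue N T)}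

open Classical in
/-- The expansion of `∏ᵢ [1 + nᵢ (1 - R̂ᵢ)]` without the terms indexed by cutsets. -/
def reducedOp (G : OrientedMultigraph V E) : Module.End ℝ ((E → ℝ) → ℝ) :=
  ∑ C : Finset E with ¬ G.IsCutset C, termOp C

open Classical in
/-- The same operator sorted by degree, with the linear terms of all lines (also of bridges). -/
def gradedOp (G : OrientedMultigraph V E) : Module.End ℝ ((E → ℝ) → ℝ) :=
  1 + ∑ i : E, lineOp i +
    ∑ k ∈ Finset.Icc 2 G.cycleRank,
      ∑ C ∈ Finset.powersetCard k Finset.univ with ¬ G.IsCutset C, termOp C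

end OrientedMultigraph

end

/-! The Kronecker deltas are written as integrals over times `θ v ∈ (0, 2π]`, one point `o` being
held at time 0. The sum over each `n_i` then gives the propagator of a circle, a combination of `exp
(-q x)` and `exp (q x)` whose weights are the values of `thermalWeight` at `q` and at `-q`.
Expanding the product over the lines turns `S_G` into a sum over sign reversals `D` of time
integrals of pure exponentials.

In such an integral, let `X` be the set of points already passed. Between consecutive events the
integrand decays at the rate `cutWeight X`, the sum of the `q_e` over the boundary of `X` minus an
imaginary integer. Conditioning on the latest time gives a triangular linear system, which is solved
by explicit eigenvectors (`evolution`). At time `2π` the factor `exp (-2π · cutWeight)` only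
reverses signs in the thermal weights (`prod_thermalWeight_mul_exp`), so all exponentials are
absorbed by reindexing the sum over `D`. What is left are products of energy denominators along
maximal chains of point sets (`sum_thermalWeight_mul_evolution`, `rootedChainSum_eq`), and `S_G =
∑_D ∏ boseWeight (±q) · J (±q)` with the rational function `J = chainIntegral`. Since `boseWeight`
is `1 + n` at `q` and `-n` at `-q`, this is the full expansion of `∏ (1 + n_i (1 - R_i)) J`
(`sum_termOp_apply`).

That `J` is `I_G` follows by scaling: under `N → mN`, `q → mq` the sum becomes a Riemann sum for
`I_G`, `J` is homogeneous, and the Bose weights tend to 1 for `D = ∅` and to 0 otherwise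
(`integralValue_eq_chainIntegral_of_isGeneric`).

The terms of cutsets vanish. If `C` contains the boundary of a nonempty proper set `A`, then summing
over reversals in `C` decouples the chains in `A` from those in its complement
(`orbitSum_mul_chainSum`); recombining the two produces the denominator of the set of all points,
which is 0 (`sum_fullChainSum_eq_zero`).

All this is done for generic `q`, where no denominator vanishes and all rates differ; density and
continuity give the remaining points. A bridge carries a fixed momentum, so `I_G` depends on its
`q_i` only through `1 / (m² + q_i²)`, and its linear term is zero. -/

noncomputable section

/-! ### Chain sums and the triangular evolution system. -/

section ChainSum

variable {V : Type*} [DecidableEq V]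

/-- The sum over the maximal chains `∅ ⊂ X₁ ⊂ ⋯ ⊂ X` of the products of the `1 / c Xₖ`. -/
def chainSum (c : Finset V → ℂ) (X : Finset V) : ℂ :=
  if X = ∅ then 1 else (∑ v : {v // v ∈ X}, chainSum c (X.erase v.1)) / c X
termination_by X.card
decreasing_by exact Finset.card_erase_lt_of_mem v.2

theorem chainSum_empty (c : Finset V → ℂ) : chainSum c ∅ = 1 := by
  rw [chainSum]; simp

theorem chainSum_of_nonempty (c : Finset V → ℂ) {X : Finset V} (hX : X.Nonempty) :
    chainSum c X = (∑ v ∈ X, chainSum c (X.erase v)) / c X := by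
  rw [chainSum, if_neg hX.ne_empty, Finset.sum_coe_sort X (fun v => chainSum c (X.erase v))]

theorem mul_chainSum (c : Finset V → ℂ) {X : Finset V} (hX : X.Nonempty) (h : c X ≠ 0) :
    c X * chainSum c X = ∑ v ∈ X, chainSum c (X.erase v) := by
  rw [chainSum_of_nonempty c hX, mul_div_cancel₀ _ h]

theorem chainSum_congr {c c' : Finset V → ℂ} {X : Finset V}
    (h : ∀ Y ⊆ X, Y.Nonempty → c Y = c' Y) : chainSum c X = chainSum c' X := by
  induction X using Finset.strongInduction with
  | H X ih =>
    rcases X.eq_empty_or_nonempty with rfl | hX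
    · simp [chainSum_empty]
    · rw [chainSum_of_nonempty c hX, chainSum_of_nonempty c' hX, h X subset_rfl hX]
      congr 1
      exact Finset.sum_congr rfl fun v hv => ih _ (Finset.erase_ssubset hv)
        fun Y hY => h Y (hY.trans (Finset.erase_subset _ _))

theorem chainSum_smul (a : ℂ) (c : Finset V → ℂ) (X : Finset V) :
    chainSum (fun Y => a * c Y) X = (a⁻¹) ^ X.card * chainSum c X := by
  induction X using Finset.strongInduction with
  | H X ih =>
    rcases X.eq_empty_or_nonempty with rfl | hX
    · simp [chainSum_empty]
    · rw [chainSum_of_nonempty _ hX, chainSum_of_nonempty c hX,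
        Finset.sum_congr rfl fun v hv => (ih _ (Finset.erase_ssubset hv)).trans
          (by rw [Finset.card_erase_of_mem hv]), ← Finset.mul_sum]
      obtain ⟨k, hk⟩ := Nat.exists_eq_succ_of_ne_zero hX.card_pos.ne'
      rw [hk]
      simp only [Nat.succ_sub_one, pow_succ]
      simp only [div_eq_mul_inv, mul_inv]
      ring

/-- The coefficients of the right eigenvector with eigenvalue `d A`. -/
def rightChain (d : Finset V → ℂ) (A X : Finset V) : ℂ :=
  chainSum (fun Y => d (A ∪ Y) - d A) (X \ A)

/-- The coefficients of the left eigenvector with eigenvalue `d A`. -/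
def leftChain (d : Finset V → ℂ) (A Y : Finset V) : ℂ :=
  chainSum (fun Z => d (A \ Z) - d A) (A \ Y)

/-- Eigenvector equation for the triangular system `f_X' = -d X f_X + ∑ v ∈ X, f_(X \ v)` at the
exponent `-d A`. It is the recursion of `chainSum` with the shifted weights `d - d A`; the sum over
`X \ A` keeps the vector supported on the supersets of `A`. -/
theorem mul_rightChain {d : Finset V → ℂ} {A X : Finset V} (hA : A ⊆ X)
    (hd : A ≠ X → d X ≠ d A) :
    (d X - d A) * rightChain d A X = ∑ v ∈ X \ A, rightChain d A (X.erase v) := by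
  by_cases h : A = X
  · subst h; simp
  · have hne : (X \ A).Nonempty := by
      rw [Finset.sdiff_nonempty]; exact fun h' => h (hA.antisymm h')
    have := mul_chainSum (fun Y => d (A ∪ Y) - d A) hne
      (by rw [Finset.union_sdiff_of_subset hA]; exact sub_ne_zero.2 (hd h))
    rw [Finset.union_sdiff_of_subset hA] at this
    rw [rightChain, this]
    refine Finset.sum_congr rfl fun v _ => ?_
    rw [rightChain, Finset.erase_sdiff_comm]

theorem mul_leftChain {d : Finset V → ℂ} {A Y : Finset V} (hA : Y ⊆ A)
    (hd : Y ≠ A → d Y ≠ d A) :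
    (d Y - d A) * leftChain d A Y = ∑ v ∈ A \ Y, leftChain d A (insert v Y) := by
  by_cases h : Y = A
  · subst h; simp
  · have hne : (A \ Y).Nonempty := by
      rw [Finset.sdiff_nonempty]; exact fun h' => h (hA.antisymm h')
    have := mul_chainSum (fun Z => d (A \ Z) - d A) hne
      (by rw [Finset.sdiff_sdiff_eq_self hA]; exact sub_ne_zero.2 (hd h))
    rw [Finset.sdiff_sdiff_eq_self hA] at this
    rw [leftChain, this]
    refine Finset.sum_congr rfl fun v _ => ?_
    rw [leftChain, Finset.sdiff_insert]

/-- Left and right eigenvectors of a triangular matrix with distinct diagonal entries are dual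
bases. Multiplying the sum by `d X - d Y = (d X - d A) - (d Y - d A)` makes the two eigenvector
equations applicable; each part reduces by induction to pairs that are closer together, and both
count the `v` with `X = insert v Y`. -/
theorem sum_leftChain_mul_rightChain {d : Finset V → ℂ} {X₀ : Finset V}
    (hd : ∀ Y X, Y ⊂ X → X ⊆ X₀ → d Y ≠ d X) {X Y : Finset V} (hYX : Y ⊆ X) (hX : X ⊆ X₀) :
    ∑ A ∈ Finset.Icc Y X, leftChain d A Y * rightChain d A X = if Y = X then 1 else 0 := by
  induction hn : (X \ Y).card using Nat.strong_induction_on generalizing X Y with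
  | _ n ih =>
  subst hn
  split_ifs with h
  · subst h; simp [leftChain, rightChain, chainSum_empty]
  have hlt : Y ⊂ X := hYX.ssubset_of_ne h
  have hne : d X - d Y ≠ 0 := sub_ne_zero.2 (hd Y X hlt hX).symm
  have e1 : ∑ A ∈ Finset.Icc Y X, leftChain d A Y * ((d X - d A) * rightChain d A X) =
      ∑ v ∈ X \ Y, if Y = X.erase v then 1 else 0 := by
    have : ∀ A ∈ Finset.Icc Y X, leftChain d A Y * ((d X - d A) * rightChain d A X) =
        ∑ v ∈ X \ A, leftChain d A Y * rightChain d A (X.erase v) := by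
      intro A hA
      rw [Finset.mem_Icc] at hA
      rw [mul_rightChain hA.2 fun h' => (hd A X (hA.2.ssubset_of_ne h') hX).symm, Finset.mul_sum]
    rw [Finset.sum_congr rfl this, Finset.sum_comm' (s' := fun v => Finset.Icc Y (X.erase v))
      (t' := X \ Y)]
    · refine Finset.sum_congr rfl fun v hv => ?_
      rw [Finset.mem_sdiff] at hv
      refine ih _ ?_ (Finset.subset_erase.2 ⟨hYX, hv.2⟩) ((Finset.erase_subset _ _).trans hX) rfl
      rw [Finset.erase_sdiff_comm]
      exact Finset.card_erase_lt_of_mem (Finset.mem_sdiff.2 hv)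
    · intro A v
      simp only [Finset.mem_Icc, Finset.mem_sdiff, Finset.subset_erase]
      constructor
      · rintro ⟨⟨h1, h2⟩, h3, h4⟩
        exact ⟨⟨h1, h2, h4⟩, h3, fun h' => h4 (h1 h')⟩
      · rintro ⟨⟨h1, h2, h4⟩, h3, h5⟩
        exact ⟨⟨h1, h2⟩, h3, h4⟩
  have e2 : ∑ A ∈ Finset.Icc Y X, ((d Y - d A) * leftChain d A Y) * rightChain d A X =
      ∑ v ∈ X \ Y, if insert v Y = X then 1 else 0 := by
    have : ∀ A ∈ Finset.Icc Y X, ((d Y - d A) * leftChain d A Y) * rightChain d A X =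
        ∑ v ∈ A \ Y, leftChain d A (insert v Y) * rightChain d A X := by
      intro A hA
      rw [Finset.mem_Icc] at hA
      rw [mul_leftChain hA.1 fun h' => hd Y A (hA.1.ssubset_of_ne h') (hA.2.trans hX),
        Finset.sum_mul]
    rw [Finset.sum_congr rfl this, Finset.sum_comm' (s' := fun v => Finset.Icc (insert v Y) X)
      (t' := X \ Y)]
    · refine Finset.sum_congr rfl fun v hv => ?_
      have hv' := Finset.mem_sdiff.1 hv
      refine ih _ ?_ (Finset.insert_subset hv'.1 hYX) hX rfl
      rw [Finset.sdiff_insert]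
      exact Finset.card_erase_lt_of_mem hv
    · intro A v
      simp only [Finset.mem_Icc, Finset.mem_sdiff, Finset.insert_subset_iff]
      constructor
      · rintro ⟨⟨h1, h2⟩, h3, h4⟩
        exact ⟨⟨⟨h3, h1⟩, h2⟩, h2 h3, h4⟩
      · rintro ⟨⟨⟨h1, h2⟩, h4⟩, h3, h5⟩
        exact ⟨⟨h2, h4⟩, h1, h5⟩
  have e3 : ∑ v ∈ X \ Y, (if Y = X.erase v then (1 : ℂ) else 0) =
      ∑ v ∈ X \ Y, if insert v Y = X then 1 else 0 := by
    refine Finset.sum_congr rfl fun v hv => if_congr ?_ rfl rfl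
    rw [Finset.mem_sdiff] at hv
    constructor
    · intro h'; rw [h', Finset.insert_erase hv.1]
    · intro h'; rw [← h', Finset.erase_insert hv.2]
  apply mul_left_cancel₀ hne
  rw [mul_zero, ← sub_eq_zero.2 (e1.trans (e3.trans e2.symm)), ← Finset.sum_sub_distrib,
    Finset.mul_sum]
  exact Finset.sum_congr rfl fun A _ => by ring

/-- The solution of the evolution equations in terms of eigenvectors. -/
def evolution (d : Finset V → ℂ) (X : Finset V) (t : ℝ) : ℂ :=
  ∑ A ∈ X.powerset, leftChain d A ∅ * rightChain d A X * Complex.exp (-(d A * t))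

theorem evolution_zero {d : Finset V → ℂ} {X : Finset V} (hX : X.Nonempty)
    (hd : ∀ Y Z, Y ⊂ Z → Z ⊆ X → d Y ≠ d Z) : evolution d X 0 = 0 := by
  have := sum_leftChain_mul_rightChain hd (Finset.empty_subset X) subset_rfl
  rw [if_neg hX.ne_empty.symm] at this
  rw [evolution, ← this, ← Finset.bot_eq_empty, ← Finset.Iic_eq_Icc]
  simp [Finset.Iic_eq_powerset]

/-- The factor `exp (d X s)` removes the diagonal term of the system, so that only the coupling to
the smaller sets remains in the derivative. -/
theorem hasDerivAt_evolution {d : Finset V → ℂ} {X : Finset V}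
    (hd : ∀ Y Z, Y ⊂ Z → Z ⊆ X → d Y ≠ d Z) (t : ℝ) :
    HasDerivAt (fun s : ℝ => Complex.exp (d X * s) * evolution d X s)
      (Complex.exp (d X * t) * ∑ v ∈ X, evolution d (X.erase v) t) t := by
  have key : ∑ v ∈ X, evolution d (X.erase v) t =
      ∑ A ∈ X.powerset, (d X - d A) * (leftChain d A ∅ * rightChain d A X) *
        Complex.exp (-(d A * t)) := by
    have : ∀ A ∈ X.powerset, (d X - d A) * (leftChain d A ∅ * rightChain d A X) *
        Complex.exp (-(d A * t)) =
        ∑ v ∈ X \ A, leftChain d A ∅ * rightChain d A (X.erase v) * Complex.exp (-(d A * t)) := by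
      intro A hA
      rw [Finset.mem_powerset] at hA
      rw [← Finset.sum_mul, ← Finset.mul_sum,
        ← mul_rightChain hA fun h' => (hd A X (hA.ssubset_of_ne h') subset_rfl).symm]
      ring
    rw [Finset.sum_congr rfl this, Finset.sum_comm' (s' := fun v => (X.erase v).powerset)
      (t' := X)]
    · rfl
    · intro A v
      simp only [Finset.mem_powerset, Finset.mem_sdiff, Finset.subset_erase]
      tauto
  have e : (fun s : ℝ => Complex.exp (d X * s) * evolution d X s) =
      fun s : ℝ => ∑ A ∈ X.powerset, leftChain d A ∅ * rightChain d A X *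
        Complex.exp ((d X - d A) * s) := by
    funext s
    rw [evolution, Finset.mul_sum]
    refine Finset.sum_congr rfl fun A _ => ?_
    rw [sub_mul, sub_eq_add_neg, Complex.exp_add]
    ring
  rw [e, key, Finset.mul_sum]
  apply HasDerivAt.fun_sum
  intro A _
  have h1 : HasDerivAt (fun s : ℝ => (d X - d A) * (s : ℂ)) (d X - d A) t := by
    simpa using (Complex.ofRealCLM.hasDerivAt (x := t)).const_mul (d X - d A)
  refine (h1.cexp.const_mul (leftChain d A ∅ * rightChain d A X)).congr_deriv ?_
  rw [sub_mul (d X), sub_eq_add_neg (d X * (t:ℂ)), Complex.exp_add]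
  ring

theorem continuous_evolution (d : Finset V → ℂ) (X : Finset V) : Continuous (evolution d X) := by
  unfold evolution
  fun_prop

theorem evolution_eq_integral {d : Finset V → ℂ} {X : Finset V} (hX : X.Nonempty)
    (hd : ∀ Y Z, Y ⊂ Z → Z ⊆ X → d Y ≠ d Z) (t : ℝ) :
    evolution d X t = ∫ s in (0 : ℝ)..t, Complex.exp (-(d X * (t - s))) *
      ∑ v ∈ X, evolution d (X.erase v) s := by
  have hc : Continuous fun s : ℝ => Complex.exp (d X * s) * ∑ v ∈ X, evolution d (X.erase v) s :=
    (by fun_prop : Continuous fun s : ℝ => Complex.exp (d X * s)).mul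
      (continuous_finsetSum _ fun v _ => continuous_evolution d _)
  have h := intervalIntegral.integral_eq_sub_of_hasDerivAt
    (fun s _ => hasDerivAt_evolution hd s) (hc.intervalIntegrable 0 t)
  rw [evolution_zero hX hd, mul_zero, sub_zero] at h
  calc evolution d X t = Complex.exp (-(d X * t)) * (Complex.exp (d X * t) * evolution d X t) := by
        rw [← mul_assoc, ← Complex.exp_add]; simp
    _ = _ := by
        rw [← h, ← intervalIntegral.integral_const_mul]
        refine intervalIntegral.integral_congr fun s _ => ?_
        rw [← mul_assoc, ← Complex.exp_add]
        congr 2; ring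

/-- The evolution equations have a unique solution. -/
theorem eq_evolution {d : Finset V → ℂ} {X₀ : Finset V}
    (hd : ∀ Y Z, Y ⊂ Z → Z ⊆ X₀ → d Y ≠ d Z) (G : Finset V → ℝ → ℂ)
    (h0 : ∀ t : ℝ, 0 ≤ t → G ∅ t = Complex.exp (-(d ∅ * t)))
    (h1 : ∀ X ⊆ X₀, X.Nonempty → ∀ t : ℝ, 0 ≤ t → G X t =
      ∫ s in (0 : ℝ)..t, Complex.exp (-(d X * (t - s))) * ∑ v ∈ X, G (X.erase v) s)
    {X : Finset V} (hX : X ⊆ X₀) {t : ℝ} (ht : 0 ≤ t) : G X t = evolution d X t := by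
  induction X using Finset.strongInduction generalizing t with
  | H X ih =>
    rcases X.eq_empty_or_nonempty with rfl | hne
    · rw [h0 t ht]; simp [evolution, leftChain, rightChain, chainSum_empty]
    · rw [h1 X hX hne t ht, evolution_eq_integral hne fun Y Z hY hZ => hd Y Z hY (hZ.trans hX)]
      refine intervalIntegral.integral_congr fun s hs => ?_
      rw [Set.uIcc_of_le ht] at hs
      congr 1
      exact Finset.sum_congr rfl fun v hv => ih _ (Finset.erase_ssubset hv)
        ((Finset.erase_subset _ _).trans hX) hs.1

variable [Fintype V]

/-- The sum over the maximal chains that are cut at the step where `o` is adjoined. -/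
def rootedChainSum (o : V) (c : Finset V → ℂ) : ℂ :=
  ∑ B ∈ (Finset.univ.erase o).powerset,
    chainSum c B * chainSum (fun Z => c Zᶜ) (insert o B)ᶜ

/-- The sum over all maximal chains between `∅` and `univ` of the product of the `1 / c X` of their
inner members. -/
def fullChainSum (c : Finset V → ℂ) : ℂ := ∑ v, chainSum c (Finset.univ.erase v)

/-- Both sides sum the same products over maximal chains: one cuts the chain where `o` enters, the
other at its last step. They are compared by telescoping: for a proper `X` containing `o`, `c X`
times (lower sum times upper sum) can be expanded by removing a point or by adjoining one. -/
theorem rootedChainSum_eq (o : V) {c : Finset V → ℂ}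
    (hc : ∀ X : Finset V, X.Nonempty → X ≠ Finset.univ → c X ≠ 0) :
    rootedChainSum o c = fullChainSum c := by
  classical
  set up : Finset V → ℂ := fun X => chainSum (fun Z => c Zᶜ) Xᶜ with hup
  have hup' : ∀ X : Finset V, X.Nonempty → X ≠ Finset.univ →
      c X * up X = ∑ v ∈ Xᶜ, up (insert v X) := by
    intro X h1 h2
    have hne : Xᶜ.Nonempty := by
      rw [Finset.nonempty_iff_ne_empty]; simpa using h2
    have := mul_chainSum (fun Z => c Zᶜ) hne (by simpa using hc X h1 h2)
    simp only [compl_compl] at this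
    rw [hup]
    simp only
    rw [this]
    exact Finset.sum_congr rfl fun v _ => by rw [Finset.compl_insert]
  set R : Finset (Finset V) := Finset.univ.filter fun X => o ∈ X with hR
  have hunivR : Finset.univ ∈ R := by simp [hR]
  -- A step up from `X` is a step down from `insert v X`; the point `o`, which lies in every `X` of
  -- `R`, is never the one adjoined.
  have e1 : ∑ X ∈ R.erase Finset.univ, ∑ v ∈ Xᶜ, chainSum c X * up (insert v X) =
      ∑ X ∈ R, ∑ v ∈ X.erase o, chainSum c (X.erase v) * up X := by
    rw [Finset.sum_sigma', Finset.sum_sigma']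
    refine Finset.sum_bij' (fun p _ => ⟨insert p.2 p.1, p.2⟩) (fun p _ => ⟨p.1.erase p.2, p.2⟩)
      ?_ ?_ ?_ ?_ ?_
    · rintro ⟨X, v⟩ h
      simp only [Finset.mem_sigma, Finset.mem_erase, hR, Finset.mem_filter, Finset.mem_univ,
        true_and, Finset.mem_compl, Finset.mem_insert, true_or, and_true] at h ⊢
      refine ⟨Or.inr h.1.2, ?_⟩
      rintro rfl; exact h.2 h.1.2
    · rintro ⟨X, v⟩ h
      simp only [Finset.mem_sigma, Finset.mem_erase, hR, Finset.mem_filter, Finset.mem_univ,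
        true_and, Finset.mem_compl, not_and, ne_eq, not_true_eq_false, false_imp_iff,
        and_true] at h ⊢
      refine ⟨?_, fun h' => h.2.1 h'.symm, h.1⟩
      intro h'
      have : v ∈ X.erase v := h' ▸ Finset.mem_univ v
      simp at this
    · rintro ⟨X, v⟩ h
      simp only [Finset.mem_sigma, Finset.mem_compl] at h
      simp [Finset.erase_insert h.2]
    · rintro ⟨X, v⟩ h
      simp only [Finset.mem_sigma, Finset.mem_erase] at h
      simp [Finset.insert_erase h.2.2]
    · rintro ⟨X, v⟩ h
      simp only [Finset.mem_sigma, Finset.mem_compl] at h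
      simp [Finset.erase_insert h.2]
  have e2 : ∑ X ∈ R.erase Finset.univ, ∑ v ∈ Xᶜ, chainSum c X * up (insert v X) =
      ∑ X ∈ R.erase Finset.univ, ∑ v ∈ X, chainSum c (X.erase v) * up X := by
    refine Finset.sum_congr rfl fun X hX => ?_
    simp only [hR, Finset.mem_erase, Finset.mem_filter, Finset.mem_univ, true_and] at hX
    have hne : X.Nonempty := ⟨o, hX.2⟩
    rw [← Finset.mul_sum, ← Finset.sum_mul, ← hup' X hne hX.1,
      ← mul_chainSum c hne (hc X hne hX.1)]
    ring
  have e3 : ∀ X ∈ R, ∑ v ∈ X, chainSum c (X.erase v) * up X =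
      chainSum c (X.erase o) * up X + ∑ v ∈ X.erase o, chainSum c (X.erase v) * up X := by
    intro X hX
    simp only [hR, Finset.mem_filter, Finset.mem_univ, true_and] at hX
    rw [Finset.add_sum_erase X (fun v => chainSum c (X.erase v) * up X) hX]
  have e4 : rootedChainSum o c = ∑ X ∈ R, chainSum c (X.erase o) * up X := by
    refine Finset.sum_bij' (fun B _ => insert o B) (fun X _ => X.erase o) ?_ ?_ ?_ ?_ ?_
    · intro B _; simp [hR]
    · intro X _; simpa using Finset.erase_subset_erase o (Finset.subset_univ X)
    · intro B hB
      rw [Finset.mem_powerset, Finset.subset_erase] at hB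
      exact Finset.erase_insert hB.2
    · intro X hX
      simp only [hR, Finset.mem_filter, Finset.mem_univ, true_and] at hX
      exact Finset.insert_erase hX
    · intro B hB
      rw [Finset.mem_powerset, Finset.subset_erase] at hB
      rw [Finset.erase_insert hB.2]
  have e5 : up Finset.univ = 1 := by simp [hup, chainSum_empty]
  -- Cancelling the steps `v ≠ o` inside proper sets leaves the steps `v = o` of the proper sets
  -- against the steps `v ≠ o` of `univ`. The step `v = o` of `univ` completes both sides.
  rw [e1, Finset.sum_congr rfl fun X hX => e3 X (Finset.mem_of_mem_erase hX),
    Finset.sum_add_distrib, ← Finset.add_sum_erase R _ hunivR] at e2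
  have e6 := add_right_cancel e2
  rw [e4, ← Finset.add_sum_erase R _ hunivR, ← e6, fullChainSum,
    ← Finset.add_sum_erase Finset.univ _ (Finset.mem_univ o), e5]
  simp

end ChainSum

/-! ### Sign reversals and thermal weights. -/

section FlipSigns

variable {E : Type*} [DecidableEq E]

theorem flipSigns_symmDiff (D K : Finset E) (q : E → ℝ) :
    flipSigns (symmDiff D K) q = flipSigns K (flipSigns D q) := by
  funext e
  by_cases h1 : e ∈ D <;> by_cases h2 : e ∈ K <;> simp [flipSigns, Finset.mem_symmDiff, h1, h2]

@[simp] theorem flipSigns_empty (q : E → ℝ) : flipSigns ∅ q = q := by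
  funext e; simp [flipSigns]

/-- The reversals in subsets of `C` form a group under symmetric difference, and reversing `K` is a
translation of it. -/
theorem sum_flipSigns_reindex {M : Type*} [AddCommMonoid M] {C K : Finset E} (hK : K ⊆ C)
    (F : (E → ℝ) → M) (q : E → ℝ) :
    ∑ D ∈ C.powerset, F (flipSigns K (flipSigns D q)) = ∑ D ∈ C.powerset, F (flipSigns D q) := by
  have hmem : ∀ D ∈ C.powerset, symmDiff D K ∈ C.powerset := by
    intro D hD
    rw [Finset.mem_powerset] at hD ⊢
    intro e he
    rw [Finset.mem_symmDiff] at he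
    rcases he with h | h
    · exact hD h.1
    · exact hK h.1
  refine Finset.sum_bij' (fun D _ => symmDiff D K) (fun D _ => symmDiff D K) hmem hmem ?_ ?_ ?_
  · intro D _; exact symmDiff_symmDiff_cancel_right K D
  · intro D _; exact symmDiff_symmDiff_cancel_right K D
  · intro D _; rw [flipSigns_symmDiff]

end FlipSigns

/-- The weight `1 / (r (1 - exp (-2 π r)))`. -/
def thermalWeight (r : ℝ) : ℝ := 1 / (r * (1 - Real.exp (-(2 * Real.pi * r))))

/-- A full turn around the circle exchanges the two exponentials of the propagator. This relation is
what later converts `exp (-2π r)` into a reflection. -/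
theorem thermalWeight_mul_exp (r : ℝ) :
    thermalWeight r * Real.exp (-(2 * Real.pi * r)) = thermalWeight (-r) := by
  have h : Real.exp (-(2 * Real.pi * r)) * Real.exp (-(2 * Real.pi * -r)) = 1 := by
    rw [← Real.exp_add]; simp
  have h1 := Real.exp_pos (-(2 * Real.pi * -r))
  unfold thermalWeight
  set x := Real.exp (-(2 * Real.pi * r))
  set y := Real.exp (-(2 * Real.pi * -r))
  have hx : x = 1 / y := by rw [eq_div_iff h1.ne', h]
  rw [hx]
  -- At `r = 0` both weights are 0 by the convention for division by zero.
  by_cases hr : r = 0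
  · simp [hr]
  by_cases hy : y = 1
  · simp [hy]
  have hy1 : y - 1 ≠ 0 := sub_ne_zero.2 hy
  have hy2 : 1 - y ≠ 0 := sub_ne_zero.2 (Ne.symm hy)
  have : 1 - 1 / y = (y - 1) / y := by field_simp
  rw [this]
  field_simp
  ring

/-! ### Cut weights, decoupling over a cutset, and the thermal sum. -/

namespace OrientedMultigraph

variable {V E : Type*} [Fintype E] [DecidableEq V]

/-- The lines with exactly one endpoint in `X`. -/
def boundary (G : OrientedMultigraph V E) (X : Finset V) : Finset E :=
  Finset.univ.filter fun e => ¬ (G.src e ∈ X ↔ G.tgt e ∈ X)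

theorem mem_boundary {G : OrientedMultigraph V E} {X : Finset V} {e : E} :
    e ∈ G.boundary X ↔ ¬ (G.src e ∈ X ↔ G.tgt e ∈ X) := by
  simp [boundary]

/-- The decay rate of the states with the points of `X` in the past. -/
def cutWeight (G : OrientedMultigraph V E) (N : V → ℤ) (r : E → ℝ) (X : Finset V) : ℂ :=
  ((∑ e ∈ G.boundary X, r e : ℝ) : ℂ) - ((∑ v ∈ X, N v : ℤ) : ℂ) * Complex.I

variable (G : OrientedMultigraph V E) (N : V → ℤ)

theorem cutWeight_congr {r r' : E → ℝ} {X : Finset V} (h : ∀ e ∈ G.boundary X, r e = r' e) :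
    G.cutWeight N r X = G.cutWeight N r' X := by
  rw [cutWeight, cutWeight, Finset.sum_congr rfl h]

theorem cutWeight_empty (r : E → ℝ) : G.cutWeight N r ∅ = 0 := by
  simp [cutWeight, boundary]

theorem cutWeight_univ [Fintype V] (hN : ∑ v, N v = 0) (r : E → ℝ) :
    G.cutWeight N r Finset.univ = 0 := by
  simp [cutWeight, boundary, hN]

theorem mul_chainSum_cutWeight {r : E → ℝ} {X : Finset V}
    (h : X.Nonempty → G.cutWeight N r X ≠ 0) :
    G.cutWeight N r X * chainSum (G.cutWeight N r) X =
      ∑ v ∈ X, chainSum (G.cutWeight N r) (X.erase v) := by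
  rcases X.eq_empty_or_nonempty with rfl | hX
  · simp [cutWeight_empty]
  · exact mul_chainSum _ hX (h hX)

theorem chainSum_cutWeight_congr {r r' : E → ℝ} {X : Finset V}
    (h : ∀ e, G.src e ∈ X ∨ G.tgt e ∈ X → r e = r' e) :
    chainSum (G.cutWeight N r) X = chainSum (G.cutWeight N r') X := by
  refine chainSum_congr fun Y hY _ => cutWeight_congr G N fun e he => h e ?_
  rw [mem_boundary] at he
  by_contra h'
  exact he (iff_of_false (fun h1 => h' (Or.inl (hY h1))) fun h1 => h' (Or.inr (hY h1)))

/-- The lines with both endpoints in `X`. -/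
def innerLines (G : OrientedMultigraph V E) (X : Finset V) : Finset E :=
  Finset.univ.filter fun e => G.src e ∈ X ∧ G.tgt e ∈ X

variable [DecidableEq E]

/-- The lines of the boundary of `A` that have their outer end in `X` and their inner end not in
`X`. -/
def reversedLines (G : OrientedMultigraph V E) (A X : Finset V) : Finset E :=
  (G.boundary A ∩ G.boundary X) ∩ G.boundary (X \ A)

theorem reversedLines_subset (A X : Finset V) : G.reversedLines A X ⊆ G.boundary A :=
  Finset.inter_subset_left.trans Finset.inter_subset_left

/-- Checked line by line. A line joining `X ∩ A` to `X \ A` contributes `r e - r e = 0` on the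
right, and a line joining `X \ A` to `A \ X` contributes `-r e`; the latter are exactly the reversed
lines. -/
theorem cutWeight_reversedLines (r : E → ℝ) (A X : Finset V) :
    G.cutWeight N (flipSigns (G.reversedLines A X) r) X =
      G.cutWeight N r (X ∩ A) + G.cutWeight N (flipSigns (G.boundary A) r) (X \ A) := by
  have h1 : ∑ e ∈ G.boundary X, flipSigns (G.reversedLines A X) r e =
      ∑ e ∈ G.boundary (X ∩ A), r e +
        ∑ e ∈ G.boundary (X \ A), flipSigns (G.boundary A) r e := by
    simp only [boundary, Finset.sum_filter, ← Finset.sum_add_distrib]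
    refine Finset.sum_congr rfl fun e _ => ?_
    by_cases h1 : G.src e ∈ X <;> by_cases h2 : G.tgt e ∈ X <;> by_cases h3 : G.src e ∈ A <;>
      by_cases h4 : G.tgt e ∈ A <;>
      simp [flipSigns, reversedLines, mem_boundary, h1, h2, h3, h4]
  rw [cutWeight, cutWeight, cutWeight, h1, ← Finset.sum_inter_add_sum_sdiff X A N]
  push_cast
  ring

/-- A Leibniz rule: the removed point lies in `X ∩ A` or in `X \ A` and acts on one factor only, so
the two denominators add up, and their sum is the weight of `X` after the reversal. -/
theorem sum_erase_chainSum_mul {r : E → ℝ} {A X : Finset V}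
    (h1 : (X ∩ A).Nonempty → G.cutWeight N r (X ∩ A) ≠ 0)
    (h2 : (X \ A).Nonempty → G.cutWeight N (flipSigns (G.boundary A) r) (X \ A) ≠ 0) :
    ∑ v ∈ X, chainSum (G.cutWeight N r) (X.erase v ∩ A) *
      chainSum (G.cutWeight N (flipSigns (G.boundary A) r)) (X.erase v \ A) =
    G.cutWeight N (flipSigns (G.reversedLines A X) r) X * (chainSum (G.cutWeight N r) (X ∩ A) *
      chainSum (G.cutWeight N (flipSigns (G.boundary A) r)) (X \ A)) := by
  rw [cutWeight_reversedLines, add_mul, ← mul_assoc, mul_chainSum_cutWeight G N h1,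
    mul_left_comm (G.cutWeight N _ (X \ A)), mul_chainSum_cutWeight G N h2, Finset.sum_mul,
    Finset.mul_sum, ← Finset.sum_inter_add_sum_sdiff X A]
  congr 1
  · refine Finset.sum_congr rfl fun v hv => ?_
    rw [Finset.mem_inter] at hv
    congr 2
    · ext w; simp only [Finset.mem_inter, Finset.mem_erase]; tauto
    · ext w
      simp only [Finset.mem_sdiff, Finset.mem_erase]
      constructor
      · tauto
      · rintro ⟨h3, h4⟩
        exact ⟨⟨fun h => h4 (h ▸ hv.2), h3⟩, h4⟩
  · refine Finset.sum_congr rfl fun v hv => ?_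
    rw [Finset.mem_sdiff] at hv
    congr 2
    · ext w
      simp only [Finset.mem_inter, Finset.mem_erase]
      constructor
      · tauto
      · rintro ⟨h3, h4⟩
        exact ⟨⟨fun h => hv.2 (h ▸ h4), h3⟩, h4⟩
    · ext w; simp only [Finset.mem_sdiff, Finset.mem_erase]; tauto

theorem reversedLines_erase_of_mem {A X : Finset V} {v : V} (hv : v ∈ X) (hA : v ∈ A) :
    symmDiff (G.reversedLines A X) (G.reversedLines A (X.erase v)) ⊆ G.innerLines X := by
  intro e he
  by_cases h1 : G.src e = v <;> by_cases h2 : G.tgt e = v <;> by_cases h3 : G.src e ∈ X <;>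
    by_cases h4 : G.tgt e ∈ X <;> by_cases h5 : G.src e ∈ A <;> by_cases h6 : G.tgt e ∈ A <;>
    simp_all [Finset.mem_symmDiff, reversedLines, mem_boundary, innerLines]

theorem reversedLines_erase_of_notMem {A X : Finset V} {v : V} (hv : v ∈ X) (hA : v ∉ A) {e : E}
    (he : e ∈ symmDiff (G.reversedLines A X) (G.reversedLines A (X.erase v))) :
    G.src e ∉ X.erase v ∧ G.tgt e ∉ X.erase v := by
  by_cases h1 : G.src e = v <;> by_cases h2 : G.tgt e = v <;> by_cases h3 : G.src e ∈ X <;>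
    by_cases h4 : G.tgt e ∈ X <;> by_cases h5 : G.src e ∈ A <;> by_cases h6 : G.tgt e ∈ A <;>
    simp_all [Finset.mem_symmDiff, reversedLines, mem_boundary]

/-- The decoupling identity. Along a chain the set of reversed lines changes with `X`, but each
change is harmless: it either concerns lines inside `X`, to which the prefactor is blind, or lines
away from the rest of the chain, where it can be absorbed into the sum over `D`. The prefactor `φ`
stands for the denominators of the larger sets already split off, so that the induction can run
downwards through the chain. -/
theorem orbitSum_mul_chainSum [Fintype V] {A : Finset V} {C : Finset E} (hAC : G.boundary A ⊆ C)
    {q : E → ℝ}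
    (hc : ∀ D ⊆ C, ∀ X : Finset V, X.Nonempty → X ≠ Finset.univ →
      G.cutWeight N (flipSigns D q) X ≠ 0)
    {X : Finset V} (hX : X ≠ Finset.univ) (φ : (E → ℝ) → ℂ)
    (hφ : ∀ S ⊆ G.innerLines X, ∀ r, φ (flipSigns S r) = φ r) :
    ∑ D ∈ C.powerset, φ (flipSigns D q) * chainSum (G.cutWeight N (flipSigns D q)) X =
      ∑ D ∈ C.powerset, φ (flipSigns (G.reversedLines A X) (flipSigns D q)) *
        (chainSum (G.cutWeight N (flipSigns D q)) (X ∩ A) *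
        chainSum (G.cutWeight N (flipSigns (G.boundary A) (flipSigns D q))) (X \ A)) := by
  have hflip : ∀ D ∈ C.powerset, ∀ K ⊆ C, symmDiff D K ⊆ C := by
    intro D hD K hK e he
    rw [Finset.mem_powerset] at hD
    rw [Finset.mem_symmDiff] at he
    exact he.elim (fun h => hD h.1) fun h => hK h.1
  induction X using Finset.strongInduction generalizing φ with
  | H X ih =>
    rcases X.eq_empty_or_nonempty with rfl | hne
    · refine Finset.sum_congr rfl fun D _ => ?_
      simp [chainSum_empty, reversedLines, boundary]
    have hsub : ∀ v, G.innerLines (X.erase v) ⊆ G.innerLines X := by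
      intro v e
      simp only [innerLines, Finset.mem_filter, Finset.mem_univ, true_and, Finset.mem_erase]
      tauto
    -- The top denominator joins the prefactor; it sees only boundary lines of `X`, hence is still
    -- invariant under reversal of inner lines.
    set ψ : (E → ℝ) → ℂ := fun r => φ r / G.cutWeight N r X with hψ
    have hψ' : ∀ S ⊆ G.innerLines X, ∀ r, ψ (flipSigns S r) = ψ r := by
      intro S hS r
      simp only [hψ, hφ S hS]
      congr 1
      refine cutWeight_congr G N fun e he => ?_
      have : e ∉ S := by
        intro h
        have := hS h
        simp only [innerLines, Finset.mem_filter, Finset.mem_univ, true_and] at this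
        exact mem_boundary.1 he (iff_of_true this.1 this.2)
      simp [flipSigns, this]
    have step : ∀ v ∈ X,
        ∑ D ∈ C.powerset, ψ (flipSigns D q) *
          chainSum (G.cutWeight N (flipSigns D q)) (X.erase v) =
        ∑ D ∈ C.powerset, ψ (flipSigns (G.reversedLines A X) (flipSigns D q)) *
          (chainSum (G.cutWeight N (flipSigns D q)) (X.erase v ∩ A) *
          chainSum (G.cutWeight N (flipSigns (G.boundary A) (flipSigns D q))) (X.erase v \ A)) := by
      intro v hv
      have hne' : X.erase v ≠ Finset.univ := by
        intro h
        have : v ∈ X.erase v := h ▸ Finset.mem_univ v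
        simp at this
      rw [ih _ (Finset.erase_ssubset hv) hne' ψ fun S hS => hψ' S (hS.trans (hsub v))]
      set τ := symmDiff (G.reversedLines A X) (G.reversedLines A (X.erase v)) with hτ
      -- For `v ∈ A` the discrepancy `τ` consists of inner lines of `X`, so `ψ` takes the same value
      -- for every `D`.
      by_cases hA : v ∈ A
      · refine Finset.sum_congr rfl fun D _ => ?_
        congr 1
        have : symmDiff (G.reversedLines A X) τ = G.reversedLines A (X.erase v) :=
          symmDiff_symmDiff_cancel_left _ _
        rw [← this, flipSigns_symmDiff]
        exact hψ' _ (G.reversedLines_erase_of_mem hv hA) _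
      -- For `v ∉ A` the lines of `τ` do not touch `X.erase v`. Translating `D` by `τ` corrects the
      -- argument of `ψ` and leaves both chain sums unchanged.
      · have hτC : τ ⊆ C := by
          intro e he
          rw [hτ, Finset.mem_symmDiff] at he
          exact hAC (he.elim (fun h => G.reversedLines_subset _ _ h.1)
            fun h => G.reversedLines_subset _ _ h.1)
        rw [← sum_flipSigns_reindex hτC (fun r => ψ (flipSigns (G.reversedLines A (X.erase v)) r) *
          (chainSum (G.cutWeight N r) (X.erase v ∩ A) *
          chainSum (G.cutWeight N (flipSigns (G.boundary A) r)) (X.erase v \ A)))]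
        refine Finset.sum_congr rfl fun D _ => ?_
        have hs : symmDiff τ (G.reversedLines A (X.erase v)) = G.reversedLines A X :=
          symmDiff_symmDiff_cancel_right _ _
        have hout : ∀ e, G.src e ∈ X.erase v ∨ G.tgt e ∈ X.erase v → e ∉ τ := by
          intro e he h
          have := G.reversedLines_erase_of_notMem hv hA h
          tauto
        rw [← flipSigns_symmDiff τ, hs]
        congr 2
        · refine chainSum_cutWeight_congr G N fun e he => ?_
          have : e ∉ τ := hout e (he.imp (fun h => Finset.inter_subset_left h)
            fun h => Finset.inter_subset_left h)
          simp [flipSigns, this]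
        · refine chainSum_cutWeight_congr G N fun e he => ?_
          have : e ∉ τ := hout e (he.imp (fun h => Finset.sdiff_subset h)
            fun h => Finset.sdiff_subset h)
          simp [flipSigns, this]
    calc ∑ D ∈ C.powerset, φ (flipSigns D q) * chainSum (G.cutWeight N (flipSigns D q)) X
        = ∑ v ∈ X, ∑ D ∈ C.powerset, ψ (flipSigns D q) *
            chainSum (G.cutWeight N (flipSigns D q)) (X.erase v) := by
          rw [Finset.sum_comm]
          refine Finset.sum_congr rfl fun D _ => ?_
          rw [chainSum_of_nonempty _ hne, ← Finset.mul_sum, hψ]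
          ring
      _ = _ := by
          rw [Finset.sum_congr rfl step, Finset.sum_comm]
          refine Finset.sum_congr rfl fun D hD => ?_
          rw [← Finset.mul_sum, sum_erase_chainSum_mul G N
            (fun h => hc D (Finset.mem_powerset.1 hD) _ h fun h' => hX (Finset.univ_subset_iff.1
              (h' ▸ Finset.inter_subset_left)))
            (fun h => by
              rw [← flipSigns_symmDiff]
              exact hc _ (hflip D hD _ hAC) _ h fun h' => hX (Finset.univ_subset_iff.1
              (h' ▸ Finset.sdiff_subset))), ← mul_assoc, hψ]
          simp only
          rw [div_mul_cancel₀]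
          rw [← flipSigns_symmDiff]
          exact hc _ (hflip D hD _ ((G.reversedLines_subset A X).trans hAC)) X hne hX

/-- The chain sums cancel after summation over the reflections in the lines of a set that
separates the points. -/
theorem sum_fullChainSum_eq_zero [Fintype V] (hN : ∑ v, N v = 0) {A : Finset V}
    (hA : A.Nonempty) (hA' : A ≠ Finset.univ) {C : Finset E}
    (hAC : G.boundary A ⊆ C) {q : E → ℝ}
    (hc : ∀ D ⊆ C, ∀ X : Finset V, X.Nonempty → X ≠ Finset.univ →
      G.cutWeight N (flipSigns D q) X ≠ 0) :
    ∑ D ∈ C.powerset, fullChainSum (G.cutWeight N (flipSigns D q)) = 0 := by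
  have h1 : ∀ v, ∑ D ∈ C.powerset,
      chainSum (G.cutWeight N (flipSigns D q)) (Finset.univ.erase v) =
      ∑ D ∈ C.powerset, chainSum (G.cutWeight N (flipSigns D q)) (Finset.univ.erase v ∩ A) *
        chainSum (G.cutWeight N (flipSigns (G.boundary A) (flipSigns D q)))
          (Finset.univ.erase v \ A) := by
    intro v
    have hne' : Finset.univ.erase v ≠ Finset.univ := by
      intro h
      have : v ∈ Finset.univ.erase v := by rw [h]; exact Finset.mem_univ v
      simp at this
    simpa using orbitSum_mul_chainSum G N hAC hc hne' (fun _ => 1) fun _ _ _ => rfl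
  simp only [fullChainSum]
  rw [Finset.sum_comm, Finset.sum_congr rfl fun v _ => h1 v, Finset.sum_comm]
  refine Finset.sum_eq_zero fun D hD => ?_
  rw [Finset.mem_powerset] at hD
  -- For the set of all points the sum over the last step is the Leibniz sum, and its weight
  -- vanishes since there is no boundary and the `N v` add up to 0.
  rw [sum_erase_chainSum_mul, cutWeight_univ G N hN, zero_mul]
  · intro h
    exact hc D hD _ h (by simpa using hA')
  · intro h
    rw [← flipSigns_symmDiff]
    refine hc _ ?_ _ h fun h' => ?_
    · intro e he
      rw [Finset.mem_symmDiff] at he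
      exact he.elim (fun h => hD h.1) fun h => hAC h.1
    · obtain ⟨a, ha⟩ := hA
      have : a ∈ Finset.univ \ A := by rw [h']; exact Finset.mem_univ a
      simp [ha] at this

/-- The decay rates if the point `o` lies in the past of all others. -/
def rootedWeight (o : V) (r : E → ℝ) (P : Finset V) : ℂ := G.cutWeight N r (insert o P)

/-- Differences of rates are again rates, after reversal of the boundary of `A`. Hence the
eigenvector coefficients, whose denominators are such differences, are chain sums of the same kind.
-/
theorem cutWeight_sub_of_superset {r : E → ℝ} {A X : Finset V} (hX : A ⊆ X) :
    G.cutWeight N r X - G.cutWeight N r A =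
      G.cutWeight N (flipSigns (G.boundary A) r) (X \ A) := by
  have h1 : ∑ e ∈ G.boundary X, r e = ∑ e ∈ G.boundary A, r e +
      ∑ e ∈ G.boundary (X \ A), flipSigns (G.boundary A) r e := by
    simp only [boundary, Finset.sum_filter, ← Finset.sum_add_distrib]
    refine Finset.sum_congr rfl fun e _ => ?_
    have h5 := @hX (G.src e)
    have h6 := @hX (G.tgt e)
    by_cases h1 : G.src e ∈ X <;> by_cases h2 : G.tgt e ∈ X <;> by_cases h3 : G.src e ∈ A <;>
      by_cases h4 : G.tgt e ∈ A <;> simp_all [flipSigns]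
  rw [cutWeight, cutWeight, cutWeight, h1, ← Finset.sum_sdiff hX]
  push_cast
  ring

theorem cutWeight_sub_of_subset [Fintype V] (hN : ∑ v, N v = 0) {r : E → ℝ} {A Y : Finset V}
    (hY : Y ⊆ A) :
    G.cutWeight N r Y - G.cutWeight N r A =
      G.cutWeight N (flipSigns (G.boundary A) r) (A \ Y)ᶜ := by
  have h1 : ∑ e ∈ G.boundary Y, r e = ∑ e ∈ G.boundary A, r e +
      ∑ e ∈ G.boundary (A \ Y)ᶜ, flipSigns (G.boundary A) r e := by
    simp only [boundary, Finset.sum_filter, ← Finset.sum_add_distrib]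
    refine Finset.sum_congr rfl fun e _ => ?_
    have h5 := @hY (G.src e)
    have h6 := @hY (G.tgt e)
    by_cases h1 : G.src e ∈ Y <;> by_cases h2 : G.tgt e ∈ Y <;> by_cases h3 : G.src e ∈ A <;>
      by_cases h4 : G.tgt e ∈ A <;> simp_all [flipSigns]
  have h2 : ∑ v ∈ A, N v = ∑ v ∈ Y, N v - ∑ v ∈ (A \ Y)ᶜ, N v := by
    rw [← Finset.sum_sdiff hY, eq_sub_iff_add_eq, add_right_comm, Finset.sum_add_sum_compl, hN,
      zero_add]
  rw [cutWeight, cutWeight, cutWeight, h1, h2]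
  push_cast
  ring

/-- The imaginary part of the rate is an integer and drops out after time `2π`; the real part
supplies one factor `exp (-2π r e)` for each boundary line. -/
theorem prod_thermalWeight_mul_exp (r : E → ℝ) (X : Finset V) :
    ((∏ e, thermalWeight (r e) : ℝ) : ℂ) *
      Complex.exp (-(G.cutWeight N r X * ((2 * Real.pi : ℝ) : ℂ))) =
    ((∏ e, thermalWeight (flipSigns (G.boundary X) r e) : ℝ) : ℂ) := by
  have h1 : Complex.exp (-(G.cutWeight N r X * ((2 * Real.pi : ℝ) : ℂ))) =
      ((Real.exp (-(2 * Real.pi * ∑ e ∈ G.boundary X, r e)) : ℝ) : ℂ) := by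
    have : -(G.cutWeight N r X * ((2 * Real.pi : ℝ) : ℂ)) =
        ((-(2 * Real.pi * ∑ e ∈ G.boundary X, r e) : ℝ) : ℂ) +
          ((∑ v ∈ X, N v : ℤ) : ℂ) * (2 * Real.pi * Complex.I) := by
      rw [cutWeight]; push_cast; ring
    rw [this, Complex.exp_add, Complex.exp_int_mul_two_pi_mul_I, mul_one, Complex.ofReal_exp]
  rw [h1, ← Complex.ofReal_mul]
  congr 1
  have h2 : Real.exp (-(2 * Real.pi * ∑ e ∈ G.boundary X, r e)) =
      ∏ e, if e ∈ G.boundary X then Real.exp (-(2 * Real.pi * r e)) else 1 := by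
    rw [Finset.prod_ite_mem, Finset.univ_inter, ← Real.exp_sum, Finset.mul_sum,
      Finset.sum_neg_distrib]
  rw [h2, ← Finset.prod_mul_distrib]
  refine Finset.prod_congr rfl fun e _ => ?_
  by_cases he : e ∈ G.boundary X
  · simp [he, flipSigns, thermalWeight_mul_exp]
  · simp [he, flipSigns]

/-- In the eigenvector expansion at time `2π`, the exponential and both coefficients of the mode `A`
become functions of `q` with the boundary of `insert o A` reversed. Summing over all `D` undoes this
common reversal, mode by mode. -/
theorem sum_thermalWeight_mul_evolution [Fintype V] (hN : ∑ v, N v = 0) (o : V) (q : E → ℝ) :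
    ∑ D : Finset E, ((∏ e, thermalWeight (flipSigns D q e) : ℝ) : ℂ) *
      evolution (G.rootedWeight N o (flipSigns D q)) (Finset.univ.erase o) (2 * Real.pi) =
    ∑ D : Finset E, ((∏ e, thermalWeight (flipSigns D q e) : ℝ) : ℂ) *
      rootedChainSum o (G.cutWeight N (flipSigns D q)) := by
  set U : Finset V := Finset.univ.erase o with hU
  have hleft : ∀ A ⊆ U, ∀ r : E → ℝ, leftChain (G.rootedWeight N o r) A ∅ =
      chainSum (fun Z => G.cutWeight N (flipSigns (G.boundary (insert o A)) r) Zᶜ) A := by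
    intro A hA r
    rw [leftChain, Finset.sdiff_empty]
    refine chainSum_congr fun Z hZ _ => ?_
    rw [rootedWeight, rootedWeight, cutWeight_sub_of_subset G N hN
      (Finset.insert_subset_insert o Finset.sdiff_subset)]
    congr 2
    ext w
    have hw : w ∈ Z → w ≠ o := fun h => Finset.ne_of_mem_erase (hA (hZ h))
    have hw' := @hZ w
    simp only [Finset.mem_sdiff, Finset.mem_insert]
    tauto
  have hright : ∀ A ⊆ U, ∀ r : E → ℝ, rightChain (G.rootedWeight N o r) A U =
      chainSum (G.cutWeight N (flipSigns (G.boundary (insert o A)) r)) (U \ A) := by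
    intro A hA r
    rw [rightChain]
    refine chainSum_congr fun Y hY _ => ?_
    rw [rootedWeight, rootedWeight, cutWeight_sub_of_superset G N
      (Finset.insert_subset_insert o Finset.subset_union_left)]
    congr 1
    ext w
    have hw : w ∈ Y → w ≠ o ∧ w ∉ A := fun h => by
      have := hY h
      rw [Finset.mem_sdiff] at this
      exact ⟨Finset.ne_of_mem_erase this.1, this.2⟩
    simp only [Finset.mem_sdiff, Finset.mem_insert, Finset.mem_union]
    tauto
  set F : Finset V → (E → ℝ) → ℂ := fun A r => ((∏ e, thermalWeight (r e) : ℝ) : ℂ) *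
    (chainSum (G.cutWeight N r) (U \ A) * chainSum (fun Z => G.cutWeight N r Zᶜ) A) with hF
  have e1 : ∀ r : E → ℝ, ((∏ e, thermalWeight (r e) : ℝ) : ℂ) *
      evolution (G.rootedWeight N o r) U (2 * Real.pi) =
      ∑ A ∈ U.powerset, F A (flipSigns (G.boundary (insert o A)) r) := by
    intro r
    rw [evolution, Finset.mul_sum]
    refine Finset.sum_congr rfl fun A hA => ?_
    rw [Finset.mem_powerset] at hA
    rw [hF]
    simp only
    rw [← prod_thermalWeight_mul_exp G N r (insert o A), hleft A hA, hright A hA, rootedWeight]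
    ring
  have e2 : ∀ r : E → ℝ, ((∏ e, thermalWeight (r e) : ℝ) : ℂ) *
      rootedChainSum o (G.cutWeight N r) = ∑ A ∈ U.powerset, F A r := by
    intro r
    rw [rootedChainSum, Finset.mul_sum]
    -- The mode `A` supplies the upper part of the chain, after `o`; its complement in `U` supplies
    -- the lower part.
    refine Finset.sum_bij' (fun B _ => U \ B) (fun B _ => U \ B) ?_ ?_ ?_ ?_ ?_
    · intro B _; exact Finset.mem_powerset.2 Finset.sdiff_subset
    · intro B _; exact Finset.mem_powerset.2 Finset.sdiff_subset
    · intro B hB; exact Finset.sdiff_sdiff_eq_self (Finset.mem_powerset.1 hB)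
    · intro B hB; exact Finset.sdiff_sdiff_eq_self (Finset.mem_powerset.1 hB)
    · intro B hB
      rw [hF]
      simp only
      rw [Finset.sdiff_sdiff_eq_self (Finset.mem_powerset.1 hB)]
      congr 3
      ext w
      simp [hU]
  simp only [e1, e2]
  rw [Finset.sum_comm, Finset.sum_comm (s := (Finset.univ : Finset (Finset E)))]
  refine Finset.sum_congr rfl fun A _ => ?_
  simpa using sum_flipSigns_reindex (Finset.subset_univ (G.boundary (insert o A))) (F A) q

end OrientedMultigraph

/-! ### Integration over cubes with some coordinates frozen. -/

section CubeMeasure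

variable {V : Type*} [DecidableEq V]

/-- Lebesgue measure on `(0, t]` for the points of `P`, a point mass for the others. -/
def coordMeasure (P : Finset V) (t : ℝ) (v : V) : Measure ℝ :=
  if v ∈ P then volume.restrict (Set.Ioc 0 t) else Measure.dirac 0

instance (P : Finset V) (t : ℝ) (v : V) : IsFiniteMeasure (coordMeasure P t v) := by
  unfold coordMeasure
  split_ifs <;> infer_instance

theorem measurable_update_prod (v : V) :
    Measurable fun p : ℝ × (V → ℝ) => Function.update p.2 v p.1 := by
  refine measurable_pi_lambda _ fun w => ?_
  by_cases h : w = v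
  · subst h; simpa using measurable_fst
  · simp only [Function.update_of_ne h]; fun_prop

variable [Fintype V]

/-- Lebesgue measure on the cube of side `t` in the coordinates of `P`. -/
def cubeMeasure (P : Finset V) (t : ℝ) : Measure (V → ℝ) := Measure.pi (coordMeasure P t)

instance (P : Finset V) (t : ℝ) : IsFiniteMeasure (cubeMeasure P t) := by
  unfold cubeMeasure; infer_instance

/-- Separates the coordinate `v`: in the remaining measure it carries a unit mass at 0, which the
update overwrites. All measures thus stay on the one space `V → ℝ`. -/
theorem cubeMeasure_eq_map {P : Finset V} {v : V} (hv : v ∈ P) (t : ℝ) :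
    cubeMeasure P t = ((volume.restrict (Set.Ioc 0 t)).prod (cubeMeasure (P.erase v) t)).map
      fun p => Function.update p.2 v p.1 := by
  refine Measure.pi_eq fun s hs => ?_
  rw [Measure.map_apply (measurable_update_prod v) (MeasurableSet.univ_pi hs)]
  have : (fun p : ℝ × (V → ℝ) => Function.update p.2 v p.1) ⁻¹' (Set.univ.pi s) =
      s v ×ˢ (Set.univ.pi (Function.update s v Set.univ)) := by
    ext p
    simp only [Set.mem_preimage, Set.mem_pi, Set.mem_univ, true_imp_iff, Set.mem_prod]
    constructor
    · intro h
      refine ⟨by simpa using h v, fun w => ?_⟩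
      by_cases hw : w = v
      · subst hw; simp
      · simpa [Function.update_of_ne hw] using h w
    · rintro ⟨h1, h2⟩ w
      by_cases hw : w = v
      · subst hw; simpa using h1
      · simpa [Function.update_of_ne hw] using h2 w
  rw [this, Measure.prod_prod, cubeMeasure, Measure.pi_pi,
    ← Finset.mul_prod_erase Finset.univ _ (Finset.mem_univ v),
    ← Finset.mul_prod_erase Finset.univ (fun i => coordMeasure P t i (s i)) (Finset.mem_univ v)]
  have h1 : coordMeasure (P.erase v) t v (Function.update s v Set.univ v) = 1 := by
    simp [coordMeasure]
  have h2 : coordMeasure P t v (s v) = volume.restrict (Set.Ioc 0 t) (s v) := by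
    simp [coordMeasure, hv]
  rw [h1, h2, one_mul]
  congr 1
  refine Finset.prod_congr rfl fun w hw => ?_
  have hw := Finset.ne_of_mem_erase hw
  simp [coordMeasure, hw]

theorem cubeMeasure_ae_mem (P : Finset V) {t : ℝ} :
    ∀ᵐ θ ∂cubeMeasure P t, (∀ v ∈ P, θ v ∈ Set.Ioc 0 t) ∧ ∀ v ∉ P, θ v = 0 := by
  have h : ∀ v, ∀ᵐ θ ∂cubeMeasure P t, (v ∈ P → θ v ∈ Set.Ioc 0 t) ∧ (v ∉ P → θ v = 0) := by
    intro v
    have h0 : ∀ᵐ x ∂coordMeasure P t v, (v ∈ P → x ∈ Set.Ioc 0 t) ∧ (v ∉ P → x = 0) := by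
      unfold coordMeasure
      split_ifs with hv
      · filter_upwards [ae_restrict_mem measurableSet_Ioc] with x hx
        simp [hv, hx.1, hx.2]
      · rw [ae_dirac_eq]; simp [hv]
    exact (Measure.tendsto_eval_ae_ae (μ := coordMeasure P t) (i := v)).eventually h0
  filter_upwards [ae_all_iff.2 h] with θ hθ
  exact ⟨fun v hv => (hθ v).1 hv, fun v hv => (hθ v).2 hv⟩

theorem integrable_cubeMeasure (P : Finset V) {t : ℝ} (ht : 0 ≤ t) {F : (V → ℝ) → ℂ}
    (hF : Continuous F) : Integrable F (cubeMeasure P t) := by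
  obtain ⟨C, hC⟩ := (isCompact_univ_pi fun _ : V => isCompact_Icc (a := (0 : ℝ)) (b := t)
    ).exists_bound_of_continuousOn hF.continuousOn
  refine Integrable.of_bound hF.aestronglyMeasurable C ?_
  filter_upwards [cubeMeasure_ae_mem P] with θ hθ
  refine hC θ fun v _ => ?_
  by_cases hv : v ∈ P
  · exact ⟨(hθ.1 v hv).1.le, (hθ.1 v hv).2⟩
  · rw [hθ.2 v hv]; exact ⟨le_rfl, ht⟩

theorem cubeMeasure_ae_ne {P : Finset V} {t : ℝ} {v w : V} (hv : v ∈ P) (hvw : w ≠ v) :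
    ∀ᵐ θ ∂cubeMeasure P t, θ v ≠ θ w := by
  rw [ae_iff]
  simp only [ne_eq, not_not]
  have hm : MeasurableSet {θ : V → ℝ | θ v = θ w} :=
    measurableSet_eq_fun (measurable_pi_apply v) (measurable_pi_apply w)
  rw [cubeMeasure_eq_map hv, Measure.map_apply (measurable_update_prod v) hm,
    Measure.prod_apply_symm ((measurable_update_prod v) hm)]
  refine (lintegral_congr fun θ => ?_).trans lintegral_zero
  have : (fun x : ℝ => (x, θ)) ⁻¹' ((fun p : ℝ × (V → ℝ) => Function.update p.2 v p.1) ⁻¹'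
      {θ : V → ℝ | θ v = θ w}) = {θ w} := by
    ext x; simp [Function.update_of_ne hvw]
  rw [this]
  exact le_antisymm ((Measure.restrict_apply_le _ _).trans (by simp)) zero_le

theorem cubeMeasure_restrict {P : Finset V} {s t : ℝ} (hst : s ≤ t) :
    (cubeMeasure P t).restrict {θ | ∀ w ∈ P, θ w ≤ s} = cubeMeasure P s := by
  have : {θ : V → ℝ | ∀ w ∈ P, θ w ≤ s} =
      Set.univ.pi fun w => if w ∈ P then Set.Iic s else Set.univ := by
    ext θ
    simp only [Set.mem_ofPred_eq, Set.mem_pi, Set.mem_univ, true_imp_iff]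
    refine forall_congr' fun w => ?_
    by_cases hw : w ∈ P <;> simp [hw]
  rw [this, cubeMeasure, Measure.restrict_pi_pi, cubeMeasure]
  congr 1
  funext w
  by_cases hw : w ∈ P
  · simp only [coordMeasure, hw, if_true]
    rw [Measure.restrict_restrict measurableSet_Iic, Set.inter_comm, Set.Ioc_inter_Iic,
      min_eq_right hst]
  · simp [coordMeasure, hw]

/-- The integral over a cube, decomposed according to the largest coordinate. -/
theorem integral_cubeMeasure {P : Finset V} (hP : P.Nonempty) {t : ℝ} (ht : 0 ≤ t)
    {F : (V → ℝ) → ℂ} (hF : Continuous F) :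
    ∫ θ, F θ ∂cubeMeasure P t = ∫ s in (0 : ℝ)..t,
      ∑ v ∈ P, ∫ θ, F (Function.update θ v s) ∂cubeMeasure (P.erase v) s := by
  set M : V → Set (V → ℝ) := fun v => {θ | ∀ w ∈ P.erase v, θ w ≤ θ v} with hM
  have hMm : ∀ v, MeasurableSet (M v) := by
    intro v
    simp only [hM, Set.ofPred_forall]
    exact Finset.measurableSet_biInter _ fun w _ =>
      measurableSet_le (measurable_pi_apply w) (measurable_pi_apply v)
  have hint := integrable_cubeMeasure P ht hF
  -- Ties are negligible, so the sets `M v` partition the cube up to measure zero.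
  have hinj : ∀ᵐ θ ∂cubeMeasure P t, ∀ v ∈ P, ∀ w, w ≠ v → θ v ≠ θ w := by
    rw [ae_all_iff]; intro v
    rw [eventually_imp_distrib_left]; intro hv
    rw [ae_all_iff]; intro w
    rw [eventually_imp_distrib_left]; intro hw
    exact cubeMeasure_ae_ne hv hw
  have e1 : ∫ θ, F θ ∂cubeMeasure P t =
      ∑ v ∈ P, ∫ θ, (M v).indicator F θ ∂cubeMeasure P t := by
    rw [← integral_finsetSum _ fun v _ => hint.indicator (hMm v)]
    refine integral_congr_ae ?_
    filter_upwards [hinj] with θ hθ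
    obtain ⟨v, hv, hmax⟩ := P.exists_max_image θ hP
    rw [Finset.sum_eq_single_of_mem v hv]
    · rw [Set.indicator_of_mem]
      exact fun w hw => hmax w (Finset.mem_of_mem_erase hw)
    · intro w hw hwv
      rw [Set.indicator_of_notMem]
      intro h
      exact hθ v hv w hwv (le_antisymm (h v (Finset.mem_erase.2 ⟨hwv.symm, hv⟩)) (hmax w hw))
  have hu := measurable_update_prod (V := V)
  have hint2 : ∀ v ∈ P, Integrable
      (fun p : ℝ × (V → ℝ) => (M v).indicator F (Function.update p.2 v p.1))
      ((volume.restrict (Set.Ioc 0 t)).prod (cubeMeasure (P.erase v) t)) := by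
    intro v hv
    have := hint.indicator (hMm v)
    rw [cubeMeasure_eq_map hv] at this
    exact this.comp_measurable (hu v)
  have e2 : ∀ v ∈ P, ∫ θ, (M v).indicator F θ ∂cubeMeasure P t =
      ∫ s in Set.Ioc 0 t, ∫ θ, (M v).indicator F (Function.update θ v s)
        ∂cubeMeasure (P.erase v) t := by
    intro v hv
    rw [cubeMeasure_eq_map hv, integral_map (hu v).aemeasurable
      ((hF.measurable.indicator (hMm v)).aestronglyMeasurable), integral_prod _ (hint2 v hv)]
  rw [e1, Finset.sum_congr rfl e2,
    ← integral_finsetSum _ fun v hv => (hint2 v hv).integral_prod_left,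
    intervalIntegral.integral_of_le ht]
  refine setIntegral_congr_fun measurableSet_Ioc fun s hs => ?_
  refine Finset.sum_congr rfl fun v hv => ?_
  have : ∀ θ, (M v).indicator F (Function.update θ v s) =
      {θ : V → ℝ | ∀ w ∈ P.erase v, θ w ≤ s}.indicator (fun θ => F (Function.update θ v s)) θ := by
    intro θ
    have hiff : Function.update θ v s ∈ M v ↔ θ ∈ {θ : V → ℝ | ∀ w ∈ P.erase v, θ w ≤ s} := by
      simp only [hM, Set.mem_ofPred_eq, Function.update_self]
      refine forall₂_congr fun w hw => ?_
      rw [Function.update_of_ne (Finset.ne_of_mem_erase hw)]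
    by_cases h : Function.update θ v s ∈ M v
    · rw [Set.indicator_of_mem h, Set.indicator_of_mem (hiff.1 h)]
    · rw [Set.indicator_of_notMem h, Set.indicator_of_notMem (fun h' => h (hiff.2 h'))]
  simp only [this]
  rw [integral_indicator, cubeMeasure_restrict hs.2]
  simp only [Set.ofPred_forall]
  exact Finset.measurableSet_biInter _ fun w _ =>
    measurableSet_le (measurable_pi_apply w) measurable_const

end CubeMeasure

/-! ### The time-ordered integrals. -/

namespace OrientedMultigraph

variable {V E : Type*} [Fintype V] [Fintype E]
variable (G : OrientedMultigraph V E) (N : V → ℤ)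

/-- The product of the exponentials of the lines and of the plane waves of the points. -/
def timeWeight (r : E → ℝ) (θ : V → ℝ) : ℂ :=
  Complex.exp (-((∑ e, r e * |θ (G.tgt e) - θ (G.src e)| : ℝ) : ℂ) -
    ((∑ v, (N v : ℝ) * θ v : ℝ) : ℂ) * Complex.I)

theorem continuous_timeWeight (r : E → ℝ) : Continuous (G.timeWeight N r) := by
  unfold timeWeight
  fun_prop

variable [DecidableEq V]

/-- Replaces the coordinates off `P` by `t`, and that of `o` by `0`. -/
def pastTimes (o : V) (P : Finset V) (t : ℝ) (θ : V → ℝ) : V → ℝ :=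
  fun v => if v ∈ P then θ v else if v = o then 0 else t

/-- Delaying all points off `X`, which sit at the latest time `m`, lengthens exactly the boundary
lines of `X` by `δ`. Since the `N v` sum to 0, the phase is expressed through the points of `X`. -/
theorem timeWeight_shift (hN : ∑ v, N v = 0) (r : E → ℝ) (X : Finset V) {b : V → ℝ} {m δ : ℝ}
    (hδ : 0 ≤ δ) (hb : ∀ v, b v ≤ m) (hb' : ∀ v ∉ X, b v = m) :
    G.timeWeight N r (fun v => if v ∈ X then b v else b v + δ) =
      Complex.exp (-(G.cutWeight N r X * δ)) * G.timeWeight N r b := by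
  have h1 : ∑ e, r e * |(if G.tgt e ∈ X then b (G.tgt e) else b (G.tgt e) + δ) -
      (if G.src e ∈ X then b (G.src e) else b (G.src e) + δ)| =
      ∑ e, r e * |b (G.tgt e) - b (G.src e)| + (∑ e ∈ G.boundary X, r e) * δ := by
    rw [boundary, Finset.sum_filter, Finset.sum_mul, ← Finset.sum_add_distrib]
    refine Finset.sum_congr rfl fun e _ => ?_
    have hs := hb (G.src e)
    have ht := hb (G.tgt e)
    by_cases h1 : G.src e ∈ X <;> by_cases h2 : G.tgt e ∈ X
    · simp [h1, h2]
    · simp only [h1, h2, hb' _ h2, if_true, if_false]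
      rw [abs_of_nonneg (by linarith), abs_of_nonneg (by linarith)]
      simp; ring
    · simp only [h1, h2, hb' _ h1, if_true, if_false]
      rw [abs_of_nonpos (by linarith), abs_of_nonpos (by linarith)]
      simp; ring
    · simp [h1, h2]
  have h2 : ∑ v, (N v : ℝ) * (if v ∈ X then b v else b v + δ) =
      ∑ v, (N v : ℝ) * b v - ((∑ v ∈ X, N v : ℤ) : ℝ) * δ := by
    have h3 : ((∑ v ∈ X, N v : ℤ) : ℝ) = - ∑ v, if v ∈ X then 0 else (N v : ℝ) := by
      rw [eq_neg_iff_add_eq_zero, Int.cast_sum, ← Finset.univ_inter X, ← Finset.sum_ite_mem,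
        ← Finset.sum_add_distrib, Finset.sum_congr (g := fun v => (N v : ℝ)) rfl]
      · exact_mod_cast hN
      · intro v _
        by_cases hv : v ∈ X <;> simp [hv]
    rw [h3, neg_mul, sub_neg_eq_add, Finset.sum_mul, ← Finset.sum_add_distrib]
    refine Finset.sum_congr rfl fun v _ => ?_
    split_ifs <;> ring
  rw [timeWeight, timeWeight, h1, h2, ← Complex.exp_add, cutWeight]
  congr 1
  push_cast
  ring

/-- The integral over the times in `(0, t]` of the points of `P`. -/
def pastIntegral (o : V) (r : E → ℝ) (P : Finset V) (t : ℝ) : ℂ :=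
  ∫ θ, G.timeWeight N r (pastTimes o P t θ) ∂cubeMeasure P t

theorem pastIntegral_empty (hN : ∑ v, N v = 0) (o : V) (r : E → ℝ) {t : ℝ} (ht : 0 ≤ t) :
    G.pastIntegral N o r ∅ t = Complex.exp (-(G.rootedWeight N o r ∅ * t)) := by
  have h := G.timeWeight_shift N hN r {o} (b := fun _ => 0) (m := 0) ht (by simp) (by simp)
  have h0 : G.timeWeight N r (fun _ => 0) = 1 := by simp [timeWeight]
  have hp : ∀ θ : V → ℝ, pastTimes o ∅ t θ =
      fun v => if v ∈ ({o} : Finset V) then 0 else 0 + t := by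
    intro θ; funext v; simp [pastTimes]
  have hu : (cubeMeasure (∅ : Finset V) t) Set.univ = 1 := by
    rw [cubeMeasure, Measure.pi_univ]; simp [coordMeasure]
  rw [pastIntegral]
  simp only [hp]
  rw [h, h0, mul_one, integral_const, rootedWeight]
  simp [measureReal_def, hu]

/-- Let `s` be the latest of the times of `P`, taken at `v`. Moving all points off `insert o P` back
from `t` to `s` costs `exp (-d (t - s))`, and then `v` is one of the points at the final time `s`.
-/
theorem pastIntegral_eq_integral (hN : ∑ v, N v = 0) {o : V} (r : E → ℝ) {P : Finset V}
    (ho : o ∉ P) (hP : P.Nonempty) {t : ℝ} (ht : 0 ≤ t) :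
    G.pastIntegral N o r P t = ∫ s in (0 : ℝ)..t,
      Complex.exp (-(G.rootedWeight N o r P * (t - s))) *
        ∑ v ∈ P, G.pastIntegral N o r (P.erase v) s := by
  have hc : Continuous fun θ => G.timeWeight N r (pastTimes o P t θ) := by
    refine (G.continuous_timeWeight N r).comp (continuous_pi fun v => ?_)
    unfold pastTimes
    split_ifs <;> fun_prop
  rw [pastIntegral, integral_cubeMeasure hP ht hc]
  refine intervalIntegral.integral_congr_ae ?_
  refine Eventually.of_forall fun s hs => ?_
  rw [Set.uIoc_of_le ht] at hs
  rw [Finset.mul_sum]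
  refine Finset.sum_congr rfl fun v hv => ?_
  rw [pastIntegral, ← integral_const_mul]
  refine integral_congr_ae ?_
  filter_upwards [cubeMeasure_ae_mem (P.erase v)] with θ hθ
  have h := G.timeWeight_shift N hN r (insert o P) (b := pastTimes o (P.erase v) s θ)
    (m := s) (δ := t - s) (by linarith [hs.2]) ?_ ?_
  · rw [rootedWeight, ← Complex.ofReal_sub, ← h]
    congr 1
    funext w
    have hvo : v ≠ o := fun h => ho (h ▸ hv)
    by_cases h1 : w = v
    · subst h1; simp [pastTimes, hv, hvo]
    · by_cases h2 : w ∈ P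
      · simp [pastTimes, h1, h2]
      · by_cases h3 : w = o
        · subst h3; simp [pastTimes, ho]
        · simp [pastTimes, h1, h2, h3]
  · intro w
    unfold pastTimes
    split_ifs with h1 h2
    · exact (hθ.1 w h1).2
    · exact hs.1.le
    · exact le_rfl
  · intro w hw
    rw [Finset.mem_insert, not_or] at hw
    simp [pastTimes, hw.1, hw.2]

theorem pastIntegral_eq_evolution (hN : ∑ v, N v = 0) {o : V} {r : E → ℝ}
    (hd : ∀ Y Z, Y ⊂ Z → Z ⊆ Finset.univ.erase o →
      G.rootedWeight N o r Y ≠ G.rootedWeight N o r Z) {t : ℝ} (ht : 0 ≤ t) :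
    G.pastIntegral N o r (Finset.univ.erase o) t =
      evolution (G.rootedWeight N o r) (Finset.univ.erase o) t :=
  eq_evolution hd (G.pastIntegral N o r) (fun _ h => G.pastIntegral_empty N hN o r h)
    (fun _ hX hne _ h => G.pastIntegral_eq_integral N hN r
      (fun ho => Finset.ne_of_mem_erase (hX ho) rfl) hne h) subset_rfl ht

end OrientedMultigraph

/-! ### Fourier series of the propagator on the circle. -/

section Propagator

theorem summable_one_div_int_sq_add_sq {q : ℝ} (hq : 0 < q) :
    Summable fun n : ℤ => 1 / ((n : ℝ) ^ 2 + q ^ 2) := by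
  refine Summable.of_norm_bounded_eventually
    (Real.summable_one_div_int_pow.2 (by norm_num : 1 < 2)) ?_
  filter_upwards [(Set.finite_singleton (0 : ℤ)).compl_mem_cofinite] with n hn
  have hn : (n : ℝ) ≠ 0 := by simpa using hn
  rw [Real.norm_of_nonneg (by positivity)]
  exact one_div_le_one_div_of_le (by positivity) (by nlinarith)

theorem integral_exp_neg_mul {z : ℂ} (hz : z ≠ 0) (T : ℝ) :
    ∫ x in (0 : ℝ)..T, Complex.exp (-(z * x)) = (1 - Complex.exp (-(z * T))) / z := by
  have := integral_exp_mul_complex (a := 0) (b := T) (neg_ne_zero.2 hz)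
  simp only [neg_mul] at this
  rw [this]
  simp
  field_simp
  ring

instance : Fact (0 < 2 * Real.pi) := ⟨Real.two_pi_pos⟩

/-- The propagator on a circle of length `2 π`, for arguments in `[0, 2 π]`. -/
def circlePropagator (q x : ℝ) : ℝ :=
  Real.pi * (thermalWeight q * Real.exp (-(q * x)) + thermalWeight (-q) * Real.exp (-(-q * x)))

theorem circlePropagator_period (q : ℝ) :
    circlePropagator q 0 = circlePropagator q (2 * Real.pi) := by
  have h1 := thermalWeight_mul_exp q
  have h2 := thermalWeight_mul_exp (-q)
  rw [neg_neg] at h2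
  rw [circlePropagator, circlePropagator, show q * (2 * Real.pi) = 2 * Real.pi * q by ring,
    show -q * (2 * Real.pi) = 2 * Real.pi * -q by ring, h1, h2]
  simp
  ring

theorem thermalWeight_mul_integral {r : ℝ} (hr : r ≠ 0) (n : ℤ) :
    ((thermalWeight r : ℝ) : ℂ) * ∫ x in (0 : ℝ)..(2 * Real.pi),
      Complex.exp (-((r + n * Complex.I) * x)) = 1 / (r * (r + n * Complex.I)) := by
  have hz : (r + n * Complex.I : ℂ) ≠ 0 := by
    intro h
    have := congrArg Complex.re h
    simp at this
    exact hr this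
  have hexp : Complex.exp (-((r + n * Complex.I) * ((2 * Real.pi : ℝ) : ℂ))) =
      ((Real.exp (-(2 * Real.pi * r)) : ℝ) : ℂ) := by
    have : -((r + n * Complex.I : ℂ) * ((2 * Real.pi : ℝ) : ℂ)) =
        ((-(2 * Real.pi * r) : ℝ) : ℂ) + ((-n : ℤ) : ℂ) * (2 * Real.pi * Complex.I) := by
      push_cast; ring
    rw [this, Complex.exp_add, Complex.exp_int_mul_two_pi_mul_I, mul_one, Complex.ofReal_exp]
  have h1 : (1 - Real.exp (-(2 * Real.pi * r))) ≠ 0 := by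
    rw [sub_ne_zero, ne_comm, ne_eq, Real.exp_eq_one_iff]
    have := Real.pi_pos
    intro h
    exact hr (by nlinarith [mul_eq_zero.1 (neg_eq_zero.1 h), Real.two_pi_pos.ne']) |>.elim
  rw [integral_exp_neg_mul hz, hexp, thermalWeight]
  have h2 : (1 - ((Real.exp (-(2 * Real.pi * r)) : ℝ) : ℂ)) ≠ 0 := by exact_mod_cast h1
  have h3 : (r : ℂ) ≠ 0 := by exact_mod_cast hr
  simp only [Complex.ofReal_div, Complex.ofReal_one, Complex.ofReal_mul, Complex.ofReal_sub]
  field_simp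

/-- The Fourier coefficients of the right side are computed: the two exponentials give `1 / (q (q +
i n))` and `1 / (q (q - i n))`, whose sum is `2 / (n² + q²)`. They are summable and the function is
continuous on the circle, so its series converges to it pointwise. -/
theorem hasSum_circlePropagator {q : ℝ} (hq : 0 < q) {x : ℝ} (hx : x ∈ Set.Icc 0 (2 * Real.pi)) :
    HasSum (fun n : ℤ => ((1 / ((n : ℝ) ^ 2 + q ^ 2) : ℝ) : ℂ) * Complex.exp (n * x * Complex.I))
      (circlePropagator q x : ℂ) := by
  have hp := Real.two_pi_pos
  set g : ℝ → ℂ := fun x => (circlePropagator q x : ℂ) with hg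
  have hgc : Continuous g := by
    simp only [hg, circlePropagator]; fun_prop
  have hgp : g 0 = g (2 * Real.pi) := by simp only [hg, circlePropagator_period q]
  let F : C(AddCircle (2 * Real.pi), ℂ) :=
    ⟨AddCircle.liftIco (2 * Real.pi) 0 g, AddCircle.liftIco_zero_continuous hgp hgc.continuousOn⟩
  have hF : F ((x : ℝ) : AddCircle (2 * Real.pi)) = g x := by
    change AddCircle.liftIco (2 * Real.pi) 0 g _ = g x
    rcases hx.2.eq_or_lt with h | h
    · rw [h, AddCircle.coe_period, ← hgp]
      exact AddCircle.liftIco_zero_coe_apply ⟨le_rfl, hp⟩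
    · exact AddCircle.liftIco_zero_coe_apply ⟨hx.1, h⟩
  have hcoef : ∀ n : ℤ, fourierCoeff F n = ((1 / ((n : ℝ) ^ 2 + q ^ 2) : ℝ) : ℂ) := by
    intro n
    change fourierCoeff (AddCircle.liftIco (2 * Real.pi) 0 g) n = _
    rw [fourierCoeff_liftIco_eq, fourierCoeffOn_eq_integral]
    have hi : ∀ r : ℝ, IntervalIntegrable (fun x : ℝ => ((thermalWeight r : ℝ) : ℂ) *
        Complex.exp (-((r + n * Complex.I) * x))) volume 0 (2 * Real.pi) := fun r =>
      (by fun_prop : Continuous fun x : ℝ => ((thermalWeight r : ℝ) : ℂ) *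
        Complex.exp (-((r + n * Complex.I) * x))).intervalIntegrable _ _
    have e : ∀ x : ℝ, fourier (-n) (x : AddCircle (0 + 2 * Real.pi - 0)) • g x =
        Real.pi * (((thermalWeight q : ℝ) : ℂ) * Complex.exp (-((q + n * Complex.I) * x)) +
          ((thermalWeight (-q) : ℝ) : ℂ) *
            Complex.exp (-((((-q : ℝ) : ℂ) + n * Complex.I) * x))) := by
      intro x
      rw [fourier_coe_apply, smul_eq_mul]
      have h1 : 2 * (Real.pi : ℂ) * Complex.I * ((-n : ℤ) : ℂ) * x /
          ((0 + 2 * Real.pi - 0 : ℝ) : ℂ) = -(n * Complex.I * x) := by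
        have : (Real.pi : ℂ) ≠ 0 := by exact_mod_cast Real.pi_ne_zero
        push_cast
        rw [zero_add, sub_zero]
        field_simp
      rw [h1]
      simp only [hg, circlePropagator]
      push_cast
      have h2 : ∀ r : ℂ, Complex.exp (-((r + n * Complex.I) * x)) =
          Complex.exp (-(n * Complex.I * x)) * Complex.exp (-(r * x)) := by
        intro r; rw [← Complex.exp_add]; congr 1; ring
      rw [h2, h2]
      ring
    simp only [e]
    rw [intervalIntegral.integral_const_mul, zero_add,
      intervalIntegral.integral_add (hi q) (hi (-q)),
      intervalIntegral.integral_const_mul, intervalIntegral.integral_const_mul,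
      thermalWeight_mul_integral hq.ne', thermalWeight_mul_integral (neg_ne_zero.2 hq.ne')]
    have h3 : (q + n * Complex.I : ℂ) ≠ 0 := by
      intro h
      have := congrArg Complex.re h
      simp at this
      exact hq.ne' this
    have h4 : (-q + n * Complex.I : ℂ) ≠ 0 := by
      intro h
      have := congrArg Complex.re h
      simp at this
      exact hq.ne' this
    have h5 : (q : ℂ) ≠ 0 := by exact_mod_cast hq.ne'
    have h6 : (Real.pi : ℂ) ≠ 0 := by exact_mod_cast Real.pi_ne_zero
    have h7 : ((n : ℂ) ^ 2 + q ^ 2) = -((q + n * Complex.I) * (-q + n * Complex.I)) := by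
      ring_nf; rw [Complex.I_sq]; ring
    rw [Complex.real_smul]
    push_cast
    rw [h7]
    field_simp
    ring
  have hs : Summable (fourierCoeff F) := by
    simp only [funext hcoef]
    exact Complex.ofRealCLM.summable (summable_one_div_int_sq_add_sq hq)
  have := has_pointwise_sum_fourier_series_of_summable hs (x : AddCircle (2 * Real.pi))
  rw [hF] at this
  convert this using 1
  funext n
  rw [hcoef, smul_eq_mul, fourier_coe_apply]
  congr 2
  have : (Real.pi : ℂ) ≠ 0 := by exact_mod_cast Real.pi_ne_zero
  push_cast
  field_simp

theorem hasSum_circlePropagator_abs {q : ℝ} (hq : 0 < q) {x : ℝ} (hx : |x| ≤ 2 * Real.pi) :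
    HasSum (fun n : ℤ => ((1 / ((n : ℝ) ^ 2 + q ^ 2) : ℝ) : ℂ) * Complex.exp (n * x * Complex.I))
      (circlePropagator q |x| : ℂ) := by
  have h := hasSum_circlePropagator hq (x := |x|) ⟨abs_nonneg x, hx⟩
  rcases le_total 0 x with h0 | h0
  · rwa [abs_of_nonneg h0] at h ⊢
  · rw [abs_of_nonpos h0] at h ⊢
    rw [← (Equiv.neg ℤ).hasSum_iff] at h
    convert h using 1
    funext n
    simp

end Propagator

/-! ### Sums of products as integrals over a product of counting measures. -/

section SumsOverProducts

variable {ι : Type*} [Fintype ι]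

theorem pi_count_eq_count {α : ι → Type*} [∀ i, MeasurableSpace (α i)]
    [∀ i, MeasurableSingletonClass (α i)] [∀ i, Countable (α i)] :
    Measure.pi (fun i => (Measure.count : Measure (α i))) = Measure.count := by
  refine Measure.ext_of_singleton fun a => ?_
  rw [Measure.pi_singleton]
  simp

theorem summable_prod_of_summable_norm {f : ι → ℤ → ℂ} (hf : ∀ i, Summable fun n => ‖f i n‖) :
    Summable fun n : ι → ℤ => ‖∏ i, f i (n i)‖ := by
  rw [← integrable_count_iff, ← pi_count_eq_count]
  exact Integrable.fintype_prod fun i => integrable_count_iff.2 (hf i)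

theorem hasSum_prod_of_summable_norm {f : ι → ℤ → ℂ} (hf : ∀ i, Summable fun n => ‖f i n‖)
    {a : ι → ℂ} (ha : ∀ i, HasSum (f i) (a i)) :
    HasSum (fun n : ι → ℤ => ∏ i, f i (n i)) (∏ i, a i) := by
  have hs := summable_prod_of_summable_norm hf
  have h := integral_fintype_prod_eq_prod (μ := fun _ => (Measure.count : Measure ℤ)) f
  have h1 : ∀ i, ∫ n, f i n ∂Measure.count = a i := fun i => by
    rw [integral_countable (integrable_count_iff.2 (hf i))]
    simpa [measureReal_def] using (ha i).tsum_eq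
  rw [pi_count_eq_count, integral_countable (integrable_count_iff.2 hs),
    Finset.prod_congr rfl fun i _ => h1 i] at h
  rw [← h]
  simpa [measureReal_def] using hs.of_norm.hasSum

end SumsOverProducts

/-! ### Generic parameters. -/

section Generic

variable {E : Type*} [Fintype E]

/-- No nontrivial relation with coefficients in `{-1, 0, 1}`. -/
def IsGeneric (q : E → ℝ) : Prop :=
  ∀ ε : E → SignType, ε ≠ 0 → ∑ e, ((ε e : ℤ) : ℝ) * q e ≠ 0

theorem IsGeneric.flipSigns [DecidableEq E] {q : E → ℝ} (hq : IsGeneric q) (D : Finset E) :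
    IsGeneric (flipSigns D q) := by
  intro ε hε
  have h := hq (fun e => if e ∈ D then -ε e else ε e) ?_
  · convert h using 2 with e
    by_cases he : e ∈ D <;> simp [_root_.flipSigns, he]
  · intro h
    apply hε
    funext e
    have := congrFun h e
    by_cases he : e ∈ D
    · simpa [he, SignType.neg_eq_zero_iff] using this
    · simpa [he] using this

theorem IsGeneric.smul {q : E → ℝ} (hq : IsGeneric q) {a : ℝ} (ha : a ≠ 0) :
    IsGeneric (a • q) := by
  intro ε hε
  have := mul_ne_zero ha (hq ε hε)
  rw [Finset.mul_sum] at this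
  convert this using 2 with e
  simp only [Pi.smul_apply, smul_eq_mul]
  ring

theorem IsGeneric.sum_ne_zero {q : E → ℝ} (hq : IsGeneric q) {S : Finset E} (hS : S.Nonempty) :
    ∑ e ∈ S, q e ≠ 0 := by
  classical
  have h := hq (fun e => if e ∈ S then 1 else 0) ?_
  · convert h using 1
    rw [← Finset.univ_inter S, ← Finset.sum_ite_mem]
    refine Finset.sum_congr rfl fun e _ => ?_
    by_cases he : e ∈ S <;> simp [he]
  · obtain ⟨e, he⟩ := hS
    intro h
    simpa [he] using congrFun h e

/-- The difference of two indicator functions takes values in `{-1, 0, 1}`; this is why relations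
with these coefficients are the ones excluded. -/
theorem IsGeneric.sum_ne_sum {q : E → ℝ} (hq : IsGeneric q) {S S' : Finset E} (hS : S ≠ S') :
    ∑ e ∈ S, q e ≠ ∑ e ∈ S', q e := by
  classical
  have h := hq (fun e => if e ∈ S then (if e ∈ S' then 0 else 1) else
    if e ∈ S' then -1 else 0) ?_
  · rw [← sub_ne_zero]
    convert h using 1
    rw [← Finset.univ_inter S, ← Finset.sum_ite_mem, ← Finset.univ_inter S',
      ← Finset.sum_ite_mem, ← Finset.sum_sub_distrib]
    refine Finset.sum_congr rfl fun e _ => ?_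
    by_cases he : e ∈ S <;> by_cases he' : e ∈ S' <;> simp [he, he']
  · intro h
    apply hS
    ext e
    have := congrFun h e
    by_cases he : e ∈ S <;> by_cases he' : e ∈ S' <;> simp [he, he'] at this ⊢

theorem IsGeneric.ne_zero {q : E → ℝ} (hq : IsGeneric q) (e : E) : q e ≠ 0 := by
  simpa using hq.sum_ne_zero (Finset.singleton_nonempty e)

end Generic

/-! ### Nonvanishing and distinctness of the rates. -/

namespace OrientedMultigraph

variable {V E : Type*}

theorem exists_mem_boundary_of_connected [Fintype E] [DecidableEq V] (G : OrientedMultigraph V E)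
    {A : Set E} (hA : (G.graphOn A).Connected) {X : Finset V} {u w : V} (hu : u ∈ X) (hw : w ∉ X) :
    ∃ e ∈ A, e ∈ G.boundary X := by
  obtain ⟨p⟩ := hA.preconnected u w
  obtain ⟨d, -, h1, h2⟩ := p.exists_boundary_dart (X : Set V) hu hw
  have : (SimpleGraph.fromRel fun u v => ∃ e ∈ A, G.src e = u ∧ G.tgt e = v).Adj d.fst d.snd :=
    d.adj
  rw [SimpleGraph.fromRel_adj] at this
  obtain ⟨-, ⟨e, he, h3, h4⟩ | ⟨e, he, h3, h4⟩⟩ := this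
  all_goals
    refine ⟨e, he, ?_⟩
    rw [mem_boundary, h3, h4]
    simp only [Finset.mem_coe] at h1 h2
    tauto

variable [Fintype E] [DecidableEq V] (G : OrientedMultigraph V E) (N : V → ℤ)

theorem cutWeight_re (r : E → ℝ) (X : Finset V) :
    (G.cutWeight N r X).re = ∑ e ∈ G.boundary X, r e := by
  rw [cutWeight, ← Complex.ofReal_intCast]
  simp

variable [Fintype V]

theorem boundary_nonempty (hG : (G.graphOn Set.univ).Connected)
    {X : Finset V} (hX : X.Nonempty) (hX' : X ≠ Finset.univ) :
    (G.boundary X).Nonempty := by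
  obtain ⟨u, hu⟩ := hX
  obtain ⟨w, hw⟩ : ∃ w, w ∉ X := by
    by_contra! h
    exact hX' (Finset.eq_univ_iff_forall.2 h)
  obtain ⟨e, -, he⟩ := G.exists_mem_boundary_of_connected hG hu hw
  exact ⟨e, he⟩

theorem cutWeight_ne_zero (hG : (G.graphOn Set.univ).Connected)
    {r : E → ℝ} (hr : IsGeneric r) {X : Finset V} (hX : X.Nonempty)
    (hX' : X ≠ Finset.univ) : G.cutWeight N r X ≠ 0 := by
  intro h
  have := congrArg Complex.re h
  rw [cutWeight_re] at this
  exact hr.sum_ne_zero (G.boundary_nonempty hG hX hX') this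

theorem rootedWeight_ne (hG : (G.graphOn Set.univ).Connected)
    {r : E → ℝ} (hr : IsGeneric r) {o : V} {Y Z : Finset V} (hYZ : Y ⊂ Z)
    (hZ : Z ⊆ Finset.univ.erase o) : G.rootedWeight N o r Y ≠ G.rootedWeight N o r Z := by
  intro h
  have := congrArg Complex.re h
  rw [rootedWeight, rootedWeight, cutWeight_re, cutWeight_re] at this
  refine hr.sum_ne_sum ?_ this
  obtain ⟨w, hw, hw'⟩ := Finset.exists_of_ssubset hYZ
  have ho : o ∉ Z := fun h => Finset.ne_of_mem_erase (hZ h) rfl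
  -- A line leaving `Z \ Y` lies in exactly one of the two boundaries, so these are different sets
  -- and genericity separates their sums.
  obtain ⟨e, -, he⟩ := G.exists_mem_boundary_of_connected hG (X := Z \ Y) (u := w) (w := o)
    (by simp [hw, hw']) (by simp [ho])
  intro h'
  have h1 : e ∈ G.boundary (insert o Y) ↔ e ∈ G.boundary (insert o Z) := by rw [h']
  rw [mem_boundary] at he
  simp only [mem_boundary, Finset.mem_insert, Finset.mem_sdiff] at h1 he
  have h3 := fun h : G.src e ∈ Y => hYZ.subset h
  have h4 := fun h : G.tgt e ∈ Y => hYZ.subset h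
  have h5 : G.src e = o → G.src e ∉ Z := fun h => h ▸ ho
  have h6 : G.tgt e = o → G.tgt e ∉ Z := fun h => h ▸ ho
  clear hw hw' h' this h hr hG ho
  grind

end OrientedMultigraph

/-! ### The Matsubara sum as a time integral and as a sum over chains. -/

namespace OrientedMultigraph

section

variable {V E : Type*} [Fintype V] [Fintype E] [DecidableEq E]
variable (G : OrientedMultigraph V E) (N : V → ℤ)

/-- Expansion of a product of two-term sums: `D` is the set of lines for which the term with `-q e`
is chosen. -/
theorem prod_circlePropagator (q : E → ℝ) (θ : V → ℝ) :
    (∏ e, (circlePropagator (q e) |θ (G.tgt e) - θ (G.src e)| : ℂ)) *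
      Complex.exp (-((∑ v, (N v : ℝ) * θ v : ℝ) : ℂ) * Complex.I) =
    (Real.pi : ℂ) ^ Fintype.card E * ∑ D : Finset E,
      ((∏ e, thermalWeight (flipSigns D q e) : ℝ) : ℂ) * G.timeWeight N (flipSigns D q) θ := by
  have h1 : ∀ e, (circlePropagator (q e) |θ (G.tgt e) - θ (G.src e)| : ℂ) = (Real.pi : ℂ) *
      (((thermalWeight (-q e) * Real.exp (-(-q e * |θ (G.tgt e) - θ (G.src e)|)) : ℝ) : ℂ) +
        ((thermalWeight (q e) * Real.exp (-(q e * |θ (G.tgt e) - θ (G.src e)|)) : ℝ) : ℂ)) := by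
    intro e
    rw [circlePropagator]; push_cast; ring
  rw [Finset.prod_congr rfl fun e _ => h1 e, Finset.prod_mul_distrib, Finset.prod_const,
    Finset.card_univ, mul_assoc, Finset.prod_add, Finset.sum_mul, Finset.powerset_univ]
  congr 1
  refine Finset.sum_congr rfl fun D _ => ?_
  have h2 : G.timeWeight N (flipSigns D q) θ =
      ((∏ e, Real.exp (-(flipSigns D q e * |θ (G.tgt e) - θ (G.src e)|)) : ℝ) : ℂ) *
        Complex.exp (-((∑ v, (N v : ℝ) * θ v : ℝ) : ℂ) * Complex.I) := by
    rw [timeWeight, sub_eq_add_neg, Complex.exp_add, ← Complex.ofReal_neg, ← Complex.ofReal_exp,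
      ← Finset.sum_neg_distrib, Real.exp_sum, neg_mul]
  rw [h2, ← mul_assoc, ← Complex.ofReal_mul, ← Finset.prod_mul_distrib]
  congr 1
  rw [Complex.ofReal_prod, ← Finset.prod_mul_prod_compl D, ← Finset.compl_eq_univ_sdiff]
  congr 1
  · exact Finset.prod_congr rfl fun e he => by simp [flipSigns, he]
  · exact Finset.prod_congr rfl fun e he => by
      rw [Finset.mem_compl] at he; simp [flipSigns, he]

end

variable {V E : Type*} [Fintype V] [DecidableEq V]
variable (G : OrientedMultigraph V E) (N : V → ℤ)

theorem sum_sign (e : E) : ∑ v, G.sign v e = 0 := by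
  simp [sign]

theorem sum_mul_sign (θ : V → ℝ) (e : E) :
    ∑ v, (G.sign v e : ℝ) * θ v = θ (G.tgt e) - θ (G.src e) := by
  simp [sign, sub_mul]

variable [Fintype E]

theorem sum_vertexSum {R : Type*} [CommRing R] (n : E → R) : ∑ v, G.vertexSum n v = 0 := by
  simp only [vertexSum]
  rw [Finset.sum_comm]
  refine Finset.sum_eq_zero fun e _ => ?_
  rw [← Finset.sum_mul, ← Int.cast_sum, sum_sign]
  simp

theorem summand_nonneg (q : E → ℝ) (n : E → ℤ) : 0 ≤ G.summand N q n := by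
  unfold summand
  refine div_nonneg (Finset.prod_nonneg fun v _ => ?_) (Finset.prod_nonneg fun e _ => by positivity)
  split_ifs <;> norm_num

theorem summand_le (q : E → ℝ) (n : E → ℤ) :
    G.summand N q n ≤ ∏ e, 1 / ((n e : ℝ) ^ 2 + q e ^ 2) := by
  rw [summand, Finset.prod_div_distrib, Finset.prod_const_one]
  refine div_le_div_of_nonneg_right ?_ (Finset.prod_nonneg fun e _ => by positivity)
  refine Finset.prod_le_one (fun v _ => ?_) fun v _ => ?_ <;> split_ifs <;> norm_num

theorem summable_prod_propagator {q : E → ℝ} (hq : ∀ e, 0 < q e) :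
    Summable fun n : E → ℤ => ∏ e, 1 / ((n e : ℝ) ^ 2 + q e ^ 2) := by
  have h := summable_prod_of_summable_norm
    (f := fun e (n : ℤ) => ((1 / ((n : ℝ) ^ 2 + q e ^ 2) : ℝ) : ℂ)) fun e => by
      simpa only [Complex.norm_real] using (summable_one_div_int_sq_add_sq (hq e)).norm
  simp only [← Complex.ofReal_prod, Complex.norm_real] at h
  exact h.of_norm

theorem summable_summand {q : E → ℝ} (hq : ∀ e, 0 < q e) : Summable (G.summand N q) :=
  (summable_prod_propagator hq).of_nonneg_of_le (G.summand_nonneg N q) (G.summand_le N q)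

theorem integral_exp_int_mul (k : ℤ) :
    ∫ x in Set.Ioc 0 (2 * Real.pi), Complex.exp (k * x * Complex.I) =
      if k = 0 then ((2 * Real.pi : ℝ) : ℂ) else 0 := by
  rw [← intervalIntegral.integral_of_le Real.two_pi_pos.le]
  split_ifs with hk
  · subst hk; simp
  · have h : (k * Complex.I : ℂ) ≠ 0 := mul_ne_zero (by exact_mod_cast hk) Complex.I_ne_zero
    have e : ∀ x : ℝ, (k * x * Complex.I : ℂ) = -(-(k * Complex.I) * x) := fun x => by ring
    simp only [e]
    rw [integral_exp_neg_mul (neg_ne_zero.2 h)]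
    have : -(-(k * Complex.I) * ((2 * Real.pi : ℝ) : ℂ)) = (k : ℂ) * (2 * Real.pi * Complex.I) := by
      push_cast; ring
    rw [this, Complex.exp_int_mul_two_pi_mul_I]
    simp

/-- Orthogonality of characters gives the deltas of the points other than `o`. The delta at `o` is
implied by these, since both `vertexSum` and `N` have total 0. -/
theorem integral_planeWave (hN : ∑ v, N v = 0) (o : V) (n : E → ℤ) :
    ∫ θ, Complex.exp ((∑ v, (G.vertexSum n v - N v : ℤ) *
        (pastTimes o (Finset.univ.erase o) (2 * Real.pi) θ v : ℂ)) * Complex.I)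
        ∂cubeMeasure (Finset.univ.erase o) (2 * Real.pi) =
      (2 * Real.pi : ℂ) ^ (Fintype.card V - 1) *
        ∏ v, if G.vertexSum n v = N v then (1 : ℂ) else 0 := by
  set k : V → ℤ := fun v => G.vertexSum n v - N v with hk
  have hk0 : ∑ v, k v = 0 := by
    have := G.sum_vertexSum n
    simp only [hk] at this ⊢
    rw [Finset.sum_sub_distrib, this, hN, sub_zero]
  set g : V → ℝ → ℂ := fun v x => if v = o then 1 else Complex.exp (k v * x * Complex.I) with hg
  have e1 : ∀ θ : V → ℝ, Complex.exp ((∑ v, (k v : ℤ) *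
      (pastTimes o (Finset.univ.erase o) (2 * Real.pi) θ v : ℂ)) * Complex.I) =
      ∏ v, g v (θ v) := by
    intro θ
    rw [Finset.sum_mul, Complex.exp_sum]
    refine Finset.prod_congr rfl fun v _ => ?_
    by_cases hv : v = o
    · simp [pastTimes, hv, hg]
    · simp [pastTimes, hv, hg]
  change ∫ θ, Complex.exp ((∑ v, (k v : ℤ) *
      (pastTimes o (Finset.univ.erase o) (2 * Real.pi) θ v : ℂ)) * Complex.I) ∂_ = _
  rw [integral_congr_ae (Eventually.of_forall e1), cubeMeasure, integral_fintype_prod_eq_prod,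
    ← Finset.mul_prod_erase _ _ (Finset.mem_univ o),
    ← Finset.mul_prod_erase _ (fun v => if G.vertexSum n v = N v then (1 : ℂ) else 0)
      (Finset.mem_univ o)]
  have e2 : ∀ v ∈ Finset.univ.erase o,
      ∫ x, g v x
        ∂coordMeasure (Finset.univ.erase o) (2 * Real.pi) v =
      (2 * Real.pi) * if G.vertexSum n v = N v then (1 : ℂ) else 0 := by
    intro v hv
    have hv' := Finset.ne_of_mem_erase hv
    simp only [hg, hv', if_false, coordMeasure, hv, if_true]
    rw [integral_exp_int_mul]
    have : k v = 0 ↔ G.vertexSum n v = N v := by rw [hk]; exact sub_eq_zero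
    simp only [this]
    split_ifs <;> simp
  rw [Finset.prod_congr rfl e2, Finset.prod_mul_distrib, Finset.prod_const,
    Finset.card_erase_of_mem (Finset.mem_univ o), Finset.card_univ]
  have e3 : ∫ x, g o x
        ∂coordMeasure (Finset.univ.erase o) (2 * Real.pi) o = 1 := by
    simp [coordMeasure, hg]
  rw [e3, one_mul]
  congr 1
  by_cases hall : ∀ v ∈ Finset.univ.erase o, G.vertexSum n v = N v
  · have ho : G.vertexSum n o = N o := by
      rw [← Finset.add_sum_erase _ _ (Finset.mem_univ o), Finset.sum_eq_zero, add_zero] at hk0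
      · exact sub_eq_zero.1 hk0
      · exact fun v hv => sub_eq_zero.2 (hall v hv)
    rw [if_pos ho, one_mul]
  · push Not at hall
    obtain ⟨v, hv, hne⟩ := hall
    rw [Finset.prod_eq_zero hv (by simp [hne]), mul_zero]

variable [DecidableEq E]

/-- The Matsubara sum as an integral over the times of the points. -/
theorem matsubaraSum_eq_sum_pastIntegral (hN : ∑ v, N v = 0) (o : V) {q : E → ℝ}
    (hq : ∀ e, 0 < q e) :
    (2 * Real.pi : ℂ) ^ (Fintype.card V - 1) * (G.matsubaraSum N q : ℂ) =
      (Real.pi : ℂ) ^ Fintype.card E * ∑ D : Finset E,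
        ((∏ e, thermalWeight (flipSigns D q e) : ℝ) : ℂ) *
          G.pastIntegral N o (flipSigns D q) (Finset.univ.erase o) (2 * Real.pi) := by
  set μ := cubeMeasure (Finset.univ.erase o) (2 * Real.pi)
  set T : (V → ℝ) → (V → ℝ) := pastTimes o (Finset.univ.erase o) (2 * Real.pi) with hT
  have hTc : Continuous T := by
    refine continuous_pi fun v => ?_
    simp only [hT, pastTimes]
    split_ifs <;> fun_prop
  set a : (E → ℤ) → ℝ := fun n => ∏ e, 1 / ((n e : ℝ) ^ 2 + q e ^ 2) with ha
  have ha0 : ∀ n, 0 ≤ a n := fun n => Finset.prod_nonneg fun e _ => by positivity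
  set F : (E → ℤ) → (V → ℝ) → ℂ := fun n θ => (a n : ℂ) *
    Complex.exp ((∑ v, (G.vertexSum n v - N v : ℤ) * (T θ v : ℂ)) * Complex.I) with hF
  have hFc : ∀ n, Continuous (F n) := by
    intro n
    have : ∀ v, Continuous fun θ => T θ v := fun v => (continuous_apply v).comp hTc
    simp only [hF]
    fun_prop
  have hnorm : ∀ n θ, ‖F n θ‖ = a n := by
    intro n θ
    have : (∑ v, ((G.vertexSum n v - N v : ℤ) : ℂ) * (T θ v : ℂ)) =
        ((∑ v, ((G.vertexSum n v - N v : ℤ) : ℝ) * T θ v : ℝ) : ℂ) := by push_cast; rfl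
    simp only [hF]
    rw [norm_mul, this, Complex.norm_exp_ofReal_mul_I, mul_one, Complex.norm_real,
      Real.norm_of_nonneg (ha0 n)]
  have hint : ∀ n, Integrable (F n) μ := fun n =>
    integrable_cubeMeasure _ Real.two_pi_pos.le (hFc n)
  have hsum : Summable fun n => ∫ θ, ‖F n θ‖ ∂μ := by
    simp only [hnorm, integral_const, smul_eq_mul]
    exact (summable_prod_propagator hq).mul_left _
  have h1 := (hasSum_integral_of_summable_integral_norm hint hsum).tsum_eq
  have h2 : ∀ n, ∫ θ, F n θ ∂μ =
      (2 * Real.pi : ℂ) ^ (Fintype.card V - 1) * (G.summand N q n : ℂ) := by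
    intro n
    simp only [hF]
    rw [integral_const_mul, G.integral_planeWave N hN o n]
    simp only [ha, summand]
    have : ((∏ v, if G.vertexSum n v = N v then (1 : ℝ) else 0 : ℝ) : ℂ) =
        ∏ v, if G.vertexSum n v = N v then (1 : ℂ) else 0 := by
      rw [Complex.ofReal_prod]
      exact Finset.prod_congr rfl fun v _ => by split_ifs <;> simp
    rw [Complex.ofReal_div, this, Finset.prod_div_distrib, Finset.prod_const_one,
      Complex.ofReal_div, Complex.ofReal_one]
    ring
  simp only [h2] at h1
  rw [tsum_mul_left, ← Complex.ofReal_tsum] at h1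
  rw [matsubaraSum, h1]
  -- At fixed times the sum over `n` factorizes over the lines; all time differences are at most
  -- `2π` in absolute value, where the closed form of the propagator is valid.
  have h3 : ∀ᵐ θ ∂μ, ∑' n, F n θ = (Real.pi : ℂ) ^ Fintype.card E * ∑ D : Finset E,
      ((∏ e, thermalWeight (flipSigns D q e) : ℝ) : ℂ) * G.timeWeight N (flipSigns D q) (T θ) := by
    filter_upwards [cubeMeasure_ae_mem (Finset.univ.erase o)] with θ hθ
    have hT' : ∀ v, T θ v ∈ Set.Icc 0 (2 * Real.pi) := by
      intro v
      by_cases hv : v = o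
      · simp [hT, pastTimes, hv, Real.pi_pos.le]
      · have := hθ.1 v (by simp [hv])
        simp only [hT, pastTimes]
        rw [if_pos (by simp [hv])]
        exact ⟨this.1.le, this.2⟩
    rw [← prod_circlePropagator]
    have h4 : ∀ e, HasSum (fun n : ℤ => ((1 / ((n : ℝ) ^ 2 + q e ^ 2) : ℝ) : ℂ) *
        Complex.exp (n * ((T θ (G.tgt e) - T θ (G.src e) : ℝ) : ℂ) * Complex.I))
        (circlePropagator (q e) |T θ (G.tgt e) - T θ (G.src e)| : ℂ) := fun e =>
      hasSum_circlePropagator_abs (hq e) (by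
        have h5 := hT' (G.tgt e)
        have h6 := hT' (G.src e)
        rw [abs_le]
        constructor <;> linarith [h5.1, h5.2, h6.1, h6.2])
    have h5 := hasSum_prod_of_summable_norm (fun e => by
      have : ∀ n : ℤ, ‖((1 / ((n : ℝ) ^ 2 + q e ^ 2) : ℝ) : ℂ) *
          Complex.exp (n * ((T θ (G.tgt e) - T θ (G.src e) : ℝ) : ℂ) * Complex.I)‖ =
          1 / ((n : ℝ) ^ 2 + q e ^ 2) := by
        intro n
        rw [norm_mul, ← Complex.ofReal_intCast, ← Complex.ofReal_mul,
          Complex.norm_exp_ofReal_mul_I, mul_one, Complex.norm_real,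
          Real.norm_of_nonneg (by positivity)]
      simp only [this]
      exact summable_one_div_int_sq_add_sq (hq e)) h4
    rw [← (h5.mul_right _).tsum_eq]
    refine tsum_congr fun n => ?_
    simp only [hF, ha]
    rw [Finset.prod_mul_distrib, Complex.ofReal_prod, mul_assoc, ← Complex.exp_sum,
      ← Complex.exp_add, ← Finset.sum_mul, ← add_mul]
    congr 3
    -- Summation by parts on the graph: the coboundary is adjoint to `vertexSum`.
    have h6 : ∑ e, (n e : ℝ) * (T θ (G.tgt e) - T θ (G.src e)) =
        ∑ v, ((G.vertexSum n v : ℤ) : ℝ) * T θ v := by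
      simp only [← G.sum_mul_sign, vertexSum, Finset.mul_sum, Int.cast_sum, Finset.sum_mul]
      rw [Finset.sum_comm]
      refine Finset.sum_congr rfl fun v _ => Finset.sum_congr rfl fun e _ => ?_
      push_cast; ring
    have h7 : ((∑ e, (n e : ℝ) * (T θ (G.tgt e) - T θ (G.src e)) : ℝ) : ℂ) =
        ∑ e, (n e : ℂ) * ((T θ (G.tgt e) - T θ (G.src e) : ℝ) : ℂ) := by push_cast; rfl
    rw [← h7, h6]
    push_cast
    rw [← sub_eq_add_neg, ← Finset.sum_sub_distrib]
    exact Finset.sum_congr rfl fun v _ => by ring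
  rw [integral_congr_ae h3, integral_const_mul, integral_finsetSum]
  · simp only [integral_const_mul]
    rfl
  · intro D _
    exact integrable_cubeMeasure _ Real.two_pi_pos.le
      (((G.continuous_timeWeight N _).comp hTc).const_mul _)

/-- The Matsubara sum in terms of chains of sets of points. -/
theorem matsubaraSum_eq_sum_fullChainSum (hG : (G.graphOn Set.univ).Connected)
    (hN : ∑ v, N v = 0) {q : E → ℝ}
    (hq : ∀ e, 0 < q e) (hgen : IsGeneric q) :
    (2 * Real.pi : ℂ) ^ (Fintype.card V - 1) * (G.matsubaraSum N q : ℂ) =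
      (Real.pi : ℂ) ^ Fintype.card E * ∑ D : Finset E,
        ((∏ e, thermalWeight (flipSigns D q e) : ℝ) : ℂ) *
          fullChainSum (G.cutWeight N (flipSigns D q)) := by
  obtain ⟨o⟩ := hG.nonempty
  rw [G.matsubaraSum_eq_sum_pastIntegral N hN o hq]
  congr 1
  have h1 : ∀ D : Finset E, G.pastIntegral N o (flipSigns D q) (Finset.univ.erase o) (2 * Real.pi) =
      evolution (G.rootedWeight N o (flipSigns D q)) (Finset.univ.erase o) (2 * Real.pi) := fun D =>
    G.pastIntegral_eq_evolution N hN
      (fun _ _ hY hZ => G.rootedWeight_ne N hG (hgen.flipSigns D) hY hZ)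
      Real.two_pi_pos.le
  simp only [h1]
  rw [G.sum_thermalWeight_mul_evolution N hN o q]
  refine Finset.sum_congr rfl fun D _ => ?_
  rw [rootedChainSum_eq o fun X hX hX' => G.cutWeight_ne_zero N hG (hgen.flipSigns D) hX hX']

end OrientedMultigraph

/-! ### Linear algebra of the constraints; cutsets. -/

namespace OrientedMultigraph

variable {V E : Type*} [DecidableEq V]

section LinearAlgebra

variable [Fintype E] {R : Type*} [CommRing R] (G : OrientedMultigraph V E)

/-- The vertex sums as a linear map. -/
def vertexSumLinear (R : Type*) [CommRing R] : (E → R) →ₗ[R] (V → R) where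
  toFun n v := G.vertexSum n v
  map_add' m n := by
    funext v; simp [vertexSum, mul_add, Finset.sum_add_distrib]
  map_smul' a n := by
    funext v; simp [vertexSum, Finset.mul_sum, mul_left_comm]

theorem vertexSum_single [DecidableEq E] (e : E) :
    G.vertexSumLinear R (Pi.single e 1) = Pi.single (G.tgt e) 1 - Pi.single (G.src e) 1 := by
  funext v
  simp only [vertexSumLinear, vertexSum, LinearMap.coe_mk, AddHom.coe_mk, sign, Pi.sub_apply]
  rw [Finset.sum_eq_single e]
  · simp [Pi.single_apply, eq_comm]
  · intro e' _ h; simp [h]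
  · simp

/-- The vertex sums of the functions supported in `T`. -/
def vertexSumRange (R : Type*) [CommRing R] (T : Finset E) : Submodule R (V → R) :=
  Submodule.map (G.vertexSumLinear R)
    { carrier := {x | ∀ e, e ∉ T → x e = 0}
      add_mem' := fun ha hb e he => by simp [ha e he, hb e he]
      zero_mem' := fun _ _ => rfl
      smul_mem' := fun c x hx e he => by simp [hx e he] }

/-- A unit flow along a path in `T` from `a` to `b`. No division occurs, so this holds over `ℤ` as
well as over `ℝ`; the sum over `n` and the integral both need it. -/
theorem single_sub_single_mem {T : Finset E} (hT : (G.graphOn {e | e ∈ T}).Connected) (a b : V) :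
    (Pi.single b 1 - Pi.single a 1 : V → R) ∈ G.vertexSumRange R T := by
  classical
  obtain ⟨p⟩ := hT.preconnected a b
  induction p with
  | nil => simp
  | @cons u v w h p ih =>
    have hadj : (SimpleGraph.fromRel fun u v => ∃ e ∈ ({e | e ∈ T} : Set E), G.src e = u ∧
      G.tgt e = v).Adj u v := h
    rw [SimpleGraph.fromRel_adj] at hadj
    have hline : ∀ e ∈ T, (Pi.single (G.tgt e) 1 - Pi.single (G.src e) 1 : V → R) ∈
        G.vertexSumRange R T := by
      intro e he
      refine ⟨Pi.single e 1, ?_, G.vertexSum_single e⟩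
      intro e' he'
      have : e' ≠ e := fun h => he' (h ▸ he)
      simp [this]
    have huv : (Pi.single v 1 - Pi.single u 1 : V → R) ∈ G.vertexSumRange R T := by
      obtain ⟨-, ⟨e, he, rfl, rfl⟩ | ⟨e, he, rfl, rfl⟩⟩ := hadj
      · exact hline e he
      · rw [← neg_sub]
        exact neg_mem (hline e he)
    have := add_mem ih huv
    rwa [sub_add_sub_cancel] at this

variable [Fintype V]

theorem mem_vertexSumRange {T : Finset E} (hT : (G.graphOn {e | e ∈ T}).Connected) {w : V → R}
    (hw : ∑ v, w v = 0) : w ∈ G.vertexSumRange R T := by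
  obtain ⟨o⟩ := hT.nonempty
  have : w = ∑ v, w v • (Pi.single v 1 - Pi.single o 1 : V → R) := by
    simp only [smul_sub, Finset.sum_sub_distrib]
    rw [← Finset.sum_smul, hw, zero_smul, sub_zero]
    funext u
    simp [Pi.single_apply]
  rw [this]
  exact sum_mem fun v _ => Submodule.smul_mem _ _ (G.single_sub_single_mem hT o v)

/-- The values off a spanning tree can be prescribed. -/
theorem exists_solution {T : Finset E} (hT : (G.graphOn {e | e ∈ T}).Connected) {w : V → R}
    (hw : ∑ v, w v = 0) (y : {l // l ∉ T} → R) :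
    ∃ x : E → R, (∀ v, G.vertexSum x v = w v) ∧ ∀ l, x l.1 = y l := by
  classical
  set x₀ : E → R := fun e => if h : e ∉ T then y ⟨e, h⟩ else 0 with hx₀
  obtain ⟨x₁, h1, h2⟩ := G.mem_vertexSumRange hT (w := fun v => w v - G.vertexSum x₀ v)
    (by rw [Finset.sum_sub_distrib, hw, G.sum_vertexSum, sub_zero])
  refine ⟨x₀ + x₁, fun v => ?_, fun l => ?_⟩
  · have h3 : G.vertexSum (x₀ + x₁) v = G.vertexSum x₀ v + G.vertexSum x₁ v :=
      congrFun ((G.vertexSumLinear R).map_add x₀ x₁) v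
    have h4 : G.vertexSum x₁ v = w v - G.vertexSum x₀ v := congrFun h2 v
    rw [h3, h4, add_sub_cancel]
  · have := h1 l.1 l.2
    rw [Pi.add_apply, this]
    simp [hx₀, l.2]

/-- Dimension count: flows on `T` together with one source at `o` map onto `ℝ^V`, and `|T| + 1 =
|V|`, so the map is injective too. -/
theorem eq_zero_of_vertexSum_eq_zero {T : Finset E} (hT : G.IsSpanningTree T) {x : E → ℝ}
    (h0 : ∀ v, G.vertexSum x v = 0) (h1 : ∀ e, e ∉ T → x e = 0) : x = 0 := by
  classical
  obtain ⟨o⟩ := hT.1.nonempty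
  let ext : ({e // e ∈ T} → ℝ) →ₗ[ℝ] (E → ℝ) :=
    { toFun := fun z e => if h : e ∈ T then z ⟨e, h⟩ else 0
      map_add' := fun a b => by funext e; by_cases h : e ∈ T <;> simp [h]
      map_smul' := fun a b => by funext e; by_cases h : e ∈ T <;> simp [h] }
  let Φ : (({e // e ∈ T} → ℝ) × ℝ) →ₗ[ℝ] (V → ℝ) :=
    LinearMap.coprod (G.vertexSumLinear ℝ ∘ₗ ext) (LinearMap.toSpanSingleton ℝ _ (Pi.single o 1))
  have hdim : Module.finrank ℝ (({e // e ∈ T} → ℝ) × ℝ) = Module.finrank ℝ (V → ℝ) := by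
    simp [hT.2]
  have hsurj : Function.Surjective Φ := by
    intro w
    obtain ⟨x', hx', hw'⟩ := G.mem_vertexSumRange (R := ℝ) hT.1
      (w := w - (∑ v, w v) • Pi.single o 1) (by simp [Finset.sum_sub_distrib, Pi.single_apply])
    refine ⟨(fun e => x' e.1, ∑ v, w v), ?_⟩
    have hext : ext (fun e => x' e.1) = x' := by
      funext e
      by_cases h : e ∈ T
      · simp [ext, h]
      · simp [ext, h, hx' e h]
    simp only [Φ, LinearMap.coprod_apply, LinearMap.comp_apply, hext, hw',
      LinearMap.toSpanSingleton_apply]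
    abel
  have hinj := (LinearMap.injective_iff_surjective_of_finrank_eq_finrank hdim).2 hsurj
  have hext : ext (fun e => x e.1) = x := by
    funext e
    by_cases h : e ∈ T
    · simp [ext, h]
    · simp [ext, h, h1 e h]
  have : (fun e : {e // e ∈ T} => x e.1, (0 : ℝ)) = 0 := by
    apply hinj
    simp only [Φ, LinearMap.coprod_apply, LinearMap.comp_apply, hext, map_zero, add_zero]
    funext v
    exact h0 v
  funext e
  by_cases h : e ∈ T
  · exact congrFun (congrArg Prod.fst this) ⟨e, h⟩
  · exact h1 e h

variable {N : V → ℤ} {T : Finset E}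

theorem existsUnique_isSolution (hT : G.IsSpanningTree T) (hN : ∑ v, N v = 0)
    (y : {l // l ∉ T} → ℝ) : ∃! x : E → ℝ, G.IsSolution N T y x := by
  obtain ⟨x, hx⟩ := G.exists_solution hT.1 (w := fun v => (N v : ℝ)) (by exact_mod_cast hN) y
  refine ⟨x, hx, fun x' hx' => ?_⟩
  rw [← sub_eq_zero]
  refine G.eq_zero_of_vertexSum_eq_zero hT (fun v => ?_) fun e he => ?_
  · have : G.vertexSum (x' - x) v = G.vertexSum x' v - G.vertexSum x v :=
      congrFun ((G.vertexSumLinear ℝ).map_sub x' x) v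
    rw [this, hx.1, hx'.1, sub_self]
  · rw [Pi.sub_apply, hx.2 ⟨e, he⟩, hx'.2 ⟨e, he⟩, sub_self]

theorem isSolution_solution (hT : G.IsSpanningTree T) (hN : ∑ v, N v = 0)
    (y : {l // l ∉ T} → ℝ) : G.IsSolution N T y (G.solution N T y) :=
  Classical.epsilon_spec (G.existsUnique_isSolution hT hN y).exists

theorem eq_solution (hT : G.IsSpanningTree T) (hN : ∑ v, N v = 0)
    {y : {l // l ∉ T} → ℝ} {x : E → ℝ} (hx : G.IsSolution N T y x) : x = G.solution N T y :=
  (G.existsUnique_isSolution hT hN y).unique hx (G.isSolution_solution hT hN y)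

theorem solution_natCast_smul (hT : G.IsSpanningTree T) (hN : ∑ v, N v = 0)
    (y : {l // l ∉ T} → ℝ) (m : ℕ) :
    G.solution (fun v => m * N v) T ((m : ℝ) • y) = (m : ℝ) • G.solution N T y := by
  refine (G.eq_solution hT (by rw [← Finset.mul_sum, hN, mul_zero]) ⟨fun v => ?_, fun l => ?_⟩).symm
  · have : G.vertexSum ((m : ℝ) • G.solution N T y) v =
      (m : ℝ) • G.vertexSum (G.solution N T y) v :=
      congrFun ((G.vertexSumLinear ℝ).map_smul (m : ℝ) (G.solution N T y)) v
    rw [this, (G.isSolution_solution hT hN y).1 v]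
    push_cast
    rfl
  · rw [Pi.smul_apply, Pi.smul_apply, (G.isSolution_solution hT hN y).2 l]

/-- The solution is a linear left inverse of the injective map (vertex sums, values off `T`),
applied to the data. -/
theorem continuous_solution (hT : G.IsSpanningTree T) (hN : ∑ v, N v = 0) :
    Continuous (G.solution N T) := by
  let f : (E → ℝ) →ₗ[ℝ] (V → ℝ) × ({l // l ∉ T} → ℝ) :=
    (G.vertexSumLinear ℝ).prod (LinearMap.funLeft ℝ ℝ Subtype.val)
  have hf : LinearMap.ker f = ⊥ := by
    rw [LinearMap.ker_eq_bot']
    intro x hx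
    have h1 := congrArg Prod.fst hx
    have h2 := congrArg Prod.snd hx
    exact G.eq_zero_of_vertexSum_eq_zero hT (fun v => congrFun h1 v)
      fun e he => congrFun h2 ⟨e, he⟩
  obtain ⟨g, hg⟩ := f.exists_leftInverse_of_injective hf
  have : G.solution N T = fun y => g (fun v => (N v : ℝ), y) := by
    funext y
    have h := G.isSolution_solution hT hN y
    have h3 : f (G.solution N T y) = (fun v => (N v : ℝ), y) :=
      Prod.ext (funext h.1) (funext h.2)
    rw [← h3]
    exact (LinearMap.congr_fun hg _).symm
  rw [this]
  exact (LinearMap.continuous_of_finiteDimensional g).comp (by fun_prop)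

/-- The remaining lines connect all points, so there are at least `|V| - 1` of them; parallel lines
only help the inequality. -/
theorem card_le_cycleRank [DecidableEq E] {C : Finset E} (hC : ¬ G.IsCutset C) :
    C.card ≤ G.cycleRank := by
  rw [IsCutset, not_not] at hC
  have h1 := hC.card_vert_le_card_edgeSet_add_one
  have h2 : (G.graphOn {e | e ∉ C}).edgeSet ⊆
      ((Finset.univ \ C).image fun e => s(G.src e, G.tgt e) : Finset (Sym2 V)) := by
    intro p
    induction p with
    | _ a b =>
    intro h
    have h : (SimpleGraph.fromRel fun u v => ∃ e ∈ {e | e ∉ C}, G.src e = u ∧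
      G.tgt e = v).Adj a b := h
    rw [SimpleGraph.fromRel_adj] at h
    rw [Finset.mem_coe, Finset.mem_image]
    obtain ⟨-, ⟨e, he, rfl, rfl⟩ | ⟨e, he, rfl, rfl⟩⟩ := h
    · exact ⟨e, by simpa using he, rfl⟩
    · exact ⟨e, by simpa using he, Sym2.eq_swap⟩
  have h3 : Nat.card (G.graphOn {e | e ∉ C}).edgeSet ≤ (Finset.univ \ C).card := by
    refine (Nat.card_mono (Finset.finite_toSet _) h2).trans ?_
    rw [Nat.card_coe_set_eq, Set.ncard_coe_finset]
    exact Finset.card_image_le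
  rw [Finset.card_sdiff_of_subset (Finset.subset_univ C), Finset.card_univ] at h3
  have h4 := Finset.card_le_univ C
  rw [Nat.card_eq_fintype_card] at h1
  rw [cycleRank]
  omega

theorem exists_boundary_subset_of_isCutset {C : Finset E} [Nonempty V] (hC : G.IsCutset C) :
    ∃ A : Finset V, A.Nonempty ∧ A ≠ Finset.univ ∧ G.boundary A ⊆ C := by
  classical
  rw [IsCutset, SimpleGraph.connected_iff, not_and_or] at hC
  have hC := hC.resolve_right (not_not.2 inferInstance)
  simp only [SimpleGraph.Preconnected, not_forall] at hC
  obtain ⟨u, v, huv⟩ := hC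
  -- A connected component left after the removal of `C`.
  refine ⟨Finset.univ.filter fun w => (G.graphOn {e | e ∉ C}).Reachable u w, ⟨u, by simp⟩, ?_, ?_⟩
  · intro h
    have : v ∈ Finset.univ.filter fun w => (G.graphOn {e | e ∉ C}).Reachable u w := by
      rw [h]; exact Finset.mem_univ v
    exact huv (by simpa using this)
  · intro e he
    by_contra heC
    rw [mem_boundary] at he
    simp only [Finset.mem_filter, Finset.mem_univ, true_and] at he
    apply he
    by_cases hst : G.src e = G.tgt e
    · rw [hst]
    have hadj : (G.graphOn {e | e ∉ C}).Adj (G.src e) (G.tgt e) := by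
      change (SimpleGraph.fromRel _).Adj _ _
      rw [SimpleGraph.fromRel_adj]
      exact ⟨hst, Or.inl ⟨e, heC, rfl, rfl⟩⟩
    exact ⟨fun h => h.trans hadj.reachable, fun h => h.trans hadj.symm.reachable⟩

end LinearAlgebra

end OrientedMultigraph

/-! ### Riemann sums over the whole space. -/

section RiemannSums

variable {ι : Type*}

/-- The nearest point below `y` in the lattice of spacing `1 / m`. -/
def latticeFloor (m : ℕ) (y : ι → ℝ) : ι → ℤ := fun i => ⌊(m : ℝ) * y i⌋

theorem measurable_latticeFloor (m : ℕ) : Measurable (latticeFloor m : (ι → ℝ) → ι → ℤ) :=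
  measurable_pi_lambda _ fun i =>
    Int.measurable_floor.comp (by fun_prop : Measurable fun y : ι → ℝ => (m : ℝ) * y i)

variable [Fintype ι]

theorem map_latticeFloor_singleton {m : ℕ} (hm : 0 < m) (k : ι → ℤ) :
    ((volume : Measure (ι → ℝ)).map (latticeFloor m)).real {k} = ((m : ℝ)⁻¹) ^ Fintype.card ι := by
  have hm' : (0 : ℝ) < m := by exact_mod_cast hm
  have : latticeFloor m ⁻¹' {k} =
      Set.univ.pi fun i => Set.Ico ((k i : ℝ) / m) (((k i : ℝ) + 1) / m) := by
    ext y
    simp only [Set.mem_preimage, Set.mem_singleton_iff, Set.mem_pi, Set.mem_univ, true_imp_iff,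
      funext_iff, latticeFloor, Set.mem_Ico, Int.floor_eq_iff]
    refine forall_congr' fun i => ?_
    rw [div_le_iff₀' hm', lt_div_iff₀' hm']
  rw [measureReal_def, Measure.map_apply (measurable_latticeFloor m) (measurableSet_singleton k),
    this, Real.volume_pi_Ico, ENNReal.toReal_prod]
  have h : ∀ i, ((k i : ℝ) + 1) / m - (k i : ℝ) / m = (m : ℝ)⁻¹ := fun i => by field_simp; ring
  simp only [h]
  rw [Finset.prod_const, ENNReal.toReal_ofReal (by positivity), Finset.card_univ]

/-- A bound in terms of `y` alone, uniform over the lattice points `z` within distance 1: it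
dominates all Riemann sums at once. The constant comes from `1 + y² ≤ 3 + 2 z²`. -/
theorem one_div_sq_add_sq_le {q z y : ℝ} (hq : 0 < q) (h : |z - y| ≤ 1) :
    1 / (z ^ 2 + q ^ 2) ≤ (2 + 3 / q ^ 2) * (1 + y ^ 2)⁻¹ := by
  have h1 : y ^ 2 ≤ 2 * z ^ 2 + 2 := by
    have := abs_le.1 h
    nlinarith [sq_nonneg (z + (z - y)), sq_nonneg (2 * z - y)]
  have h2 : 0 < z ^ 2 + q ^ 2 := by positivity
  have h3 : (3 / q ^ 2) * q ^ 2 = 3 := by field_simp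
  rw [← div_eq_mul_inv, div_le_div_iff₀ h2 (by positivity)]
  have h4 : 0 ≤ 3 / q ^ 2 := by positivity
  nlinarith [mul_nonneg h4 (sq_nonneg z), sq_nonneg q]

theorem integrable_prod_inv_one_add_sq (K : ι → ℝ) :
    Integrable fun y : ι → ℝ => ∏ i, (K i * (1 + y i ^ 2)⁻¹) :=
  Integrable.fintype_prod (f := fun i (x : ℝ) => K i * (1 + x ^ 2)⁻¹) fun _ =>
    integrable_inv_one_add_sq.const_mul _

theorem prod_propagator_le {q : ι → ℝ} (hq : ∀ i, 0 < q i) {z y : ι → ℝ}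
    (h : ∀ i, |z i - y i| ≤ 1) :
    ∏ i, 1 / (z i ^ 2 + q i ^ 2) ≤ ∏ i, ((2 + 3 / q i ^ 2) * (1 + y i ^ 2)⁻¹) :=
  Finset.prod_le_prod (fun i _ => by positivity) fun i _ => one_div_sq_add_sq_le (hq i) (h i)

theorem integrable_of_le_prod_propagator {F : (ι → ℝ) → ℝ} (hF : Continuous F) {c : ℝ}
    {q : ι → ℝ} (hq : ∀ i, 0 < q i) (hc : 0 ≤ c)
    (hle : ∀ y, |F y| ≤ c * ∏ i, 1 / (y i ^ 2 + q i ^ 2)) : Integrable F := by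
  refine ((integrable_prod_inv_one_add_sq fun i => 2 + 3 / q i ^ 2).const_mul c).mono'
    hF.aestronglyMeasurable (Eventually.of_forall fun y => ?_)
  exact (hle y).trans (mul_le_mul_of_nonneg_left (prod_propagator_le hq fun i => by simp) hc)

/-- Riemann sums over all of space converge to the integral. -/
theorem tendsto_riemannSum {F : (ι → ℝ) → ℝ} (hF : Continuous F) {c : ℝ}
    {q : ι → ℝ} (hq : ∀ i, 0 < q i) (hc : 0 ≤ c)
    (hle : ∀ y, |F y| ≤ c * ∏ i, 1 / (y i ^ 2 + q i ^ 2)) :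
    Tendsto (fun m : ℕ => ((m : ℝ)⁻¹) ^ Fintype.card ι *
      ∑' k : ι → ℤ, F ((m : ℝ)⁻¹ • fun i => (k i : ℝ))) atTop (𝓝 (∫ y, F y)) := by
  set P : ℕ → (ι → ℝ) → ι → ℝ := fun m y => (m : ℝ)⁻¹ • fun i => (latticeFloor m y i : ℝ) with hP
  have hPm : ∀ m, Measurable (P m) := by
    intro m
    refine measurable_pi_lambda _ fun i => ?_
    have := (measurable_pi_apply i).comp (measurable_latticeFloor (ι := ι) m)
    exact ((measurable_of_countable (fun k : ℤ => (k : ℝ))).comp this).const_mul _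
  have hclose : ∀ m : ℕ, 0 < m → ∀ y i, |P m y i - y i| ≤ (m : ℝ)⁻¹ := by
    intro m hm y i
    have hm' : (0 : ℝ) < m := by exact_mod_cast hm
    have h1 := Int.floor_le ((m : ℝ) * y i)
    have h2 := Int.lt_floor_add_one ((m : ℝ) * y i)
    have h3 : P m y i - y i = (m : ℝ)⁻¹ * ((⌊(m : ℝ) * y i⌋ : ℝ) - m * y i) := by
      simp only [hP, latticeFloor, Pi.smul_apply, smul_eq_mul]
      field_simp
    rw [h3, abs_mul, abs_of_pos (inv_pos.2 hm')]
    refine mul_le_of_le_one_right (inv_pos.2 hm').le (abs_le.2 ⟨by linarith, by linarith⟩)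
  have hclose1 : ∀ m : ℕ, 0 < m → ∀ y i, |P m y i - y i| ≤ 1 := by
    intro m hm y i
    refine (hclose m hm y i).trans (inv_le_one_of_one_le₀ ?_)
    exact_mod_cast hm
  have hbound : ∀ m : ℕ, 0 < m → ∀ y, ‖F (P m y)‖ ≤
      c * ∏ i, ((2 + 3 / q i ^ 2) * (1 + y i ^ 2)⁻¹) := fun m hm y =>
    (hle _).trans (mul_le_mul_of_nonneg_left (prod_propagator_le hq (hclose1 m hm y)) hc)
  have hb := (integrable_prod_inv_one_add_sq fun i => 2 + 3 / q i ^ 2).const_mul c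
  have hlim : Tendsto (fun m : ℕ => ∫ y, F (P m y)) atTop (𝓝 (∫ y, F y)) := by
    refine tendsto_integral_filter_of_dominated_convergence _
      (Eventually.of_forall fun m => (hF.measurable.comp (hPm m)).aestronglyMeasurable)
      ?_ hb (Eventually.of_forall fun y => ?_)
    · filter_upwards [eventually_gt_atTop 0] with m hm
      exact Eventually.of_forall (hbound m hm)
    · refine (hF.tendsto y).comp (tendsto_pi_nhds.2 fun i => ?_)
      rw [tendsto_iff_dist_tendsto_zero]
      refine squeeze_zero' (Eventually.of_forall fun m => dist_nonneg) ?_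
        (tendsto_inv_atTop_nhds_zero_nat (𝕜 := ℝ))
      filter_upwards [eventually_gt_atTop 0] with m hm
      exact hclose m hm y i
  refine hlim.congr' ?_
  filter_upwards [eventually_gt_atTop 0] with m hm
  have hmeas : AEStronglyMeasurable (fun k : ι → ℤ => F ((m : ℝ)⁻¹ • fun i => (k i : ℝ)))
      ((volume : Measure (ι → ℝ)).map (latticeFloor m)) :=
    (measurable_of_countable _).aestronglyMeasurable
  have hint : Integrable (fun y => F (P m y)) := hb.mono'
    (hF.measurable.comp (hPm m)).aestronglyMeasurable (Eventually.of_forall (hbound m hm))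
  -- The Riemann sum is the integral of a step function, pushed forward to the lattice, where each
  -- point has mass `m⁻¹` to the power of the dimension.
  change ∫ y, (fun k : ι → ℤ => F ((m : ℝ)⁻¹ • fun i => (k i : ℝ))) (latticeFloor m y) = _
  rw [← integral_map (measurable_latticeFloor m).aemeasurable hmeas, integral_countable
    ((integrable_map_measure hmeas (measurable_latticeFloor m).aemeasurable).2 hint)]
  simp only [map_latticeFloor_singleton hm, smul_eq_mul]
  rw [tsum_mul_left]

end RiemannSums

/-! ### Convergence and continuity of sum and integral; the scaling limit. -/

namespace OrientedMultigraph

variable {V E : Type*} [DecidableEq V] [Fintype E]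
variable (G : OrientedMultigraph V E) {N : V → ℤ} {T : Finset E}

theorem integrand_nonneg (q : E → ℝ) (y : {l // l ∉ T} → ℝ) : 0 ≤ G.integrand N T q y := by
  unfold integrand
  exact div_nonneg zero_le_one (Finset.prod_nonneg fun e _ => by positivity)

theorem integrand_anti {q q' : E → ℝ} (hq : ∀ e, 0 < q e) (h : ∀ e, q e ≤ q' e)
    (y : {l // l ∉ T} → ℝ) : G.integrand N T q' y ≤ G.integrand N T q y := by
  unfold integrand
  refine one_div_le_one_div_of_le (Finset.prod_pos fun e _ => by have := hq e; positivity)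
    (Finset.prod_le_prod (fun e _ => by positivity) fun e _ => ?_)
  have := hq e
  have := h e
  gcongr

theorem eventually_half_le {q : E → ℝ} (hq : ∀ e, 0 < q e) :
    ∀ᶠ q' in 𝓝 q, ∀ e, q e / 2 ≤ q' e := by
  refine eventually_all.2 fun e => ?_
  have := (continuous_apply e).tendsto q
  exact this.eventually (eventually_ge_nhds (by linarith [hq e]))

variable [Fintype V]

theorem continuous_integrand (hT : G.IsSpanningTree T) (hN : ∑ v, N v = 0) {q : E → ℝ}
    (hq : ∀ e, 0 < q e) : Continuous (G.integrand N T q) := by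
  have h := G.continuous_solution hT hN
  unfold integrand
  refine Continuous.div continuous_const (continuous_finsetProd _ fun e _ => ?_) fun y => ?_
  · exact (((continuous_apply e).comp h).pow 2).add continuous_const
  · exact (Finset.prod_pos fun e _ => by have := hq e; positivity).ne'

/-- The Matsubara sum as a sum over the independent variables. -/
theorem matsubaraSum_eq_tsum_integrand (hT : G.IsSpanningTree T) (hN : ∑ v, N v = 0)
    (q : E → ℝ) :
    G.matsubaraSum N q = ∑' k : {l // l ∉ T} → ℤ, G.integrand N T q fun l => (k l : ℝ) := by
  -- Integer values off the tree extend to integer solutions, which parametrizes the support of the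
  -- summand by the free lattice variables.
  choose n hn1 hn2 using fun k : {l // l ∉ T} → ℤ =>
    G.exists_solution (R := ℤ) hT.1 (w := N) hN k
  have hinj : Function.Injective n := by
    intro k k' h
    funext l
    rw [← hn2 k l, ← hn2 k' l, h]
  have hsol : ∀ n' : E → ℤ, (∀ v, G.vertexSum n' v = N v) → (fun e => (n' e : ℝ)) =
      G.solution N T fun l => (n' l.1 : ℝ) := by
    intro n' hn'
    refine G.eq_solution hT hN ⟨fun v => ?_, fun l => rfl⟩
    rw [← hn' v]
    simp [vertexSum]
  have hsupp : Function.support (G.summand N q) ⊆ Set.range n := by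
    intro n' hn'
    have h1 : ∀ v, G.vertexSum n' v = N v := by
      by_contra! h
      obtain ⟨v, hv⟩ := h
      apply hn'
      rw [summand, Finset.prod_eq_zero (Finset.mem_univ v) (if_neg hv), zero_div]
    refine ⟨fun l => n' l.1, ?_⟩
    have h2 := hsol n' h1
    have h3 := hsol _ (hn1 fun l => n' l.1)
    simp only [hn2] at h3
    funext e
    have := congrFun (h3.trans h2.symm) e
    exact_mod_cast this
  rw [matsubaraSum, ← hinj.tsum_eq hsupp]
  refine tsum_congr fun k => ?_
  have h3 := hsol _ (hn1 k)
  simp only [hn2] at h3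
  rw [summand, integrand, ← h3]
  simp [hn1]

theorem integrand_natCast_smul (hT : G.IsSpanningTree T) (hN : ∑ v, N v = 0) (q : E → ℝ)
    (y : {l // l ∉ T} → ℝ) (m : ℕ) :
    G.integrand (fun v => m * N v) T ((m : ℝ) • q) ((m : ℝ) • y) =
      ((m : ℝ)⁻¹) ^ (2 * Fintype.card E) * G.integrand N T q y := by
  rw [integrand, G.solution_natCast_smul hT hN, integrand]
  have : ∀ e, ((m : ℝ) • G.solution N T y) e ^ 2 + ((m : ℝ) • q) e ^ 2 =
      (m : ℝ) ^ 2 * (G.solution N T y e ^ 2 + q e ^ 2) := by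
    intro e; simp only [Pi.smul_apply, smul_eq_mul]; ring
  simp only [this]
  rw [Finset.prod_mul_distrib, Finset.prod_const, Finset.card_univ, ← pow_mul, inv_pow, one_div,
    mul_inv, one_div]

theorem continuousAt_matsubaraSum {q : E → ℝ} (hq : ∀ e, 0 < q e) :
    ContinuousAt (G.matsubaraSum N) q := by
  have hq2 : ∀ e, 0 < q e / 2 := fun e => by linarith [hq e]
  refine tendsto_tsum_of_dominated_convergence (G.summable_summand N hq2) (fun n => ?_) ?_
  · have : (∏ e, ((n e : ℝ) ^ 2 + q e ^ 2)) ≠ 0 :=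
      (Finset.prod_pos fun e _ => by have := hq e; positivity).ne'
    unfold summand
    refine ContinuousAt.div continuousAt_const (Continuous.continuousAt ?_) this
    fun_prop
  · filter_upwards [eventually_half_le hq] with q' hq' n
    rw [Real.norm_of_nonneg (G.summand_nonneg N q' n), summand, summand]
    refine div_le_div_of_nonneg_left (Finset.prod_nonneg fun v _ => by split_ifs <;> norm_num)
      (Finset.prod_pos fun e _ => by have := hq2 e; positivity)
      (Finset.prod_le_prod (fun e _ => by positivity) fun e _ => ?_)
    have := hq2 e
    have := hq' e
    gcongr

variable [DecidableEq E]

/-- The tree factors are bounded by `1 / q²`; the others, in the independent variables, already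
ensure integrability. -/
theorem integrand_le (hT : G.IsSpanningTree T) (hN : ∑ v, N v = 0) {q : E → ℝ}
    (hq : ∀ e, 0 < q e) (y : {l // l ∉ T} → ℝ) :
    |G.integrand N T q y| ≤ (∏ e ∈ T, 1 / q e ^ 2) * ∏ l : {l // l ∉ T},
      1 / (y l ^ 2 + q l.1 ^ 2) := by
  have hx := (G.isSolution_solution hT hN y).2
  have h1 : G.integrand N T q y = ∏ e, 1 / (G.solution N T y e ^ 2 + q e ^ 2) := by
    rw [integrand, Finset.prod_div_distrib, Finset.prod_const_one]
  rw [abs_of_nonneg (G.integrand_nonneg q y), h1, ← Finset.prod_mul_prod_compl T,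
    Finset.prod_subtype Tᶜ (p := fun l => l ∉ T) (fun e => by simp)]
  refine mul_le_mul ?_ (le_of_eq ?_) (Finset.prod_nonneg fun e _ => by positivity)
    (Finset.prod_nonneg fun e _ => by positivity)
  · refine Finset.prod_le_prod (fun e _ => by positivity) fun e _ => ?_
    have := hq e
    exact one_div_le_one_div_of_le (by positivity) (by nlinarith [sq_nonneg (G.solution N T y e)])
  · exact Finset.prod_congr rfl fun l _ => by rw [hx l]

theorem integrable_integrand (hT : G.IsSpanningTree T) (hN : ∑ v, N v = 0) {q : E → ℝ}
    (hq : ∀ e, 0 < q e) : Integrable (G.integrand N T q) :=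
  integrable_of_le_prod_propagator (G.continuous_integrand hT hN hq) (q := fun l => q l.1)
    (fun l => hq l.1) (Finset.prod_nonneg fun e _ => by positivity) (G.integrand_le hT hN hq)

theorem continuousAt_integralValue (hT : G.IsSpanningTree T) (hN : ∑ v, N v = 0) {q : E → ℝ}
    (hq : ∀ e, 0 < q e) : ContinuousAt (G.integralValue N T) q := by
  have hq2 : ∀ e, 0 < q e / 2 := fun e => by linarith [hq e]
  refine tendsto_integral_filter_of_dominated_convergence (G.integrand N T fun e => q e / 2) ?_ ?_
    (G.integrable_integrand hT hN hq2) (Eventually.of_forall fun y => ?_)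
  · filter_upwards [eventually_half_le hq] with q' hq'
    exact (G.continuous_integrand hT hN fun e => (hq2 e).trans_le (hq' e)).aestronglyMeasurable
  · filter_upwards [eventually_half_le hq] with q' hq'
    refine Eventually.of_forall fun y => ?_
    rw [Real.norm_of_nonneg (G.integrand_nonneg q' y)]
    exact G.integrand_anti hq2 hq' y
  · have : (∏ e, (G.solution N T y e ^ 2 + q e ^ 2)) ≠ 0 :=
      (Finset.prod_pos fun e _ => by have := hq e; positivity).ne'
    unfold integrand
    refine ContinuousAt.div continuousAt_const (Continuous.continuousAt ?_) this
    fun_prop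

/-- The integral as a limit of rescaled sums. -/
theorem tendsto_matsubaraSum (hT : G.IsSpanningTree T) (hN : ∑ v, N v = 0) {q : E → ℝ}
    (hq : ∀ e, 0 < q e) :
    Tendsto (fun m : ℕ => ((m : ℝ)⁻¹) ^ Fintype.card {l // l ∉ T} *
      ((m : ℝ) ^ (2 * Fintype.card E) *
      G.matsubaraSum (fun v => m * N v) ((m : ℝ) • q))) atTop (𝓝 (G.integralValue N T q)) := by
  refine (tendsto_riemannSum (G.continuous_integrand hT hN hq) (q := fun l => q l.1)
    (fun l => hq l.1) (Finset.prod_nonneg fun e _ => by positivity)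
    (G.integrand_le hT hN hq)).congr' ?_
  filter_upwards [eventually_gt_atTop 0] with m hm
  have hm' : (m : ℝ) ≠ 0 := by exact_mod_cast hm.ne'
  congr 1
  rw [G.matsubaraSum_eq_tsum_integrand hT (by rw [← Finset.mul_sum, hN, mul_zero]), ← tsum_mul_left]
  refine tsum_congr fun k => ?_
  have h := G.integrand_natCast_smul hT hN q ((m : ℝ)⁻¹ • fun l => (k l : ℝ)) m
  rw [smul_inv_smul₀ hm'] at h
  rw [h, ← mul_assoc, inv_pow, mul_inv_cancel₀ (pow_ne_zero _ hm'), one_mul]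

end OrientedMultigraph

/-! ### Expansion of the operators. -/

section OperatorExpansion

variable {E : Type*} [DecidableEq E]

theorem flipSigns_singleton (i : E) (q : E → ℝ) :
    flipSigns {i} q = Function.update q i (-q i) := by
  funext e
  by_cases h : e = i
  · subst h; simp [flipSigns]
  · simp [flipSigns, h]

theorem termOp_empty : termOp (∅ : Finset E) = 1 := Finset.noncommProd_empty _ _

theorem termOp_singleton (i : E) : termOp {i} = lineOp i := Finset.noncommProd_singleton _ _

theorem termOp_apply (C : Finset E) (f : (E → ℝ) → ℝ) (q : E → ℝ) :
    termOp C f q = (∏ i ∈ C, nbe (q i)) *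
      ∑ D ∈ C.powerset, (-1) ^ D.card * f (flipSigns D q) := by
  induction C using Finset.induction_on generalizing q with
  | empty => simp [termOp_empty]
  | insert i C hi ih =>
    have h1 : termOp (insert i C) = lineOp i * termOp C :=
      Finset.noncommProd_insert_of_notMem _ _ _ _ hi
    have h2 : ∏ j ∈ C, nbe (flipSigns {i} q j) = ∏ j ∈ C, nbe (q j) :=
      Finset.prod_congr rfl fun j hj => by
        have : j ≠ i := fun h => hi (h ▸ hj)
        simp [flipSigns, this]
    have h3 : ∀ D ∈ C.powerset, (-1 : ℝ) ^ D.card * f (flipSigns D (flipSigns {i} q)) =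
        -((-1) ^ (insert i D).card * f (flipSigns (insert i D) q)) := by
      intro D hD
      have hiD : i ∉ D := fun h => hi (Finset.mem_powerset.1 hD h)
      have h4 : symmDiff {i} D = insert i D := by
        ext e
        simp only [Finset.mem_symmDiff, Finset.mem_singleton, Finset.mem_insert]
        by_cases h : e = i
        · subst h; simp [hiD]
        · simp [h]
      rw [← flipSigns_symmDiff, h4, Finset.card_insert_of_notMem hiD, pow_succ]
      ring
    rw [h1, Module.End.mul_apply, lineOp_apply, ← flipSigns_singleton, ih, ih, h2,
      Finset.prod_insert hi, Finset.sum_powerset_insert hi, Finset.sum_congr rfl h3,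
      Finset.sum_neg_distrib]
    ring

/-- The weight `1 / (1 - exp (-2 π r))`. -/
def boseWeight (r : ℝ) : ℝ := 1 / (1 - Real.exp (-(2 * Real.pi * r)))

theorem boseWeight_neg (q : ℝ) : boseWeight (-q) = -nbe q := by
  rw [boseWeight, nbe, ← neg_sub, one_div, inv_neg, one_div]
  simp

theorem boseWeight_eq {q : ℝ} (hq : 0 < q) : boseWeight q = 1 + nbe q := by
  have h1 : 1 < Real.exp (2 * Real.pi * q) := Real.one_lt_exp_iff.2 (by positivity)
  rw [boseWeight, nbe, Real.exp_neg]
  set x := Real.exp (2 * Real.pi * q)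
  have h2 : x - 1 ≠ 0 := by linarith
  have h3 : x ≠ 0 := by linarith
  have h4 : 1 - x⁻¹ = (x - 1) / x := by field_simp
  rw [h4]
  field_simp
  ring

/-- Each factor `1 + n (1 - R)` equals `(1 + n) - n R`, and these two coefficients are `boseWeight
q` and `boseWeight (-q)`. The proof collects, for each reflection set `D`, all `C ⊇ D`. -/
theorem sum_termOp_apply [Fintype E] (f : (E → ℝ) → ℝ) {q : E → ℝ} (hq : ∀ e, 0 < q e) :
    ∑ C : Finset E, termOp C f q =
      ∑ D : Finset E, (∏ e, boseWeight (flipSigns D q e)) * f (flipSigns D q) := by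
  have h1 : ∀ D : Finset E, ∏ e, boseWeight (flipSigns D q e) =
      (-1) ^ D.card * ∑ C ∈ Finset.Icc D Finset.univ, ∏ i ∈ C, nbe (q i) := by
    intro D
    have h2 : ∏ i ∈ Dᶜ, (1 + nbe (q i)) = ∑ C ∈ Dᶜ.powerset, ∏ i ∈ C, nbe (q i) :=
      Finset.prod_one_add _
    have h3 : ∑ C ∈ Finset.Icc D Finset.univ, ∏ i ∈ C, nbe (q i) =
        (∏ i ∈ D, nbe (q i)) * ∑ C ∈ Dᶜ.powerset, ∏ i ∈ C, nbe (q i) := by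
      rw [Finset.mul_sum]
      refine Finset.sum_bij' (fun C _ => C \ D) (fun C _ => D ∪ C) ?_ ?_ ?_ ?_ ?_
      · intro C _
        rw [Finset.mem_powerset]
        intro e he
        simpa using (Finset.mem_sdiff.1 he).2
      · intro C _
        exact Finset.mem_Icc.2 ⟨Finset.subset_union_left, Finset.subset_univ _⟩
      · intro C hC
        exact Finset.union_sdiff_of_subset (Finset.mem_Icc.1 hC).1
      · intro C hC
        rw [Finset.mem_powerset] at hC
        ext e
        have := @hC e
        simp only [Finset.mem_compl, Finset.mem_sdiff, Finset.mem_union] at this ⊢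
        tauto
      · intro C hC
        rw [mul_comm, Finset.prod_sdiff (Finset.mem_Icc.1 hC).1]
    rw [h3, ← h2, ← mul_assoc, ← Finset.prod_const, ← Finset.prod_mul_distrib,
      ← Finset.prod_mul_prod_compl D]
    congr 1
    · exact Finset.prod_congr rfl fun e he => by simp [flipSigns, he, boseWeight_neg]
    · exact Finset.prod_congr rfl fun e he => by
        rw [Finset.mem_compl] at he
        simp [flipSigns, he, boseWeight_eq (hq e)]
  simp only [termOp_apply, h1, Finset.mul_sum, Finset.sum_mul]
  rw [Finset.sum_comm' (t' := Finset.univ) (s' := fun D => Finset.Icc D Finset.univ)]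
  · exact Finset.sum_congr rfl fun D _ => Finset.sum_congr rfl fun C _ => by ring
  · intro C D
    simp

end OperatorExpansion

/-! ### Rational continuation and rational complex functions. -/

section RationalContinuation

variable {E : Type*} {f : (E → ℝ) → ℝ}

theorem rationalContinuation_eq {q : E → ℝ} {v : ℝ} (h : IsRationalValue f q v) :
    rationalContinuation f q = v := by
  have hex : ∃ v, IsRationalValue f q v := ⟨v, h⟩
  rw [rationalContinuation, dif_pos hex]
  exact hex.choose_spec.unique h

theorem continuousAt_rationalContinuation [Finite E] {q : E → ℝ} (h : q ∈ rationalDomain f) :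
    ContinuousAt (rationalContinuation f) q := by
  obtain ⟨v, P, D, hPD, hD, rfl⟩ := h
  have hev : ∀ᶠ x in 𝓝 q, MvPolynomial.eval x D ≠ 0 :=
    (MvPolynomial.continuous_eval D).continuousAt.eventually_ne hD
  have hc : ContinuousAt (fun x => MvPolynomial.eval x P / MvPolynomial.eval x D) q :=
    (MvPolynomial.continuous_eval P).continuousAt.div
      (MvPolynomial.continuous_eval D).continuousAt hD
  refine hc.congr ?_
  filter_upwards [hev] with x hx
  exact (rationalContinuation_eq ⟨P, D, hPD, hx, rfl⟩).symm

end RationalContinuation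

section ComplexRational

variable {E : Type*}

/-- `g` is on `S` a quotient of polynomials whose denominator is real and has no zeros in `S`. -/
def IsRationalOn (S : Set (E → ℝ)) (g : (E → ℝ) → ℂ) : Prop :=
  ∃ a b d : MvPolynomial E ℝ, ∀ x ∈ S, MvPolynomial.eval x d ≠ 0 ∧
    g x * (MvPolynomial.eval x d : ℂ) =
      (MvPolynomial.eval x a : ℂ) + (MvPolynomial.eval x b : ℂ) * Complex.I

variable {S : Set (E → ℝ)} {g h : (E → ℝ) → ℂ}

theorem isRationalOn_one : IsRationalOn S fun _ => 1 := ⟨1, 0, 1, fun x _ => by simp⟩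

theorem isRationalOn_zero : IsRationalOn S fun _ => 0 := ⟨0, 0, 1, fun x _ => by simp⟩

theorem IsRationalOn.add (hg : IsRationalOn S g) (hh : IsRationalOn S h) :
    IsRationalOn S fun x => g x + h x := by
  obtain ⟨a, b, d, H⟩ := hg
  obtain ⟨a', b', d', H'⟩ := hh
  refine ⟨a * d' + a' * d, b * d' + b' * d, d * d', fun x hx => ⟨?_, ?_⟩⟩
  · rw [map_mul]; exact mul_ne_zero (H x hx).1 (H' x hx).1
  · simp only [map_mul, map_add]
    push_cast
    linear_combination (MvPolynomial.eval x d' : ℂ) * (H x hx).2 +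
      (MvPolynomial.eval x d : ℂ) * (H' x hx).2

theorem IsRationalOn.mul (hg : IsRationalOn S g) (hh : IsRationalOn S h) :
    IsRationalOn S fun x => g x * h x := by
  obtain ⟨a, b, d, H⟩ := hg
  obtain ⟨a', b', d', H'⟩ := hh
  refine ⟨a * a' - b * b', a * b' + b * a', d * d', fun x hx => ⟨?_, ?_⟩⟩
  · rw [map_mul]; exact mul_ne_zero (H x hx).1 (H' x hx).1
  · simp only [map_mul, map_add, map_sub]
    push_cast
    have h1 : g x * h x * ((MvPolynomial.eval x d : ℂ) * (MvPolynomial.eval x d' : ℂ)) =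
        (g x * (MvPolynomial.eval x d : ℂ)) * (h x * (MvPolynomial.eval x d' : ℂ)) := by ring
    rw [h1, (H x hx).2, (H' x hx).2]
    linear_combination (MvPolynomial.eval x b : ℂ) * (MvPolynomial.eval x b' : ℂ) * Complex.I_sq

theorem IsRationalOn.sum {ι : Type*} (s : Finset ι) {g : ι → (E → ℝ) → ℂ}
    (hg : ∀ i ∈ s, IsRationalOn S (g i)) : IsRationalOn S fun x => ∑ i ∈ s, g i x := by
  classical
  induction s using Finset.induction_on with
  | empty => simpa using isRationalOn_zero
  | insert i s hi ih =>
    simp only [Finset.sum_insert hi]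
    exact (hg i (Finset.mem_insert_self i s)).add
      (ih fun j hj => hg j (Finset.mem_insert_of_mem hj))

end ComplexRational

/-! ### Density of the generic points. -/

section Density

variable {E : Type*} [Fintype E]

theorem dense_eval_ne_zero {p : MvPolynomial E ℝ} (hp : p ≠ 0) :
    Dense {q : E → ℝ | MvPolynomial.eval q p ≠ 0} := by
  rw [Metric.dense_iff]
  intro q δ hδ
  by_contra h
  apply hp
  refine MvPolynomial.funext_set (fun e => Metric.ball (q e) δ) (fun e => ?_) fun x hx => ?_
  · rw [Real.ball_eq_Ioo]
    exact Set.Ioo_infinite (by linarith)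
  · rw [map_zero]
    by_contra hne
    refine h ⟨x, ?_, hne⟩
    rw [ball_pi _ hδ]
    exact hx

/-- Finitely many nonzero linear forms are excluded; their product is one nonzero polynomial. -/
theorem dense_isGeneric : Dense {q : E → ℝ | IsGeneric q} := by
  classical
  set p : MvPolynomial E ℝ := ∏ ε ∈ (Finset.univ : Finset (E → SignType)).erase 0,
    ∑ e, MvPolynomial.C ((ε e : ℤ) : ℝ) * MvPolynomial.X e with hp
  have hne : p ≠ 0 := by
    rw [hp, Finset.prod_ne_zero_iff]
    intro ε hε h
    apply Finset.ne_of_mem_erase hε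
    funext e
    have h1 := congrArg (MvPolynomial.eval (Pi.single e 1)) h
    simp only [map_sum, map_mul, MvPolynomial.eval_C, MvPolynomial.eval_X, map_zero] at h1
    rw [Finset.sum_eq_single e (fun e' _ he' => by simp [he']) (by simp)] at h1
    have h2 : ∀ s : SignType, (s : ℤ) = 0 → s = 0 := by decide
    simp only [Pi.single_eq_same, mul_one] at h1
    exact h2 _ (by exact_mod_cast h1)
  refine (dense_eval_ne_zero hne).mono fun q hq => ?_
  intro ε hε
  rw [Set.mem_ofPred_eq, hp, map_prod, Finset.prod_ne_zero_iff] at hq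
  have := hq ε (Finset.mem_erase.2 ⟨hε, Finset.mem_univ ε⟩)
  simpa using this

theorem isOpen_setOf_pos : IsOpen {q : E → ℝ | ∀ e, 0 < q e} := by
  rw [Set.ofPred_forall]
  exact isOpen_iInter_of_finite fun e => isOpen_lt continuous_const (continuous_apply e)

theorem mem_closure_generic {q : E → ℝ} (hq : ∀ e, 0 < q e) :
    q ∈ closure ({q : E → ℝ | ∀ e, 0 < q e} ∩ {q : E → ℝ | IsGeneric q}) :=
  dense_isGeneric.open_subset_closure_inter isOpen_setOf_pos hq

/-- Functions that agree at generic positive points agree where they are continuous. -/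
theorem eq_of_eq_generic {f g : (E → ℝ) → ℝ} {q : E → ℝ} (hq : ∀ e, 0 < q e)
    (hf : ContinuousAt f q) (hg : ContinuousAt g q)
    (h : ∀ x : E → ℝ, (∀ e, 0 < x e) → IsGeneric x → f x = g x) : f q = g q := by
  have hne : (𝓝[{q : E → ℝ | ∀ e, 0 < q e} ∩ {q : E → ℝ | IsGeneric q}] q).NeBot :=
    mem_closure_iff_nhdsWithin_neBot.1 (mem_closure_generic hq)
  have hf' := hf.tendsto.mono_left (nhdsWithin_le_nhds
    (s := {q : E → ℝ | ∀ e, 0 < q e} ∩ {q : E → ℝ | IsGeneric q}))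
  refine tendsto_nhds_unique hf' ((hg.tendsto.mono_left nhdsWithin_le_nhds).congr' ?_)
  filter_upwards [self_mem_nhdsWithin] with x hx
  exact (h x hx.1 hx.2).symm

end Density

/-! ### The integral as a rational function. -/

namespace OrientedMultigraph

variable {V E : Type*} [Fintype V] [Fintype E] [DecidableEq V]
variable (G : OrientedMultigraph V E) (N : V → ℤ)

/-- The Matsubara integral as a sum over the chains of sets of points. -/
def chainIntegral (r : E → ℝ) : ℝ :=
  Real.pi ^ Fintype.card E / (2 * Real.pi) ^ (Fintype.card V - 1) * (∏ e, (r e)⁻¹) *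
    (fullChainSum (G.cutWeight N r)).re

/-- The points at which all denominators of the chain sums are nonzero. -/
def chainDomain : Set (E → ℝ) :=
  {r | (∀ e, r e ≠ 0) ∧
    ∀ X : Finset V, X.Nonempty → X ≠ Finset.univ → G.cutWeight N r X ≠ 0}

/-- Multiplication by the complex conjugate makes the denominator real; it is the squared modulus of
the weight and vanishes only with it. -/
theorem isRationalOn_inv_cutWeight {X : Finset V} (h1 : X.Nonempty) (h2 : X ≠ Finset.univ) :
    IsRationalOn (G.chainDomain N) fun r => (G.cutWeight N r X)⁻¹ := by
  refine ⟨∑ e ∈ G.boundary X, MvPolynomial.X e, MvPolynomial.C ((∑ v ∈ X, N v : ℤ) : ℝ),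
    (∑ e ∈ G.boundary X, MvPolynomial.X e) ^ 2 + MvPolynomial.C (((∑ v ∈ X, N v : ℤ) : ℝ) ^ 2),
    fun x hx => ?_⟩
  have hne := hx.2 X h1 h2
  simp only [cutWeight] at hne ⊢
  simp only [map_sum, map_add, map_pow, MvPolynomial.eval_X, MvPolynomial.eval_C]
  set a : ℝ := ∑ e ∈ G.boundary X, x e
  set b : ℤ := ∑ v ∈ X, N v
  have h3 : ((a ^ 2 + (b : ℝ) ^ 2 : ℝ) : ℂ) =
      ((a : ℂ) - (b : ℂ) * Complex.I) * (a + b * Complex.I) := by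
    push_cast
    linear_combination (b : ℂ) ^ 2 * Complex.I_sq
  constructor
  · intro h
    apply hne
    have h4 : a = 0 := by nlinarith [sq_nonneg a, sq_nonneg (b : ℝ)]
    have h5 : (b : ℝ) = 0 := by nlinarith [sq_nonneg a, sq_nonneg (b : ℝ)]
    have h6 : b = 0 := by exact_mod_cast h5
    rw [h4, h6]; simp
  · rw [h3, inv_mul_cancel_left₀ hne]
    simp

theorem isRationalOn_chainSum {X : Finset V} (hX : X ≠ Finset.univ) :
    IsRationalOn (G.chainDomain N) fun r => chainSum (G.cutWeight N r) X := by
  induction X using Finset.strongInduction with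
  | H X ih =>
    rcases X.eq_empty_or_nonempty with rfl | hne
    · simpa only [chainSum_empty] using isRationalOn_one
    · simp only [chainSum_of_nonempty _ hne, div_eq_mul_inv]
      refine (IsRationalOn.sum X fun v hv => ih _ (Finset.erase_ssubset hv) fun h => ?_).mul
        (G.isRationalOn_inv_cutWeight N hne hX)
      have : v ∈ X.erase v := by rw [h]; exact Finset.mem_univ v
      simp at this

theorem exists_chainIntegral_eq : ∃ P D : MvPolynomial E ℝ, ∀ x ∈ G.chainDomain N,
    MvPolynomial.eval x D ≠ 0 ∧
      MvPolynomial.eval x P = G.chainIntegral N x * MvPolynomial.eval x D := by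
  obtain ⟨a, b, d, H⟩ := IsRationalOn.sum (S := G.chainDomain N) Finset.univ
    (g := fun v r => chainSum (G.cutWeight N r) (Finset.univ.erase v)) fun v _ =>
      G.isRationalOn_chainSum N fun h => by
        have : v ∈ Finset.univ.erase v := by rw [h]; exact Finset.mem_univ v
        simp at this
  refine ⟨MvPolynomial.C (Real.pi ^ Fintype.card E / (2 * Real.pi) ^ (Fintype.card V - 1)) * a,
    d * ∏ e, MvPolynomial.X e, fun x hx => ?_⟩
  have h1 : (∏ e, x e) ≠ 0 := Finset.prod_ne_zero_iff.2 fun e _ => hx.1 e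
  obtain ⟨h2, h3⟩ := H x hx
  refine ⟨?_, ?_⟩
  · rw [map_mul, map_prod]
    simp only [MvPolynomial.eval_X]
    exact mul_ne_zero h2 h1
  · have h4 := congrArg Complex.re h3
    rw [Complex.re_mul_ofReal] at h4
    simp only [Complex.add_re, Complex.ofReal_re, Complex.re_ofReal_mul, Complex.I_re, mul_zero,
      add_zero] at h4
    rw [map_mul, map_mul, map_prod, MvPolynomial.eval_C, ← h4, chainIntegral, fullChainSum,
      Finset.prod_inv_distrib]
    simp only [MvPolynomial.eval_X]
    field_simp

theorem mem_chainDomain_of_pos (hG : (G.graphOn Set.univ).Connected) {q : E → ℝ}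
    (hq : ∀ e, 0 < q e) : q ∈ G.chainDomain N := by
  refine ⟨fun e => (hq e).ne', fun X h1 h2 h => ?_⟩
  have := congrArg Complex.re h
  rw [cutWeight_re] at this
  exact (Finset.sum_pos (fun e _ => hq e) (G.boundary_nonempty hG h1 h2)).ne' this

theorem mem_chainDomain_of_isGeneric (hG : (G.graphOn Set.univ).Connected) {q : E → ℝ}
    (hq : IsGeneric q) : q ∈ G.chainDomain N :=
  ⟨hq.ne_zero, fun _ h1 h2 => G.cutWeight_ne_zero N hG hq h1 h2⟩

theorem continuousAt_chainIntegral (hG : (G.graphOn Set.univ).Connected) {q : E → ℝ}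
    (hq : ∀ e, 0 < q e) : ContinuousAt (G.chainIntegral N) q := by
  obtain ⟨P, D, H⟩ := G.exists_chainIntegral_eq N
  have h := H q (G.mem_chainDomain_of_pos N hG hq)
  refine ((MvPolynomial.continuous_eval P).continuousAt.div
    (MvPolynomial.continuous_eval D).continuousAt h.1).congr ?_
  filter_upwards [isOpen_setOf_pos.mem_nhds hq] with x hx
  have h := H x (G.mem_chainDomain_of_pos N hG hx)
  rw [Pi.div_apply, h.2, mul_div_cancel_right₀ _ h.1]

/-- Homogeneity: one degree from each line and one from each of the `|V| - 1` denominators of a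
chain. -/
theorem chainIntegral_natCast_smul (r : E → ℝ) (m : ℕ) :
    G.chainIntegral (fun v => m * N v) ((m : ℝ) • r) =
      ((m : ℝ)⁻¹) ^ (Fintype.card E + (Fintype.card V - 1)) * G.chainIntegral N r := by
  have h1 : G.cutWeight (fun v => m * N v) ((m : ℝ) • r) =
      fun X => (m : ℂ) * G.cutWeight N r X := by
    funext X
    simp only [cutWeight, Pi.smul_apply, smul_eq_mul, ← Finset.mul_sum]
    push_cast
    ring
  have h2 : fullChainSum (fun X => (m : ℂ) * G.cutWeight N r X) =
      ((((m : ℝ)⁻¹) ^ (Fintype.card V - 1) : ℝ) : ℂ) * fullChainSum (G.cutWeight N r) := by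
    simp only [fullChainSum, chainSum_smul, Finset.mul_sum]
    refine Finset.sum_congr rfl fun v _ => ?_
    rw [Finset.card_erase_of_mem (Finset.mem_univ v), Finset.card_univ]
    push_cast
    rfl
  rw [chainIntegral, chainIntegral, h1, h2, Complex.re_ofReal_mul, pow_add]
  simp only [Pi.smul_apply, smul_eq_mul, mul_inv]
  rw [Finset.prod_mul_distrib, Finset.prod_const, Finset.card_univ]
  ring

variable [DecidableEq E]

theorem matsubaraSum_eq_sum_chainIntegral (hG : (G.graphOn Set.univ).Connected)
    (hN : ∑ v, N v = 0) {q : E → ℝ} (hq : ∀ e, 0 < q e) (hgen : IsGeneric q) :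
    G.matsubaraSum N q = ∑ D : Finset E,
      (∏ e, boseWeight (flipSigns D q e)) * G.chainIntegral N (flipSigns D q) := by
  have h := congrArg Complex.re (G.matsubaraSum_eq_sum_fullChainSum N hG hN hq hgen)
  have h1 : ((2 * Real.pi : ℂ) ^ (Fintype.card V - 1) * (G.matsubaraSum N q : ℂ)).re =
      (2 * Real.pi) ^ (Fintype.card V - 1) * G.matsubaraSum N q := by
    rw [← Complex.ofReal_re ((2 * Real.pi) ^ (Fintype.card V - 1) * G.matsubaraSum N q)]
    push_cast
    rfl
  rw [h1, ← Complex.ofReal_pow, Complex.re_ofReal_mul, Complex.re_sum] at h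
  simp only [Complex.re_ofReal_mul] at h
  have hpi : (2 * Real.pi) ^ (Fintype.card V - 1) ≠ 0 := pow_ne_zero _ Real.two_pi_pos.ne'
  rw [← mul_right_inj' hpi, h, Finset.mul_sum, Finset.mul_sum]
  refine Finset.sum_congr rfl fun D _ => ?_
  have h2 : ∏ e, thermalWeight (flipSigns D q e) =
      (∏ e, boseWeight (flipSigns D q e)) * ∏ e, (flipSigns D q e)⁻¹ := by
    rw [← Finset.prod_mul_distrib]
    refine Finset.prod_congr rfl fun e _ => ?_
    rw [thermalWeight, boseWeight, one_div, mul_inv, one_div, mul_comm]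
  rw [h2, chainIntegral]
  field_simp

theorem tendsto_boseWeight_pos {r : ℝ} (hr : 0 < r) :
    Tendsto (fun m : ℕ => boseWeight ((m : ℝ) * r)) atTop (𝓝 1) := by
  have h1 : Tendsto (fun m : ℕ => 2 * Real.pi * ((m : ℝ) * r)) atTop atTop :=
    (tendsto_natCast_atTop_atTop.atTop_mul_const hr).const_mul_atTop Real.two_pi_pos
  have h2 := (Real.tendsto_exp_neg_atTop_nhds_zero.comp h1).const_sub 1
  have h3 := h2.inv₀ (by norm_num)
  simpa [boseWeight, Function.comp_def] using h3

theorem tendsto_boseWeight_neg {r : ℝ} (hr : 0 < r) :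
    Tendsto (fun m : ℕ => boseWeight ((m : ℝ) * -r)) atTop (𝓝 0) := by
  have h1 : Tendsto (fun m : ℕ => 2 * Real.pi * ((m : ℝ) * r)) atTop atTop :=
    (tendsto_natCast_atTop_atTop.atTop_mul_const hr).const_mul_atTop Real.two_pi_pos
  have h2 := tendsto_atTop_add_const_right _ (-1) (Real.tendsto_exp_atTop.comp h1)
  have h3 := h2.inv_tendsto_atTop.neg
  simp only [neg_zero] at h3
  refine h3.congr fun m => ?_
  rw [mul_neg, boseWeight_neg, nbe, one_div]
  rfl

theorem tendsto_prod_boseWeight {q : E → ℝ} (hq : ∀ e, 0 < q e) (D : Finset E) :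
    Tendsto (fun m : ℕ => ∏ e, boseWeight ((m : ℝ) * flipSigns D q e)) atTop
      (𝓝 (if D = ∅ then 1 else 0)) := by
  have h : Tendsto (fun m : ℕ => ∏ e, boseWeight ((m : ℝ) * flipSigns D q e)) atTop
      (𝓝 (∏ e, if e ∈ D then (0 : ℝ) else 1)) := by
    refine tendsto_finsetProd _ fun e _ => ?_
    by_cases he : e ∈ D
    · simpa [flipSigns, he] using tendsto_boseWeight_neg (hq e)
    · simpa [flipSigns, he] using tendsto_boseWeight_pos (hq e)
  convert h using 2
  split_ifs with hD
  · simp [hD]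
  · obtain ⟨e, he⟩ := Finset.nonempty_iff_ne_empty.2 hD
    rw [Finset.prod_eq_zero (Finset.mem_univ e) (by simp [he])]

variable {N} {T : Finset E}

/-- The rescaled sums have two limits: the integral, as Riemann sums, and the `D = ∅` term of the
chain formula, since every reversed line contributes an exponentially small Bose factor. -/
theorem integralValue_eq_chainIntegral_of_isGeneric (hG : (G.graphOn Set.univ).Connected)
    (hN : ∑ v, N v = 0) (hT : G.IsSpanningTree T) {q : E → ℝ} (hq : ∀ e, 0 < q e)
    (hgen : IsGeneric q) : G.integralValue N T q = G.chainIntegral N q := by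
  refine tendsto_nhds_unique (G.tendsto_matsubaraSum hT hN hq) ?_
  have h1 : Tendsto (fun m : ℕ => ∑ D : Finset E,
      (∏ e, boseWeight ((m : ℝ) * flipSigns D q e)) * G.chainIntegral N (flipSigns D q)) atTop
      (𝓝 (∑ D : Finset E, (if D = ∅ then 1 else 0) * G.chainIntegral N (flipSigns D q))) :=
    tendsto_finsetSum _ fun D _ => (tendsto_prod_boseWeight hq D).mul_const _
  have h2 : ∑ D : Finset E, (if D = ∅ then 1 else 0) * G.chainIntegral N (flipSigns D q) =
      G.chainIntegral N q := by
    simp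
  rw [h2] at h1
  refine h1.congr' ?_
  filter_upwards [eventually_gt_atTop 0] with m hm
  have hm' : (0 : ℝ) < m := by exact_mod_cast hm
  have hflip : ∀ D : Finset E, flipSigns D ((m : ℝ) • q) = (m : ℝ) • flipSigns D q := by
    intro D; funext e
    by_cases he : e ∈ D <;> simp [flipSigns, he]
  -- The powers of `m` cancel exactly because there are `|E| - |V| + 1` lines off the tree.
  have hcard : Fintype.card E + (Fintype.card V - 1) + Fintype.card {l // l ∉ T} =
      2 * Fintype.card E := by
    have h3 := hT.2
    have h4 := Finset.card_le_univ T
    rw [Fintype.card_subtype_compl, Fintype.card_coe]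
    omega
  rw [G.matsubaraSum_eq_sum_chainIntegral (fun v => m * N v) hG
    (by rw [← Finset.mul_sum, hN, mul_zero]) (q := (m : ℝ) • q) (fun e => mul_pos hm' (hq e))
    (hgen.smul hm'.ne'),
    Finset.mul_sum, Finset.mul_sum]
  refine Finset.sum_congr rfl fun D _ => ?_
  rw [hflip, G.chainIntegral_natCast_smul N _ m, ← hcard]
  simp only [Pi.smul_apply, smul_eq_mul]
  rw [pow_add (m : ℝ), inv_pow, inv_pow]
  field_simp

theorem integralValue_eq_chainIntegral (hG : (G.graphOn Set.univ).Connected)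
    (hN : ∑ v, N v = 0) (hT : G.IsSpanningTree T) {q : E → ℝ} (hq : ∀ e, 0 < q e) :
    G.integralValue N T q = G.chainIntegral N q :=
  eq_of_eq_generic hq (G.continuousAt_integralValue hT hN hq) (G.continuousAt_chainIntegral N hG hq)
    fun _ => G.integralValue_eq_chainIntegral_of_isGeneric hG hN hT

theorem isRationalValue_chainIntegral (hG : (G.graphOn Set.univ).Connected)
    (hN : ∑ v, N v = 0) (hT : G.IsSpanningTree T) {q : E → ℝ} (hq : q ∈ G.chainDomain N) :
    IsRationalValue (G.integralValue N T) q (G.chainIntegral N q) := by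
  obtain ⟨P, D, H⟩ := G.exists_chainIntegral_eq N
  refine ⟨P, D, fun x hx => ?_, (H q hq).1, ?_⟩
  · rw [G.integralValue_eq_chainIntegral hG hN hT hx]
    exact (H x (G.mem_chainDomain_of_pos N hG hx)).2
  · rw [(H q hq).2, mul_div_cancel_right₀ _ (H q hq).1]

end OrientedMultigraph

/-! ### Continuity of the operator terms. -/

section Continuity

variable {E : Type*} [DecidableEq E]

theorem continuousAt_nbe {x : ℝ} (hx : 0 < x) : ContinuousAt nbe x := by
  have h : 1 < Real.exp (2 * Real.pi * x) := Real.one_lt_exp_iff.2 (by positivity)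
  unfold nbe
  exact continuousAt_const.div (by fun_prop) (by linarith)

theorem continuous_flipSigns (D : Finset E) : Continuous (flipSigns D) := by
  refine continuous_pi fun e => ?_
  by_cases he : e ∈ D <;> simp only [flipSigns, he, if_true, if_false] <;> fun_prop

theorem continuousAt_termOp {f : (E → ℝ) → ℝ} {C : Finset E} {q : E → ℝ} (hq : ∀ e, 0 < q e)
    (hf : ∀ D ⊆ C, ContinuousAt f (flipSigns D q)) : ContinuousAt (termOp C f) q := by
  have h : termOp C f = fun q => (∏ i ∈ C, nbe (q i)) *
      ∑ D ∈ C.powerset, (-1) ^ D.card * f (flipSigns D q) := funext (termOp_apply C f)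
  rw [h]
  refine ContinuousAt.mul (tendsto_finsetProd _ fun i _ => ?_) (tendsto_finsetSum _ fun D hD => ?_)
  · exact (continuousAt_nbe (hq i)).tendsto.comp ((continuous_apply i).tendsto q)
  · exact ((hf D (Finset.mem_powerset.1 hD)).comp
      (continuous_flipSigns D).continuousAt).const_mul _

end Continuity

/-! ### The identity for the reduced operator. -/

namespace OrientedMultigraph

variable {V E : Type*} {G : OrientedMultigraph V E}

theorem graphOn_mono {A B : Set E} (h : A ⊆ B) : G.graphOn A ≤ G.graphOn B := by
  intro u v huv
  rw [graphOn, SimpleGraph.fromRel_adj] at huv ⊢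
  refine ⟨huv.1, huv.2.imp ?_ ?_⟩ <;> exact fun ⟨e, he, h'⟩ => ⟨e, h he, h'⟩

theorem IsCutset.mono {C D : Finset E} (h : C ⊆ D) (hC : G.IsCutset C) : G.IsCutset D :=
  fun hD => hC (hD.mono (graphOn_mono fun _ (he : _ ∉ D) hC => he (h hC)))

theorem not_isCutset_empty (hG : (G.graphOn Set.univ).Connected) : ¬ G.IsCutset ∅ := by
  simpa [IsCutset, Set.ofPred_true] using hG

theorem reducedOp_apply [Fintype E] [DecidableEq E] (f : (E → ℝ) → ℝ) (q : E → ℝ) :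
    open Classical in
    G.reducedOp f q = ∑ C : Finset E with ¬ G.IsCutset C, termOp C f q := by
  simp [reducedOp, LinearMap.sum_apply, Finset.sum_apply]

variable [Fintype V] [Fintype E] [DecidableEq V] [DecidableEq E]
variable {N : V → ℤ} {T : Finset E}

/-- The signs `(-1) ^ D.card` of `termOp` are compensated by those of `∏ 1 / q e`, so what remains
is the unsigned sum of the chain sums over reversals in `C`, which cancels. -/
theorem termOp_chainIntegral_eq_zero (hG : (G.graphOn Set.univ).Connected) (hN : ∑ v, N v = 0)
    {C : Finset E} (hC : G.IsCutset C) {q : E → ℝ} (hq : IsGeneric q) :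
    termOp C (G.chainIntegral N) q = 0 := by
  have := hG.nonempty
  obtain ⟨A, hA, hA', hAC⟩ := G.exists_boundary_subset_of_isCutset hC
  have h := congrArg Complex.re (G.sum_fullChainSum_eq_zero N hN hA hA' hAC
    fun D _ X => G.cutWeight_ne_zero N hG (hq.flipSigns D))
  rw [Complex.re_sum, Complex.zero_re] at h
  have h1 : ∀ D : Finset E, ∏ e, (flipSigns D q e)⁻¹ = (-1) ^ D.card * ∏ e, (q e)⁻¹ := by
    intro D
    have h2 : ∀ e, (flipSigns D q e)⁻¹ = (if e ∈ D then -1 else 1) * (q e)⁻¹ := by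
      intro e
      by_cases he : e ∈ D <;> simp [flipSigns, he, inv_neg]
    simp only [h2, Finset.prod_mul_distrib, Finset.prod_ite_mem, Finset.univ_inter,
      Finset.prod_const]
  rw [termOp_apply, mul_eq_zero]
  right
  have h3 : ∀ D ∈ C.powerset, (-1) ^ D.card * G.chainIntegral N (flipSigns D q) =
      (Real.pi ^ Fintype.card E / (2 * Real.pi) ^ (Fintype.card V - 1) * ∏ e, (q e)⁻¹) *
        (fullChainSum (G.cutWeight N (flipSigns D q))).re := by
    intro D _
    have h4 : (-1 : ℝ) ^ D.card * (-1) ^ D.card = 1 := by rw [← mul_pow]; simp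
    rw [chainIntegral, h1]
    linear_combination (Real.pi ^ Fintype.card E / (2 * Real.pi) ^ (Fintype.card V - 1) *
      (∏ e, (q e)⁻¹) * (fullChainSum (G.cutWeight N (flipSigns D q))).re) * h4
  rw [Finset.sum_congr rfl h3, ← Finset.mul_sum, h, mul_zero]

theorem matsubaraIntegral_eq_chainIntegral (hG : (G.graphOn Set.univ).Connected)
    (hN : ∑ v, N v = 0) (hT : G.IsSpanningTree T) {q : E → ℝ} (hq : q ∈ G.chainDomain N) :
    G.matsubaraIntegral N T q = G.chainIntegral N q :=
  rationalContinuation_eq (G.isRationalValue_chainIntegral hG hN hT hq)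

theorem mem_rationalDomain (hG : (G.graphOn Set.univ).Connected)
    (hN : ∑ v, N v = 0) (hT : G.IsSpanningTree T) {q : E → ℝ} (hq : q ∈ G.chainDomain N) :
    q ∈ rationalDomain (G.integralValue N T) :=
  ⟨_, G.isRationalValue_chainIntegral hG hN hT hq⟩

theorem mem_regularSet_of_isGeneric (hG : (G.graphOn Set.univ).Connected)
    (hN : ∑ v, N v = 0) (hT : G.IsSpanningTree T) {q : E → ℝ} (hq : ∀ e, 0 < q e)
    (hgen : IsGeneric q) : q ∈ G.regularSet N T :=
  ⟨hq, fun D _ => mem_rationalDomain hG hN hT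
    (G.mem_chainDomain_of_isGeneric N hG (hgen.flipSigns D))⟩

theorem matsubaraSum_eq_reducedOp_of_isGeneric (hG : (G.graphOn Set.univ).Connected)
    (hN : ∑ v, N v = 0) (hT : G.IsSpanningTree T) {q : E → ℝ} (hq : ∀ e, 0 < q e)
    (hgen : IsGeneric q) : G.matsubaraSum N q = G.reducedOp (G.matsubaraIntegral N T) q := by
  classical
  rw [G.matsubaraSum_eq_sum_chainIntegral N hG hN hq hgen, ← sum_termOp_apply _ hq,
    reducedOp_apply, Finset.sum_filter]
  refine Finset.sum_congr rfl fun C _ => ?_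
  split_ifs with hC
  · exact termOp_chainIntegral_eq_zero hG hN hC hgen
  · rw [termOp_apply, termOp_apply]
    congr 1
    refine Finset.sum_congr rfl fun D _ => ?_
    rw [matsubaraIntegral_eq_chainIntegral hG hN hT
      (G.mem_chainDomain_of_isGeneric N hG (hgen.flipSigns D))]

theorem matsubaraSum_eq_reducedOp (hG : (G.graphOn Set.univ).Connected)
    (hN : ∑ v, N v = 0) (hT : G.IsSpanningTree T) {q : E → ℝ} (hq : q ∈ G.regularSet N T) :
    G.matsubaraSum N q = G.reducedOp (G.matsubaraIntegral N T) q := by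
  classical
  refine eq_of_eq_generic hq.1 (G.continuousAt_matsubaraSum hq.1) ?_
    fun x hx hgen => matsubaraSum_eq_reducedOp_of_isGeneric hG hN hT hx hgen
  have h : G.reducedOp (G.matsubaraIntegral N T) =
      fun q => ∑ C : Finset E with ¬ G.IsCutset C, termOp C (G.matsubaraIntegral N T) q :=
    funext (reducedOp_apply _)
  rw [h]
  refine tendsto_finsetSum _ fun C hC => continuousAt_termOp hq.1 fun D hD => ?_
  -- Subsets of a non-cutset are non-cutsets, so regularity is available at every reflected point
  -- that occurs.
  exact continuousAt_rationalContinuation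
    (hq.2 D fun hD' => (Finset.mem_filter.1 hC).2 (hD'.mono hD))

/-- Sorting the non-cutsets by size exhausts them by degree `L`; the only surplus of the graded form
are the bridges. -/
theorem gradedOp_eq (hG : (G.graphOn Set.univ).Connected) :
    open Classical in
    G.gradedOp = G.reducedOp + ∑ i with G.IsCutset {i}, lineOp i := by
  classical
  set K : Finset (Finset E) := Finset.univ.filter fun C => ¬ G.IsCutset C with hK
  have h0 : K.filter (fun C => C.card = 0) = {∅} := by
    ext C
    simp only [hK, Finset.mem_filter, Finset.mem_univ, true_and, Finset.card_eq_zero,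
      Finset.mem_singleton]
    exact ⟨fun h => h.2, fun h => ⟨h ▸ not_isCutset_empty hG, h⟩⟩
  have h1 : ∑ C ∈ K with C.card = 1, termOp C = ∑ i with ¬ G.IsCutset {i}, lineOp i := by
    symm
    refine Finset.sum_bij (fun i _ => {i}) (fun i hi => ?_) (fun i _ j _ h => ?_) (fun C hC => ?_)
      fun i _ => (termOp_singleton i).symm
    · simpa [hK] using hi
    · simpa using h
    · simp only [hK, Finset.mem_filter, Finset.mem_univ, true_and, Finset.card_eq_one] at hC
      obtain ⟨hC, i, rfl⟩ := hC
      exact ⟨i, by simpa using hC, rfl⟩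
  have h2 : ∀ k, (Finset.powersetCard k Finset.univ).filter (fun C => ¬ G.IsCutset C) =
      K.filter fun C => C.card = k := by
    intro k
    ext C
    simp [hK, and_comm]
  have h3 : G.reducedOp = ∑ k ∈ insert 0 (insert 1 (Finset.Icc 2 G.cycleRank)),
      ∑ C ∈ K with C.card = k, termOp C := by
    rw [Finset.sum_fiberwise_of_maps_to, reducedOp]
    intro C hC
    have := G.card_le_cycleRank (Finset.mem_filter.1 hC).2
    simp only [Finset.mem_insert, Finset.mem_Icc]
    omega
  rw [h3, Finset.sum_insert (by simp), Finset.sum_insert (by simp), h0, h1, Finset.sum_singleton,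
    termOp_empty, gradedOp]
  simp only [h2]
  rw [← Finset.sum_filter_add_sum_filter_not Finset.univ (fun i => G.IsCutset {i})]
  abel

end OrientedMultigraph

/-- The hypothesis says that `f` depends on `x i` only through the factor `1 / (m² + x i²)`, which
is even. Regularity at the reflected point is derived here and not assumed: `regularSet` makes no
demand on reflections in cutsets, hence none on bridges. -/
theorem IsRationalValue.flipSigns_singleton {E : Type*} [DecidableEq E] {f : (E → ℝ) → ℝ} {i : E}
    {m : ℝ} (hf : ∀ x : E → ℝ, (∀ e, 0 < x e) → ∀ c : ℝ, 0 < c →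
      f x * (m ^ 2 + x i ^ 2) = f (Function.update x i c) * (m ^ 2 + c ^ 2))
    {q : E → ℝ} (hq : 0 < q i) {v : ℝ} (hv : IsRationalValue f q v) :
    IsRationalValue f (flipSigns {i} q) v := by
  obtain ⟨P, D, hPD, hD, rfl⟩ := hv
  set c := q i with hc
  -- Freezing the variable `i` at the positive value `q i` gives a representation in which it enters
  -- only through the explicit factor `m² + X i²`.
  set σ : E → MvPolynomial E ℝ := fun e => if e = i then MvPolynomial.C c else MvPolynomial.X e
  have hσ : ∀ (p : MvPolynomial E ℝ) (x : E → ℝ),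
      MvPolynomial.eval x (MvPolynomial.bind₁ σ p) =
        MvPolynomial.eval (Function.update x i c) p := by
    intro p x
    rw [← MvPolynomial.aeval_eq_eval, ← MvPolynomial.aeval_eq_eval, MvPolynomial.aeval_bind₁]
    congr 2
    funext e
    by_cases he : e = i
    · subst he; simp [σ]
    · simp [σ, he]
  have hup : Function.update (flipSigns {i} q) i c = q := by
    rw [_root_.flipSigns_singleton, Function.update_idem, hc, Function.update_eq_self]
  have hpos : m ^ 2 + c ^ 2 ≠ 0 := by positivity
  refine ⟨MvPolynomial.C (m ^ 2 + c ^ 2) * MvPolynomial.bind₁ σ P,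
    (MvPolynomial.C (m ^ 2) + MvPolynomial.X i ^ 2) * MvPolynomial.bind₁ σ D,
    fun x hx => ?_, ?_, ?_⟩
  · have hx' : ∀ e, 0 < Function.update x i c e := by
      intro e
      by_cases he : e = i
      · subst he; simpa using hq
      · simpa [he] using hx e
    simp only [map_mul, map_add, map_pow, hσ, MvPolynomial.eval_C, MvPolynomial.eval_X, hPD _ hx']
    linear_combination (-MvPolynomial.eval (Function.update x i c) D) * hf x hx c hq
  · simp only [map_mul, map_add, map_pow, hσ, MvPolynomial.eval_C, MvPolynomial.eval_X, hup]
    refine mul_ne_zero ?_ hD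
    simpa [flipSigns] using hpos
  · simp only [map_mul, map_add, map_pow, hσ, MvPolynomial.eval_C, MvPolynomial.eval_X, hup]
    have : flipSigns {i} q i ^ 2 = c ^ 2 := by simp [flipSigns, hc]
    rw [this, mul_div_mul_left _ _ hpos]

/-! ### Bridges and the graded operator. -/

namespace OrientedMultigraph

variable {V E : Type*} [Fintype V] [Fintype E] [DecidableEq V]
variable {G : OrientedMultigraph V E} {N : V → ℤ} {T : Finset E}

/-- Adding the constraints over one side of the bridge cancels all lines but the bridge, which must
carry the total of the `N v` there, up to sign. -/
theorem exists_sq_eq_of_isCutset_singleton (hG : (G.graphOn Set.univ).Connected) {i : E}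
    (hi : G.IsCutset {i}) : ∃ m : ℝ, ∀ x : E → ℝ, (∀ v, G.vertexSum x v = N v) →
      x i ^ 2 = m ^ 2 := by
  have := hG.nonempty
  obtain ⟨A, hA, hA', hAi⟩ := G.exists_boundary_subset_of_isCutset hi
  have hiA : i ∈ G.boundary A := by
    obtain ⟨e, he⟩ := G.boundary_nonempty hG hA hA'
    rwa [← Finset.mem_singleton.1 (hAi he)]
  refine ⟨∑ v ∈ A, (N v : ℝ), fun x hx => ?_⟩
  have h1 : ∀ e, ∑ v ∈ A, (G.sign v e : ℝ) =
      (if G.tgt e ∈ A then 1 else 0) - if G.src e ∈ A then 1 else 0 := by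
    intro e
    simp only [sign, Int.cast_sub, Int.cast_ite, Int.cast_one, Int.cast_zero,
      Finset.sum_sub_distrib, Finset.sum_ite_eq]
  have h2 : ∑ v ∈ A, (N v : ℝ) =
      ((if G.tgt i ∈ A then 1 else 0) - if G.src i ∈ A then 1 else 0) * x i := by
    simp only [← hx, vertexSum]
    rw [Finset.sum_comm]
    simp only [← Finset.sum_mul, h1]
    refine Finset.sum_eq_single i (fun e _ he => ?_) (by simp)
    have h3 : e ∉ G.boundary A := fun h => he (Finset.mem_singleton.1 (hAi h))
    rw [mem_boundary, not_not] at h3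
    simp [h3]
  rw [h2, mul_pow]
  rw [mem_boundary] at hiA
  by_cases h3 : G.src i ∈ A <;> by_cases h4 : G.tgt i ∈ A <;> simp_all

variable [DecidableEq E]

theorem integralValue_mul_of_sq_eq (hN : ∑ v, N v = 0) (hT : G.IsSpanningTree T)
    {i : E} {m : ℝ} (hm : ∀ x : E → ℝ, (∀ v, G.vertexSum x v = N v) → x i ^ 2 = m ^ 2)
    {q : E → ℝ} (hq : ∀ e, 0 < q e) {c : ℝ} (hc : 0 < c) :
    G.integralValue N T q * (m ^ 2 + q i ^ 2) =
      G.integralValue N T (Function.update q i c) * (m ^ 2 + c ^ 2) := by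
  rw [integralValue, integralValue, ← integral_mul_const, ← integral_mul_const]
  congr 1
  funext y
  have hi := hm _ (G.isSolution_solution hT hN y).1
  have h1 : ∀ r : E → ℝ, ∏ e, (G.solution N T y e ^ 2 + r e ^ 2) = (m ^ 2 + r i ^ 2) *
      ∏ e ∈ Finset.univ.erase i, (G.solution N T y e ^ 2 + r e ^ 2) := fun r => by
    rw [← Finset.mul_prod_erase _ _ (Finset.mem_univ i), hi]
  have h2 : ∏ e ∈ Finset.univ.erase i, (G.solution N T y e ^ 2 + Function.update q i c e ^ 2) =
      ∏ e ∈ Finset.univ.erase i, (G.solution N T y e ^ 2 + q e ^ 2) :=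
    Finset.prod_congr rfl fun e he => by rw [Function.update_of_ne (Finset.ne_of_mem_erase he)]
  have h3 : m ^ 2 + q i ^ 2 ≠ 0 := by have := hq i; positivity
  have h4 : m ^ 2 + c ^ 2 ≠ 0 := by positivity
  rw [integrand, integrand, h1, h1, h2, Function.update_self]
  field_simp

theorem lineOp_matsubaraIntegral_eq_zero (hG : (G.graphOn Set.univ).Connected)
    (hN : ∑ v, N v = 0) (hT : G.IsSpanningTree T) {i : E} (hi : G.IsCutset {i})
    {q : E → ℝ} (hq : ∀ e, 0 < q e) : lineOp i (G.matsubaraIntegral N T) q = 0 := by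
  obtain ⟨m, hm⟩ := exists_sq_eq_of_isCutset_singleton (N := N) hG hi
  have h := G.isRationalValue_chainIntegral hG hN hT (G.mem_chainDomain_of_pos N hG hq)
  have h' := h.flipSigns_singleton
    (fun x hx c hc => integralValue_mul_of_sq_eq hN hT hm hx hc) (hq i)
  rw [lineOp_apply, ← flipSigns_singleton, matsubaraIntegral, rationalContinuation_eq h,
    rationalContinuation_eq h', sub_self, mul_zero]

theorem gradedOp_matsubaraIntegral (hG : (G.graphOn Set.univ).Connected)
    (hN : ∑ v, N v = 0) (hT : G.IsSpanningTree T) {q : E → ℝ} (hq : ∀ e, 0 < q e) :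
    G.gradedOp (G.matsubaraIntegral N T) q = G.reducedOp (G.matsubaraIntegral N T) q := by
  classical
  rw [gradedOp_eq hG, LinearMap.add_apply, Pi.add_apply, LinearMap.sum_apply, Finset.sum_apply,
    Finset.sum_eq_zero fun i hi =>
      lineOp_matsubaraIntegral_eq_zero hG hN hT (Finset.mem_filter.1 hi).2 hq, add_zero]

end OrientedMultigraph

end

theorem theorem2 {V E : Type*} [Fintype V] [Fintype E] [DecidableEq V] [DecidableEq E]
    (G : OrientedMultigraph V E) (hG : G.IsMatsubara)
    (N : V → ℤ) (hN : ∑ v, N v = 0)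
    (T : Finset E) (hT : G.IsSpanningTree T) :
    -- the operator has degree at most `L`
    (∀ C : Finset E, ¬ G.IsCutset C → C.card ≤ G.cycleRank) ∧
    -- the variables off `T` are independent and determine the others
    (∀ y : {l // l ∉ T} → ℝ, ∃! x : E → ℝ, G.IsSolution N T y x) ∧
    ∀ q : E → ℝ, (∀ i, 0 < q i) →
      -- sum and integral converge, and the integral is a rational function of positive `q`
      Summable (G.summand N q) ∧
      Integrable (G.integrand N T q) ∧
      q ∈ rationalDomain (G.integralValue N T) ∧
      G.matsubaraIntegral N T q = G.integralValue N T q ∧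
      -- `S_G = Ô'_G I_G`, at the poles of individual terms by continuity
      q ∈ closure (G.regularSet N T) ∧
      ∀ O : Module.End ℝ ((E → ℝ) → ℝ), O = G.reducedOp ∨ O = G.gradedOp →
        (q ∈ G.regularSet N T → G.matsubaraSum N q = O (G.matsubaraIntegral N T) q) ∧
        Tendsto (O (G.matsubaraIntegral N T)) (𝓝[G.regularSet N T] q)
          (𝓝 (G.matsubaraSum N q)) := by

  have hc := hG.connected
  have key : ∀ O : Module.End ℝ ((E → ℝ) → ℝ), O = G.reducedOp ∨ O = G.gradedOp →
      ∀ q ∈ G.regularSet N T, G.matsubaraSum N q = O (G.matsubaraIntegral N T) q := by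
    rintro O (rfl | rfl) q hq
    · exact G.matsubaraSum_eq_reducedOp hc hN hT hq
    · rw [G.gradedOp_matsubaraIntegral hc hN hT hq.1]
      exact G.matsubaraSum_eq_reducedOp hc hN hT hq
  refine ⟨fun C => G.card_le_cycleRank, G.existsUnique_isSolution hT hN, fun q hq => ?_⟩
  have hdom := G.mem_chainDomain_of_pos N hc hq
  refine ⟨G.summable_summand N hq, G.integrable_integrand hT hN hq,
    G.mem_rationalDomain hc hN hT hdom, ?_, ?_, fun O hO => ⟨key O hO q, ?_⟩⟩
  · rw [G.matsubaraIntegral_eq_chainIntegral hc hN hT hdom,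
      G.integralValue_eq_chainIntegral hc hN hT hq]
  -- Generic positive points are regular, and they are dense in the open orthant.
  · exact closure_mono (fun x hx => G.mem_regularSet_of_isGeneric hc hN hT hx.1 hx.2)
      (mem_closure_generic hq)
  · refine ((G.continuousAt_matsubaraSum hq).tendsto.mono_left nhdsWithin_le_nhds).congr' ?_
    filter_upwards [self_mem_nhdsWithin] with x hx
    exact key O hO x hx
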